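/- Let $n\ge 1$ and let $W_{\rm af}=\langle s_0,s_1,\dots,s_n\rangle$ be the affine Weyl group of type $C_n$ (the Weyl group of $C_n^{(1)}$, with $s_0$ the affine generator), with length function $\ell$ and finite Weyl group $W=\langle s_1,\dots,s_n\rangle$. Let $P_\lambda$ and $Q_\lambda$ ($\lambda$ a strict partition) denote the Schur $P$- and $Q$-functions, $P_i=P_{(i)}$, and let $\Gamma_*=\bigoplus_\lambda\mathbb Z P_\lambda$ and $\Gamma^*=\bigoplus_\lambda\mathbb Z Q_\lambda$ be paired by $[P_\lambda,Q_\mu]=\delta_{\lambda\mu}$. Put $\Gamma_{(n)}=\mathbb Z[P_1,P_3,\dots,P_{2n-1}]\subset\Gamma_*$, and let $\Gamma^{(n)}$ be the quotient of $\Gamma^*$ by the annihilator of $\Gamma_{(n)}$, identified with the image of $\Gamma^*$ under deletion of all monomials with an exponent larger than $2n$. Let $\mathcal Z\subset W_{\rm af}$ be the set of elements having a reduced word that is a subword of a cyclic rotation of the word $0\,1\,2\cdots n\cdots 2\,1$ of length $2n$, and let $c(v)$ be the number of connected components, in the affine Dynkin diagram, of the set of simple generators occurring in a reduced word of $v$.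 For $w\in W_{\rm af}$ put $$Q^{(n)}_w=\sum_{(v^1,v^2,\dots)}\ \prod_i 2^{c(v^i)}\,y_i^{\ell(v^i)},$$ the sum over all factorizations $w=v^1v^2\cdots$ with $v^i\in\mathcal Z$ and $\sum_i\ell(v^i)=\ell(w)$. For a minimal length representative $w$ of a coset in $W_{\rm af}/W$, the type $C$ $k$-Schur function $P^{(n)}_w$ is the element of the homogeneous component of degree $\ell(w)$ of $\Gamma_{(n)}$ determined by $[P^{(n)}_w,Q^{(n)}_v]=\delta_{vw}$ for all minimal length coset representatives $v$ with $\ell(v)=\ell(w)$. **Proposition.** Let $w\in W_{\rm af}$ be a minimal length representative of a coset in $W_{\rm af}/W$, and suppose $n>\ell(w)$. Then there is a strict partition $\lambda$ such that $Q^{(n)}_w$ is the Schur $Q$-function $Q_\lambda$, and $P^{(n)}_w$ (which exists and is unique) is the Schur $P$-function $P_\lambda$. -/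

import Mathlib

noncomputable section

namespace TypeC

open MvPowerSeries

/-! ### Schur P- and Q-functions

Symmetric functions in `x₀, x₁, x₂, …` over `ℤ` are viewed inside the ring
`MvPowerSeries ℕ ℤ` of formal power series. -/

/-- A strict partition: a strictly decreasing list of positive integers. -/
structure StrictPartition where
  parts : List ℕ
  decreasing : parts.Pairwise (· > ·)
  pos : ∀ p ∈ parts, 0 < p

/-- The shifted Young diagram of `lam`: row `i` consists of the cells `(i, j)` with
`i ≤ j < i + lam_i` (rows and columns are numbered from `0`). -/
def StrictPartition.cells (lam : StrictPartition) : Finset (ℕ × ℕ) :=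
  (Finset.range lam.parts.length).biUnion fun i =>
    (Finset.Ico i (i + lam.parts.getD i 0)).image fun j => (i, j)

/-- The ordered alphabet `0' < 0 < 1' < 1 < 2' < 2 < ⋯`: the letter `i'` (marked) is
`(i, false)` and the letter `i` (unmarked) is `(i, true)`. -/
abbrev Letter : Type := ℕ ×ₗ Bool

/-- The index of the variable that belongs to a letter. -/
def Letter.index (a : Letter) : ℕ := (ofLex a).1

/-- The letter carries a mark. -/
def Letter.Marked (a : Letter) : Prop := (ofLex a).2 = false

/-- Marked shifted tableaux of shape `lam`: entries weakly increase along rows and down columns,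
a marked letter occurs at most once in each row, and an unmarked letter occurs at most once in
each column. -/
def IsMarkedShiftedTableau (lam : StrictPartition) (T : lam.cells → Letter) : Prop :=
  (∀ c d : lam.cells, c.1.1 = d.1.1 → c.1.2 < d.1.2 →
    T c ≤ T d ∧ (T c = T d → ¬ (T c).Marked)) ∧
  (∀ c d : lam.cells, c.1.2 = d.1.2 → c.1.1 < d.1.1 →
    T c ≤ T d ∧ (T c = T d → (T c).Marked))

/-- The tableau `T` has weight `x ^ α`: exactly `α i` of its entries are `i` or `i'`. -/
def HasContent (lam : StrictPartition) (T : lam.cells → Letter) (α : ℕ →₀ ℕ) : Prop :=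
  ∀ i, Nat.card {c : lam.cells // (T c).index = i} = α i

/-- The Schur Q-function: the generating function of all marked shifted tableaux. -/
def schurQ (lam : StrictPartition) : MvPowerSeries ℕ ℤ := fun α =>
  (Nat.card {T : lam.cells → Letter // IsMarkedShiftedTableau lam T ∧ HasContent lam T α} : ℤ)

/-- The Schur P-function: the generating function of the marked shifted tableaux without marks
on the main diagonal. -/
def schurP (lam : StrictPartition) : MvPowerSeries ℕ ℤ := fun α =>
  (Nat.card {T : lam.cells → Letter // IsMarkedShiftedTableau lam T ∧
    (∀ c : lam.cells, c.1.1 = c.1.2 → ¬ (T c).Marked) ∧ HasContent lam T α} : ℤ)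

/-- The one-row strict partition `(2 i + 1)`. -/
def oddRow (i : ℕ) : StrictPartition where
  parts := [2 * i + 1]
  decreasing := by simp
  pos := by simp

/-- The ring `Γ_(n) = ℤ[P₁, P₃, …, P_{2n-1}]`. -/
def GammaLower (n : ℕ) : Subalgebra ℤ (MvPowerSeries ℕ ℤ) :=
  Algebra.adjoin ℤ {f | ∃ i < n, f = schurP (oddRow i)}

/-- Deletion of all monomials in which some exponent exceeds `2 n`. -/
def truncation (n : ℕ) (f : MvPowerSeries ℕ ℤ) : MvPowerSeries ℕ ℤ :=
  open Classical in fun α => if ∀ i, α i ≤ 2 * n then coeff α f else 0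

/-- `PairingEq n f g c` says that `[f, g] = c`.

The lattices `Γ_*` and `Γ^*` spanned by the Schur P- and by the Schur Q-functions are dual under
`[P_lam, Q_mu] = δ_{lam, mu}`. The dual `Γ^(n)` of `Γ_(n) ⊆ Γ_*` is the quotient of `Γ^*` by the
annihilator of `Γ_(n)`, which consists of the elements of `Γ^*` whose truncation is zero.
An element of `Γ^(n)` is represented by the truncation `g` of any of its lifts
`G = ∑ b_mu Q_mu` to `Γ^*`, and `[f, g] = [f, G]` for `f = ∑ a_lam P_lam` in `Γ_(n)`. -/
def PairingEq (n : ℕ) (f g : MvPowerSeries ℕ ℤ) (c : ℤ) : Prop :=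
  ∃ a b : StrictPartition →₀ ℤ,
    f = (a.sum fun lam x => x • schurP lam) ∧
    g = truncation n (b.sum fun lam x => x • schurQ lam) ∧
    c = a.sum fun lam x => x * b lam

/-! ### The affine Weyl group of type C -/

/-- The Coxeter matrix of affine type `C_n`, with nodes `0, 1, …, n` on a path:
`m(0,1) = m(n-1,n) = 4`, the other edges have label `3`. If `n = 1` the only edge has
label `∞`, which is encoded by `0`. -/
def affineCMatrix (n : ℕ) : CoxeterMatrix (Fin (n + 1)) where
  M := Matrix.of fun i j =>
    if i = j then 1
    else if i.val + 1 = j.val ∨ j.val + 1 = i.val then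
      if n = 1 then 0
      else if i.val = 0 ∨ j.val = 0 ∨ i.val = n ∨ j.val = n then 4
      else 3
    else 2
  isSymm := by
    ext i j
    simp only [Matrix.transpose_apply, Matrix.of_apply]
    grind
  diagonal := by simp
  off_diagonal := by
    intro i j h
    simp only [Matrix.of_apply]
    grind

/-- The affine Weyl group `W_af` of type `C_n`. -/
abbrev AffineC (n : ℕ) : Type := (affineCMatrix n).Group

/-- The group `W_af` with its simple generators `s₀, …, s_n` as a Coxeter system. -/
abbrev coxC (n : ℕ) : CoxeterSystem (affineCMatrix n) (AffineC n) :=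
  (affineCMatrix n).toCoxeterSystem

/-- The length function of `W_af`. -/
def len {n : ℕ} (w : AffineC n) : ℕ := (coxC n).length w

/-- The finite Weyl group `W`, generated by `s₁, …, s_n`. -/
def finiteWeyl (n : ℕ) : Subgroup (AffineC n) :=
  Subgroup.closure {g | ∃ i : Fin (n + 1), i ≠ 0 ∧ g = (coxC n).simple i}

/-- `w` has minimal length in its coset `w W`. -/
def IsMinimalRep {n : ℕ} (w : AffineC n) : Prop :=
  ∀ u ∈ finiteWeyl n, len w ≤ len (w * u)

/-! ### The symmetric functions `Q^(n)_w` and `P^(n)_w` -/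

/-- The word `0 1 2 ⋯ n ⋯ 2 1` of length `2 n`. -/
def cyclicWord (n : ℕ) : List (Fin (n + 1)) :=
  List.finRange (n + 1) ++ (List.finRange (n + 1)).tail.dropLast.reverse

/-- `ω` is a reduced word of `v`. -/
def IsReducedWordOf {n : ℕ} (ω : List (Fin (n + 1))) (v : AffineC n) : Prop :=
  (coxC n).IsReduced ω ∧ (coxC n).wordProd ω = v

/-- The set `𝒵` of elements with a reduced word that is a subword of a rotation of
`0 1 2 ⋯ n ⋯ 2 1`. -/
def ZSet (n : ℕ) : Set (AffineC n) :=
  {v | ∃ ω, IsReducedWordOf ω v ∧ ∃ k, ω.Sublist ((cyclicWord n).rotate k)}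

/-- The support of `v`: the nodes that occur in a reduced word of `v`. -/
def support {n : ℕ} (v : AffineC n) : Set (Fin (n + 1)) :=
  {i | ∃ ω, IsReducedWordOf ω v ∧ i ∈ ω}

/-- The number of connected components of the support of `v` in the affine Dynkin diagram. -/
def numComponents {n : ℕ} (v : AffineC n) : ℕ :=
  Nat.card ((SimpleGraph.pathGraph (n + 1)).induce (support v)).ConnectedComponent

/-- The length-additive factorizations `w = v⁰ v¹ v² ⋯` with all factors in `𝒵` and almost all
factors equal to `1`. -/
def factorizations {n : ℕ} (w : AffineC n) : Set (ℕ → AffineC n) :=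
  {v | (∀ i, v i ∈ ZSet n) ∧ ∃ N, (∀ i, N ≤ i → v i = 1) ∧
    ((List.range N).map v).prod = w ∧ ∑ i ∈ Finset.range N, len (v i) = len w}

/-- `Q^(n)_w`, the sum of `∏ i, 2 ^ c(vⁱ) * y_i ^ ℓ(vⁱ)` over all factorizations of `w`. -/
def typeCQ (n : ℕ) (w : AffineC n) : MvPowerSeries ℕ ℤ := fun α =>
  ∑ᶠ v ∈ {v ∈ factorizations w | ∀ i, len (v i) = α i}, ∏ i ∈ α.support, 2 ^ numComponents (v i)

/-- `f` is the type C `k`-Schur function `P^(n)_w`: the element, homogeneous of degree `ℓ(w)`,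
of the basis of `Γ_(n)` dual to the basis `Q^(n)_v` of `Γ^(n)`, where `v` runs over the minimal
representatives. As the pairing is graded, only `v` of the same length as `w` matter. -/
def IsTypeCKSchur (n : ℕ) (w : AffineC n) (f : MvPowerSeries ℕ ℤ) : Prop :=
  f ∈ GammaLower n ∧ f.IsHomogeneous (len w) ∧
  ∀ v : AffineC n, IsMinimalRep v → len v = len w →
    PairingEq n f (typeCQ n v) (open Classical in if v = w then 1 else 0)

end TypeC

end

/-! Encode a strict partition by its height function `h`, where `h k` is the number of cells of
content `k` in the shifted diagram. The simple generators act on height functions by reflections: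
s_c adds a box of content c to a shape, removes one, or fixes the shape, and s_1, …, s_n fix the
empty shape. The size grows by at most one with each generator. Hence, for a shape of size at most
n, the word of contents in which it is built is reduced, and its product w_h is minimal in its coset
(`Builds.len_eq`). Conversely, read a reduced word of a minimal representative of length below n
from the right. Each letter must add a box: removing one contradicts reducedness, and if s_c fixes
the shape, then braid relations give s_c w_h = w_h s_d with d ≠ 0 (`exists_gen_mul_wordVal`), which
contradicts minimality. So these representatives correspond to strict partitions.

Under this dictionary the left factors from 𝒵 become skew shapes h/κ with at most one cell of each
content: between two boxes of content c, boxes of all neighbouring contents have to be added, and no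
rotation of the cyclic word allows this (`Builds.strip`). The components of the support are the
maximal intervals of contents, and 2^c counts the ways to mark the cells of the strip when all carry
one index. Thus factorizations and marked shifted tableaux are both counted by chains of strips, in
opposite orders; the order is immaterial because the operators that add strips commute
(`stripOp_comm`). This gives `typeCQ_shapeElt`.

Truncation changes nothing in degree at most 2n, so the pairings with the Q_μ of degree ℓ(w) read
off the coefficients of a homogeneous combination of P-functions. What remains is that the P_λ are
linearly independent, by leading monomials (`chainCount_independent`), and that P_λ lies in Γ_(n)
for |λ| ≤ 2n (`shapeP_mem`). The latter, like the commutation of the strip operators, rests on the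
Pieri rule (`pieri`). It is derived from an exchange formula for adding and removing strips
(`upSum_eq`), which a two-state transfer matrix verifies one content at a time. -/

noncomputable section

namespace TypeC

open Finset Polynomial

/-! ### Shapes

A strict partition is encoded by its height function: `h k` is the number of parts larger than
`k`, which is the number of cells of content `k` in the shifted diagram. -/

/-- The height functions of strict partitions. -/
def IsShape (h : ℕ →₀ ℕ) : Prop := ∀ k, h (k + 1) ≤ h k ∧ h k ≤ h (k + 1) + 1

/-- The skew shape `h / κ` has at most one cell of each content. -/
def Strip (κ h : ℕ →₀ ℕ) : Prop := ∀ k, κ k ≤ h k ∧ h k ≤ κ k + 1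

/-- The contents of the cells of `h / κ`. -/
def stripContents (κ h : ℕ →₀ ℕ) : Finset ℕ := h.support.filter fun k => κ k < h k

/-- The smallest elements of the maximal intervals contained in `U`; the element `0` is only
counted if `δ` is true. -/
def starts (δ : Bool) (U : Finset ℕ) : Finset ℕ :=
  U.filter fun k => if k = 0 then δ = true else k - 1 ∉ U

open Classical in
/-- The number of ways to mark the cells of `h / κ` when all of them carry the same index
(with marks on the diagonal if `δ` is true). -/
def stripWeight (δ : Bool) (κ h : ℕ →₀ ℕ) : ℤ :=
  if IsShape κ ∧ IsShape h ∧ Strip κ h then 2 ^ (starts δ (stripContents κ h)).card else 0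

theorem mem_stripContents {κ h : ℕ →₀ ℕ} {k : ℕ} : k ∈ stripContents κ h ↔ κ k < h k := by
  simp only [stripContents, mem_filter, Finsupp.mem_support_iff]
  omega

theorem IsShape.antitone {h : ℕ →₀ ℕ} (hh : IsShape h) : Antitone h :=
  antitone_nat_of_succ_le fun k => (hh k).1

theorem isShape_zero : IsShape 0 := fun k => by simp

theorem degree_eq_sum_range {h : ℕ →₀ ℕ} {K : ℕ} (hK : h.support ⊆ range K) :
    h.degree = ∑ k ∈ range K, h k := by
  rw [Finsupp.degree_apply]
  exact sum_subset hK fun x _ hx => by simpa using hx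

theorem IsShape.lt_degree {h : ℕ →₀ ℕ} (hh : IsShape h) {k : ℕ} (hk : h k ≠ 0) :
    k < h.degree := by
  have h1 : range (k + 1) ⊆ h.support := fun i hi => by
    have := hh.antitone (Nat.lt_succ_iff.1 (mem_range.1 hi))
    simp only [Finsupp.mem_support_iff]
    omega
  calc k < ∑ i ∈ range (k + 1), 1 := by simp
    _ ≤ ∑ i ∈ range (k + 1), h i := sum_le_sum fun i hi => by
        have := h1 hi
        simp only [Finsupp.mem_support_iff] at this
        omega
    _ ≤ h.degree := by
        rw [Finsupp.degree_apply]
        exact sum_le_sum_of_subset h1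

theorem IsShape.eq_zero_of_degree_le {h : ℕ →₀ ℕ} (hh : IsShape h) {k : ℕ}
    (hk : h.degree ≤ k) : h k = 0 := by
  by_contra h1
  exact absurd (hh.lt_degree h1) (by omega)

theorem IsShape.support_subset {h : ℕ →₀ ℕ} (hh : IsShape h) {K : ℕ} (hK : h.degree ≤ K) :
    h.support ⊆ range K := fun k hk => by
  have := hh.lt_degree (Finsupp.mem_support_iff.1 hk)
  simp only [mem_range]
  omega

open Classical in
/-- The shapes of size `d`. -/
def shapes (d : ℕ) : Finset (ℕ →₀ ℕ) := (finsuppAntidiag (range d) d).filter IsShape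

theorem mem_shapes {d : ℕ} {h : ℕ →₀ ℕ} : h ∈ shapes d ↔ IsShape h ∧ h.degree = d := by
  simp only [shapes, mem_filter, mem_finsuppAntidiag]
  constructor
  · rintro ⟨⟨h1, h2⟩, h3⟩
    exact ⟨h3, by rw [degree_eq_sum_range h2, h1]⟩
  · rintro ⟨h1, h2⟩
    have := h1.support_subset h2.le
    exact ⟨⟨by rw [← degree_eq_sum_range this, h2], this⟩, h1⟩

/-- The shapes of size at most `d`. -/
def shapesLE (d : ℕ) : Finset (ℕ →₀ ℕ) := (range (d + 1)).biUnion shapes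

theorem mem_shapesLE {d : ℕ} {h : ℕ →₀ ℕ} : h ∈ shapesLE d ↔ IsShape h ∧ h.degree ≤ d := by
  simp only [shapesLE, mem_biUnion, mem_shapes, mem_range]
  constructor
  · rintro ⟨a, h1, h2, h3⟩
    exact ⟨h2, by omega⟩
  · rintro ⟨h1, h2⟩
    exact ⟨_, by omega, h1, rfl⟩

theorem Strip.le {κ h : ℕ →₀ ℕ} (hs : Strip κ h) : κ ≤ h := fun k => (hs k).1

theorem Strip.degree_le {κ h : ℕ →₀ ℕ} (hs : Strip κ h) : κ.degree ≤ h.degree :=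
  Finsupp.degree_mono hs.le

theorem stripWeight_of_not {δ : Bool} {κ h : ℕ →₀ ℕ}
    (hs : ¬ (IsShape κ ∧ IsShape h ∧ Strip κ h)) : stripWeight δ κ h = 0 := if_neg hs

theorem stripWeight_ne_zero {δ : Bool} {κ h : ℕ →₀ ℕ} :
    stripWeight δ κ h ≠ 0 ↔ IsShape κ ∧ IsShape h ∧ Strip κ h := by
  simp only [stripWeight]
  split_ifs with h1 <;> simp [h1]

/-- The indicator function of a finite set of contents. -/
def ind (U : Finset ℕ) : ℕ →₀ ℕ := Finsupp.indicator U fun _ _ => 1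

theorem ind_apply (U : Finset ℕ) (k : ℕ) : ind U k = if k ∈ U then 1 else 0 := by
  simp [ind, Finsupp.indicator_apply]

theorem degree_ind (U : Finset ℕ) : (ind U).degree = U.card := by
  have : (ind U).support = U := by
    ext k; simp [ind_apply]
  rw [Finsupp.degree_apply, this, sum_congr rfl fun k hk => by rw [ind_apply, if_pos hk]]
  simp

theorem Strip.eq_add_ind {κ h : ℕ →₀ ℕ} (hs : Strip κ h) : h = κ + ind (stripContents κ h) := by
  ext k
  have := hs k
  simp only [Finsupp.add_apply, ind_apply, mem_stripContents]
  split_ifs <;> omega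

theorem Strip.degree_eq {κ h : ℕ →₀ ℕ} (hs : Strip κ h) :
    h.degree = κ.degree + (stripContents κ h).card := by
  conv_lhs => rw [hs.eq_add_ind]
  rw [map_add, degree_ind]

theorem strip_add_ind (κ : ℕ →₀ ℕ) (U : Finset ℕ) : Strip κ (κ + ind U) := fun k => by
  simp only [Finsupp.add_apply, ind_apply]
  split_ifs <;> omega

theorem stripContents_add_ind (κ : ℕ →₀ ℕ) (U : Finset ℕ) : stripContents κ (κ + ind U) = U := by
  ext k
  simp only [mem_stripContents, Finsupp.add_apply, ind_apply]
  split_ifs <;> simp_all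

/-! ### Sums over subsets of an initial segment by transfer matrices -/

section Transfer

variable {R : Type*} [CommRing R]

/-- The transfer matrix recursion with local weights `loc`. -/
def transfer (loc : ℕ → Bool → Bool → R) : ℕ → Bool → R
  | 0, e => if e then 0 else 1
  | K + 1, e => transfer loc K false * loc K false e + transfer loc K true * loc K true e

theorem transfer_succ (loc : ℕ → Bool → Bool → R) (K : ℕ) (e : Bool) :
    transfer loc (K + 1) e =
      transfer loc K false * loc K false e + transfer loc K true * loc K true e := rfl

/-- Whether the predecessor of `k` lies in `U`. -/
def prev (U : Finset ℕ) (k : ℕ) : Bool := decide (k ≠ 0 ∧ k - 1 ∈ U)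

theorem prod_loc_insert (loc : ℕ → Bool → Bool → R) {K : ℕ} (U : Finset ℕ) :
    ∏ k ∈ range K, loc k (prev (insert K U) k) (decide (k ∈ insert K U)) =
      ∏ k ∈ range K, loc k (prev U k) (decide (k ∈ U)) := by
  refine prod_congr rfl fun k hk => ?_
  have h1 : k ≠ K := by simp at hk; omega
  have h2 : k - 1 ≠ K := by simp at hk; omega
  simp [prev, h1, h2]

/-- Induction on `K`, splitting by whether `K` belongs to `U`. The test function `f` of the last
state is what makes the induction close. -/
theorem sum_powerset_prod_loc (loc : ℕ → Bool → Bool → R) (K : ℕ) (f : Bool → R) :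
    ∑ U ∈ (range K).powerset,
      (∏ k ∈ range K, loc k (prev U k) (decide (k ∈ U))) * f (prev U K) =
      transfer loc K false * f false + transfer loc K true * f true := by
  induction K generalizing f with
  | zero => simp [transfer, prev]
  | succ K ih =>
    rw [range_add_one, sum_powerset_insert (by simp)]
    have h1 : ∀ U ∈ (range K).powerset,
        (∏ k ∈ insert K (range K), loc k (prev U k) (decide (k ∈ U))) * f (prev U (K + 1)) =
        (∏ k ∈ range K, loc k (prev U k) (decide (k ∈ U))) *
          (fun e => loc K e false * f false) (prev U K) := by
      intro U hU
      have hK : K ∉ U := fun h => by simpa using mem_powerset.1 hU h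
      rw [prod_insert (by simp)]
      have : prev U (K + 1) = false := by simp [prev, hK]
      simp only [this, hK, decide_false]
      ring
    have h2 : ∀ U ∈ (range K).powerset,
        (∏ k ∈ insert K (range K), loc k (prev (insert K U) k) (decide (k ∈ insert K U))) *
          f (prev (insert K U) (K + 1)) =
        (∏ k ∈ range K, loc k (prev U k) (decide (k ∈ U))) *
          (fun e => loc K e true * f true) (prev U K) := by
      intro U hU
      rw [prod_insert (by simp), prod_loc_insert]
      have h3 : prev (insert K U) (K + 1) = true := by simp [prev]
      have h4 : prev (insert K U) K = prev U K := by
        simp only [prev, mem_insert]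
        congr 1
        refine propext (and_congr_right fun h => or_iff_right (by omega))
      simp only [h3, h4, mem_insert_self, decide_true]
      ring
    rw [sum_congr rfl h1, sum_congr rfl h2, ih fun e => loc K e false * f false,
      ih fun e => loc K e true * f true]
    simp only [transfer]
    ring

/-- The product runs one position beyond the range of `U`, so that the factor at `K` enforces the
shape condition between `K - 1` and `K`. -/
theorem sum_powerset_prod_loc_succ (loc : ℕ → Bool → Bool → R) (K : ℕ) :
    ∑ U ∈ (range K).powerset, ∏ k ∈ range (K + 1), loc k (prev U k) (decide (k ∈ U)) =
      transfer loc (K + 1) false := by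
  rw [transfer, ← sum_powerset_prod_loc loc K fun e => loc K e false]
  refine sum_congr rfl fun U hU => ?_
  have hK : K ∉ U := fun h => by simpa using mem_powerset.1 hU h
  rw [prod_range_succ]
  simp [hK]

end Transfer

/-! ### The commutation of adding and removing strips -/

/-- The local weight, at content `j`, of a strip `U` added to `m` such that the result is also
obtained by adding a strip to `k`. -/
def locUp (m k : ℕ → ℤ) (j : ℕ) (e e' : Bool) : ℤ[X] :=
  if (j = 0 ∨ m j + e'.toInt ≤ m (j - 1) + e.toInt ∧
        m (j - 1) + e.toInt ≤ m j + e'.toInt + 1) ∧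
      k j ≤ m j + e'.toInt ∧ m j + e'.toInt ≤ k j + 1 then
    (if e' then X else 1) * (if e' = true ∧ e = false then 2 else 1) *
      (if m j + e'.toInt = k j + 1 ∧ j ≠ 0 ∧ m (j - 1) + e.toInt ≠ k (j - 1) + 1 then 2 else 1)
  else 0

/-- The local weight, at content `j`, of a strip `U` removed from `k` such that the result is also
obtained by removing a strip from `m`. -/
def locDown (m k : ℕ → ℤ) (j : ℕ) (e e' : Bool) : ℤ[X] :=
  if (j = 0 ∨ k j - e'.toInt ≤ k (j - 1) - e.toInt ∧
        k (j - 1) - e.toInt ≤ k j - e'.toInt + 1) ∧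
      k j - e'.toInt ≤ m j ∧ m j ≤ k j - e'.toInt + 1 then
    (if e' then X else 1) * (if e' = true ∧ e = false then 2 else 1) *
      (if m j = k j - e'.toInt + 1 ∧ j ≠ 0 ∧ m (j - 1) ≠ k (j - 1) - e.toInt + 1 then 2 else 1)
  else 0

/-- The linear relations between the two transfer vectors. -/
def TransferRel (d : ℤ) (a0 a1 b0 b1 : ℤ[X]) : Prop :=
  (d = 0 → (1 - X) * a0 + a1 = (1 + X) * b0 ∧ 4 * X * a0 - (1 - X) * a1 = (1 + X) * b1) ∧
  (d = 1 → a0 = 0 ∧ b0 = 0 ∧ a1 = b1) ∧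
  (d = -1 → a1 = 0 ∧ b1 = 0 ∧ a0 = b0) ∧
  (d ≠ 0 → d ≠ 1 → d ≠ -1 → a0 = 0 ∧ a1 = 0 ∧ b0 = 0 ∧ b1 = 0)

theorem locUp_succ (m k : ℕ → ℤ) (j : ℕ) (e e' : Bool) {p d d' : ℤ} (hp : m j = m (j + 1) + p)
    (hd : k j = m j + d) (hd' : k (j + 1) = m (j + 1) + d') :
    locUp m k (j + 1) e e' =
      if (e'.toInt ≤ p + e.toInt ∧ p + e.toInt ≤ e'.toInt + 1) ∧ d' ≤ e'.toInt ∧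
          e'.toInt ≤ d' + 1 then
        (if e' then X else 1) * (if e' = true ∧ e = false then 2 else 1) *
          (if e'.toInt = d' + 1 ∧ e.toInt ≠ d + 1 then 2 else 1)
      else 0 := by
  simp only [locUp, Nat.add_sub_cancel]
  congr 1
  · exact propext (by omega)
  · congr 2
    exact propext (by omega)

theorem locDown_succ (m k : ℕ → ℤ) (j : ℕ) (e e' : Bool) {q d d' : ℤ}
    (hq : k j = k (j + 1) + q) (hd : k j = m j + d) (hd' : k (j + 1) = m (j + 1) + d') :
    locDown m k (j + 1) e e' =
      if (e.toInt ≤ q + e'.toInt ∧ q + e'.toInt ≤ e.toInt + 1) ∧ d' ≤ e'.toInt ∧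
          e'.toInt ≤ d' + 1 then
        (if e' then X else 1) * (if e' = true ∧ e = false then 2 else 1) *
          (if e'.toInt = d' + 1 ∧ e.toInt ≠ d + 1 then 2 else 1)
      else 0 := by
  simp only [locDown, Nat.add_sub_cancel]
  congr 1
  · exact propext (by omega)
  · congr 2
    exact propext (by omega)

/-- Let d be the difference of the two heights at the current content. A nonzero state requires d ∈
{-1, 0, 1}, and for d = ±1 only one of the two states survives. The relations for these cases are
chosen to be stable under one transfer step, whatever the drops p, q ∈ {0, 1} of the two height
functions are. -/
theorem transferRel {m k : ℕ → ℤ} (hm : ∀ j, m (j + 1) ≤ m j ∧ m j ≤ m (j + 1) + 1)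
    (hk : ∀ j, k (j + 1) ≤ k j ∧ k j ≤ k (j + 1) + 1) (j : ℕ) :
    TransferRel (k j - m j)
      (transfer (locUp m k) (j + 1) false) (transfer (locUp m k) (j + 1) true)
      (transfer (locDown m k) (j + 1) false) (transfer (locDown m k) (j + 1) true) := by
  induction j with
  | zero =>
    simp only [transfer, locUp, locDown, TransferRel]
    refine ⟨fun h => ?_, fun h => ?_, fun h => ?_, fun h1 h2 h3 => ?_⟩
    · obtain h : k 0 = m 0 := by omega
      simp [h]
      constructor <;> ring
    · obtain h : k 0 = m 0 + 1 := by omega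
      simp [h]
    · obtain h : m 0 = k 0 + 1 := by omega
      simp [h]
    · have h4 : ¬ (k 0 ≤ m 0 ∧ m 0 ≤ k 0 + 1) := by omega
      have h5 : ¬ (k 0 ≤ m 0 + 1 ∧ m 0 ≤ k 0) := by omega
      have h6 : ¬ (k 0 ≤ m 0 + 1 ∧ m 0 ≤ k 0 - 1 + 1) := by omega
      simp [h4, h5]
  | succ j ih =>
    obtain ⟨p, hp, hp'⟩ : ∃ p, m j = m (j + 1) + p ∧ (p = 0 ∨ p = 1) :=
      ⟨m j - m (j + 1), by omega, by have := hm j; omega⟩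
    obtain ⟨q, hq, hq'⟩ : ∃ q, k j = k (j + 1) + q ∧ (q = 0 ∨ q = 1) :=
      ⟨k j - k (j + 1), by omega, by have := hk j; omega⟩
    obtain ⟨d, hd⟩ : ∃ d, k j = m j + d := ⟨k j - m j, by omega⟩
    have hd' : k (j + 1) = m (j + 1) + (d + p - q) := by omega
    rw [show k (j + 1) - m (j + 1) = d + p - q by omega]
    simp only [transfer_succ _ (j + 1)]
    rw [show k j - m j = d by omega] at ih
    simp only [locUp_succ m k j _ _ hp hd hd', locDown_succ m k j _ _ hq hd hd']
    generalize transfer (locUp m k) (j + 1) false = a0 at *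
    generalize transfer (locUp m k) (j + 1) true = a1 at *
    generalize transfer (locDown m k) (j + 1) false = b0 at *
    generalize transfer (locDown m k) (j + 1) true = b1 at *
    clear hm hk hp hq hd hd'
    obtain ⟨i0, i1, i2, i3⟩ := ih
    by_cases h0 : d = 0
    · obtain ⟨r1, r2⟩ := i0 h0
      subst h0
      -- Eliminating the factor 1 + X from the two relations yields the relation needed when the
      -- difference leaves 0, that is, when p ≠ q.
      have hX : (1 + X : ℤ[X]) ≠ 0 := fun h => by simpa using congrArg (Polynomial.eval 0) h
      have r3 : a0 * 2 + a1 = b0 * 2 + b1 :=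
        mul_left_cancel₀ hX (by linear_combination 2 * r1 + r2)
      rcases hp' with rfl | rfl <;> rcases hq' with rfl | rfl <;>
        simp [TransferRel]
      · constructor
        · linear_combination r1
        · linear_combination X * r2 + 4 * X * r1
      · exact r3
      · linear_combination X * r3
      · constructor
        · linear_combination r1 + r2
        · linear_combination X * r2
    by_cases h1 : d = 1
    · obtain ⟨r1, r2, r3⟩ := i1 h1
      subst h1 r1 r2 r3
      rcases hp' with rfl | rfl <;> rcases hq' with rfl | rfl <;>
        simp [TransferRel]
      all_goals constructor <;> ring
    by_cases h2 : d = -1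
    · obtain ⟨r1, r2, r3⟩ := i2 h2
      subst h2 r1 r2 r3
      rcases hp' with rfl | rfl <;> rcases hq' with rfl | rfl <;>
        simp [TransferRel]
      all_goals constructor <;> ring
    obtain ⟨rfl, rfl, rfl, rfl⟩ := i3 h0 h1 h2
    simp [TransferRel]

end TypeC

end

/-! ### The exchange formula for adding and removing strips. -/

noncomputable section

namespace TypeC

open Finset Polynomial

theorem prod_ite_one {ι R : Type*} [CommRing R] (s : Finset ι) (p : ι → Prop) [DecidablePred p]
    (a : R) : ∏ i ∈ s, (if p i then a else 1) = a ^ (s.filter p).card := by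
  rw [prod_ite, prod_const, prod_const_one, mul_one]

theorem prod_local_weights {K : ℕ} {U V : Finset ℕ} (hU : U ⊆ range K) (hV : V ⊆ range K) :
    ∏ j ∈ range K, ((if decide (j ∈ U) = true then (X : ℤ[X]) else 1) *
      (if decide (j ∈ U) = true ∧ prev U j = false then 2 else 1) *
      (if j ∈ V ∧ j ≠ 0 ∧ j - 1 ∉ V then 2 else 1)) =
    X ^ U.card * C (2 ^ (starts true U).card * 2 ^ (starts false V).card) := by
  rw [prod_mul_distrib, prod_mul_distrib, prod_ite_one, prod_ite_one, prod_ite_one]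
  have h1 : (range K).filter (fun j => decide (j ∈ U) = true) = U := by
    ext j; simpa using fun h => mem_range.1 (hU h)
  have h2 : (range K).filter (fun j => decide (j ∈ U) = true ∧ prev U j = false) =
      starts true U := by
    ext j
    simp only [starts, prev, mem_filter]
    have := @hU j
    by_cases h : j = 0 <;> simp_all
  have h3 : (range K).filter (fun j => j ∈ V ∧ j ≠ 0 ∧ j - 1 ∉ V) = starts false V := by
    ext j
    simp only [starts, mem_filter]
    have := @hV j
    by_cases h : j = 0 <;> simp_all
  rw [h1, h2, h3, C_mul, C_pow, C_pow, mul_assoc]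
  rfl

theorem toInt_decide_mem (U : Finset ℕ) (j : ℕ) : (decide (j ∈ U)).toInt = (ind U j : ℤ) := by
  rw [ind_apply]
  split_ifs with h <;> simp [h]

theorem toInt_prev_succ (U : Finset ℕ) (j : ℕ) : (prev U (j + 1)).toInt = (ind U j : ℤ) := by
  rw [ind_apply]
  split_ifs with h <;> simp [prev, h]

theorem isShape_iff_of_support {h : ℕ →₀ ℕ} {K : ℕ} (hK : h.support ⊆ range K) :
    IsShape h ↔ ∀ j, j < K → h (j + 1) ≤ h j ∧ h j ≤ h (j + 1) + 1 := by
  refine ⟨fun hh j _ => hh j, fun hh j => ?_⟩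
  by_cases hj : j < K
  · exact hh j hj
  · have h1 : h j = 0 := by
      by_contra h1
      exact hj (mem_range.1 (hK (Finsupp.mem_support_iff.2 h1)))
    have h2 : h (j + 1) = 0 := by
      by_contra h1
      have := mem_range.1 (hK (Finsupp.mem_support_iff.2 h1))
      omega
    omega

theorem apply_eq_zero_of_support {h : ℕ →₀ ℕ} {K j : ℕ} (hK : h.support ⊆ range K) (hj : K ≤ j) :
    h j = 0 := by
  by_contra h1
  have := mem_range.1 (hK (Finsupp.mem_support_iff.2 h1))
  omega

theorem support_add_ind {μ : ℕ →₀ ℕ} {K : ℕ} {U : Finset ℕ} (hμ : μ.support ⊆ range K)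
    (hU : U ⊆ range K) : (μ + ind U).support ⊆ range K := by
  intro k hk
  by_contra h
  simp only [mem_range, not_lt] at h
  have h1 := apply_eq_zero_of_support hμ h
  have h2 : k ∉ U := fun h' => by simpa [h.not_gt] using hU h'
  simp [h1, h2, ind_apply] at hk

theorem stripContents_subset {κ h : ℕ →₀ ℕ} {K : ℕ} (hh : h.support ⊆ range K) :
    stripContents κ h ⊆ range K := (filter_subset _ _).trans hh

/-- All local factors are nonzero exactly when `μ + ind U` is a shape and a strip over `κ`. In that
case the powers of 2 count the starts of `U` and those of the contents of the second strip. -/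
theorem prod_locUp {μ κ : ℕ →₀ ℕ} (hμ : IsShape μ) (hκ : IsShape κ) {K : ℕ}
    (hμK : μ.support ⊆ range K) (hκK : κ.support ⊆ range K) {U : Finset ℕ} (hU : U ⊆ range K) :
    ∏ j ∈ range (K + 1), locUp (fun j => μ j) (fun j => κ j) j (prev U j) (decide (j ∈ U)) =
      X ^ U.card * C (stripWeight true μ (μ + ind U) * stripWeight false κ (μ + ind U)) := by
  have hl := support_add_ind hμK hU
  have hlj : ∀ j, (μ + ind U) j = μ j + ind U j := fun j => rfl
  by_cases hg : IsShape (μ + ind U) ∧ Strip κ (μ + ind U)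
  · obtain ⟨h1, h2⟩ := hg
    rw [stripWeight, if_pos ⟨hμ, h1, strip_add_ind μ U⟩, stripWeight, if_pos ⟨hκ, h1, h2⟩,
      stripContents_add_ind,
      ← prod_local_weights (K := K + 1) (hU.trans (range_mono (Nat.le_succ K)))
        ((stripContents_subset hl).trans (range_mono (Nat.le_succ K)))]
    refine prod_congr rfl fun j _ => ?_
    rw [locUp, toInt_decide_mem]
    have h3 := h2 j
    rw [hlj] at h3
    cases j with
    | zero =>
      rw [if_pos ⟨Or.inl rfl, by omega, by omega⟩]
      simp
    | succ j =>
      have h4 := h1 j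
      have h5 := h2 j
      simp only [hlj] at h4 h5
      rw [toInt_prev_succ, if_pos ⟨Or.inr ⟨by simp; omega, by simp; omega⟩, by omega, by omega⟩]
      congr 2
      simp only [mem_stripContents, hlj, Nat.add_sub_cancel]
      exact propext (by omega)
  · have : stripWeight true μ (μ + ind U) * stripWeight false κ (μ + ind U) = 0 := by
      by_contra h
      obtain ⟨h1, h2⟩ := mul_ne_zero_iff.1 h
      exact hg ⟨(stripWeight_ne_zero.1 h1).2.1, (stripWeight_ne_zero.1 h2).2.2⟩
    rw [this, C_0, mul_zero]
    by_contra h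
    rw [← ne_eq, prod_ne_zero_iff] at h
    have hc : ∀ j, j < K + 1 → _ := fun j hj => by
      have := h j (mem_range.2 hj)
      rw [locUp] at this
      exact (ite_ne_right_iff.1 this).1
    refine hg ⟨(isShape_iff_of_support hl).2 fun j hj => ?_, fun j => ?_⟩
    · have := (hc (j + 1) (by omega)).1
      simp only [toInt_prev_succ, toInt_decide_mem, Nat.add_sub_cancel] at this
      simp only [hlj]
      omega
    · by_cases hj : j < K + 1
      · have := (hc j hj).2
        simp only [toInt_decide_mem] at this
        simp only [hlj]
        omega
      · rw [apply_eq_zero_of_support hl (by omega), apply_eq_zero_of_support hκK (by omega)]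
        simp

theorem prod_locDown {μ κ : ℕ →₀ ℕ} (hμ : IsShape μ) (hκ : IsShape κ) {K : ℕ}
    (hμK : μ.support ⊆ range K) (hκK : κ.support ⊆ range K) {U : Finset ℕ} (hU : U ⊆ range K) :
    ∏ j ∈ range (K + 1), locDown (fun j => μ j) (fun j => κ j) j (prev U j) (decide (j ∈ U)) =
      X ^ U.card * C (if ind U ≤ κ then
        stripWeight true (κ - ind U) κ * stripWeight false (κ - ind U) μ else 0) := by
  have hlj : ∀ j, (κ - ind U) j = κ j - ind U j := fun j => rfl
  by_cases hg : ind U ≤ κ ∧ IsShape (κ - ind U) ∧ Strip (κ - ind U) μ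
  · obtain ⟨h0, h1, h2⟩ := hg
    have hκU : κ = (κ - ind U) + ind U := (tsub_add_cancel_of_le h0).symm
    have hs : Strip (κ - ind U) κ := by
      conv_rhs => rw [hκU]
      exact strip_add_ind _ _
    have hc : stripContents (κ - ind U) κ = U := by
      conv_lhs => rw [hκU, add_tsub_cancel_right]
      exact stripContents_add_ind _ _
    rw [if_pos h0, stripWeight, if_pos ⟨h1, hκ, hs⟩, stripWeight, if_pos ⟨h1, hμ, h2⟩, hc,
      ← prod_local_weights (K := K + 1) (hU.trans (range_mono (Nat.le_succ K)))
        ((stripContents_subset hμK).trans (range_mono (Nat.le_succ K)))]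
    refine prod_congr rfl fun j _ => ?_
    rw [locDown, toInt_decide_mem]
    have h3 := h2 j
    have h6 := h0 j
    rw [hlj] at h3
    cases j with
    | zero =>
      rw [if_pos ⟨Or.inl rfl, by omega, by omega⟩]
      simp
    | succ j =>
      have h4 := h1 j
      have h5 := h2 j
      have h7 := h0 j
      simp only [hlj] at h4 h5
      rw [toInt_prev_succ, if_pos ⟨Or.inr ⟨by simp; omega, by simp; omega⟩, by omega, by omega⟩]
      congr 2
      simp only [mem_stripContents, hlj, Nat.add_sub_cancel]
      exact propext (by omega)
  · have : (if ind U ≤ κ then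
        stripWeight true (κ - ind U) κ * stripWeight false (κ - ind U) μ else 0) = 0 := by
      by_contra h
      obtain ⟨h0, h⟩ := ite_ne_right_iff.1 h
      obtain ⟨h1, h2⟩ := mul_ne_zero_iff.1 h
      exact hg ⟨h0, (stripWeight_ne_zero.1 h1).1, (stripWeight_ne_zero.1 h2).2.2⟩
    rw [this, C_0, mul_zero]
    by_contra h
    rw [← ne_eq, prod_ne_zero_iff] at h
    have hc : ∀ j, j < K + 1 → _ := fun j hj => by
      have := h j (mem_range.2 hj)
      rw [locDown] at this
      exact (ite_ne_right_iff.1 this).1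
    have hstep : ∀ j, j < K → (κ (j + 1) : ℤ) - ind U (j + 1) ≤ κ j - ind U j ∧
        (κ j : ℤ) - ind U j ≤ κ (j + 1) - ind U (j + 1) + 1 := fun j hj => by
      have := (hc (j + 1) (by omega)).1
      simp only [toInt_prev_succ, toInt_decide_mem, Nat.add_sub_cancel] at this
      omega
    have hind : ∀ j, K ≤ j → ind U j = 0 := fun j hj => by
      rw [ind_apply, if_neg fun h' => by simpa [hj.not_gt] using hU h']
    -- The local conditions concern integers, whereas `κ - ind U` is a truncated difference.
    -- Nonnegativity follows by descending from content `K`: the integer difference is weakly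
    -- decreasing and nonnegative at `K`.
    have hpos : ∀ t, t ≤ K → (0 : ℤ) ≤ κ (K - t) - ind U (K - t) := by
      intro t
      induction t with
      | zero => intro _; rw [hind _ (by omega)]; simp
      | succ t ih =>
        intro ht
        have := (hstep (K - (t + 1)) (by omega)).1
        rw [show K - (t + 1) + 1 = K - t by omega] at this
        exact (ih (by omega)).trans this
    have h0 : ind U ≤ κ := fun j => by
      by_cases hj : j ≤ K
      · have := hpos (K - j) (by omega)
        rw [show K - (K - j) = j by omega] at this
        omega
      · rw [hind j (by omega)]; omega
    have hl : (κ - ind U).support ⊆ range K := fun j hj => hκK (by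
      simp only [Finsupp.mem_support_iff, hlj] at hj ⊢
      omega)
    refine hg ⟨h0, (isShape_iff_of_support hl).2 fun j hj => ?_, fun j => ?_⟩
    · have := hstep j hj
      have h1 := h0 j
      have h2 := h0 (j + 1)
      simp only [hlj]
      omega
    · have h1 := h0 j
      by_cases hj : j < K + 1
      · have := (hc j hj).2
        simp only [toInt_decide_mem] at this
        simp only [hlj]
        omega
      · rw [apply_eq_zero_of_support hl (by omega), apply_eq_zero_of_support hμK (by omega)]
        simp

/-- The generating coefficient for adding a strip of size `r` to `μ` and removing one to reach
`κ`. -/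
def upSum (μ κ : ℕ →₀ ℕ) (r : ℕ) : ℤ :=
  ∑ l ∈ shapes (μ.degree + r), stripWeight true μ l * stripWeight false κ l

/-- The generating coefficient for removing a strip from `μ` and adding one of size `s` to reach
`κ`. -/
def downSum (μ κ : ℕ →₀ ℕ) (s : ℕ) : ℤ :=
  ∑ l ∈ shapesLE κ.degree with l.degree + s = κ.degree,
    stripWeight true l κ * stripWeight false l μ

theorem coeff_transfer_locUp {μ κ : ℕ →₀ ℕ} (hμ : IsShape μ) (hκ : IsShape κ) {K r : ℕ}
    (hK : μ.degree + r ≤ K) (hκK : κ.support ⊆ range K) :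
    (transfer (locUp (fun j => μ j) fun j => κ j) (K + 1) false).coeff r = upSum μ κ r := by
  have hμK := hμ.support_subset (show μ.degree ≤ K by omega)
  rw [← sum_powerset_prod_loc_succ, sum_congr rfl fun U hU =>
    prod_locUp hμ hκ hμK hκK (mem_powerset.1 hU), finsetSum_coeff, upSum]
  simp only [coeff_X_pow_mul', coeff_C, Nat.sub_eq_zero_iff_le]
  symm
  refine sum_bij_ne_zero (fun l _ _ => stripContents μ l) ?_ ?_ ?_ ?_
  · intro l hl hn
    obtain ⟨h1, h2⟩ := mem_shapes.1 hl
    exact mem_powerset.2 (stripContents_subset (h1.support_subset (by omega)))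
  · intro l hl hn l' hl' hn' h
    have h1 := (stripWeight_ne_zero.1 (mul_ne_zero_iff.1 hn).1).2.2
    have h2 := (stripWeight_ne_zero.1 (mul_ne_zero_iff.1 hn').1).2.2
    rw [h1.eq_add_ind, h2.eq_add_ind, h]
  · intro U hU hn
    split_ifs at hn with h1 h2
    · refine ⟨μ + ind U, mem_shapes.2 ⟨?_, ?_⟩, hn, stripContents_add_ind μ U⟩
      · exact (stripWeight_ne_zero.1 (mul_ne_zero_iff.1 hn).1).2.1
      · rw [map_add, degree_ind]; omega
    all_goals exact absurd rfl hn
  · intro l hl hn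
    have h1 := (stripWeight_ne_zero.1 (mul_ne_zero_iff.1 hn).1).2.2
    have h2 := h1.degree_eq
    have h3 := (mem_shapes.1 hl).2
    rw [if_pos (by omega), if_pos (by omega), ← h1.eq_add_ind]

theorem coeff_transfer_locDown {μ κ : ℕ →₀ ℕ} (hμ : IsShape μ) (hκ : IsShape κ) {K : ℕ}
    (hμK : μ.support ⊆ range K) (hκK : κ.support ⊆ range K) (r : ℕ) :
    (transfer (locDown (fun j => μ j) fun j => κ j) (K + 1) false).coeff r = downSum μ κ r := by
  rw [← sum_powerset_prod_loc_succ, sum_congr rfl fun U hU =>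
    prod_locDown hμ hκ hμK hκK (mem_powerset.1 hU), finsetSum_coeff, downSum]
  simp only [coeff_X_pow_mul', coeff_C, Nat.sub_eq_zero_iff_le]
  symm
  refine sum_bij_ne_zero (fun l _ _ => stripContents l κ) ?_ ?_ ?_ ?_
  · intro l hl hn
    exact mem_powerset.2 (stripContents_subset hκK)
  · intro l hl hn l' hl' hn' h
    have h1 := (stripWeight_ne_zero.1 (mul_ne_zero_iff.1 hn).1).2.2
    have h2 := (stripWeight_ne_zero.1 (mul_ne_zero_iff.1 hn').1).2.2
    have h3 := h1.eq_add_ind.symm.trans h2.eq_add_ind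
    rw [h] at h3
    exact add_right_cancel h3
  · intro U hU hn
    split_ifs at hn with h1 h2 h3
    · have h4 := stripWeight_ne_zero.1 (mul_ne_zero_iff.1 hn).1
      have hκU : κ = (κ - ind U) + ind U := (tsub_add_cancel_of_le h3).symm
      refine ⟨κ - ind U, mem_filter.2 ⟨mem_shapesLE.2 ⟨h4.1, h4.2.2.degree_le⟩, ?_⟩, hn, ?_⟩
      · conv_rhs => rw [hκU]
        rw [map_add, degree_ind]; omega
      · conv_lhs => rw [hκU, add_tsub_cancel_right]
        exact stripContents_add_ind _ U
    all_goals exact absurd rfl hn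
  · intro l hl hn
    have h1 := (stripWeight_ne_zero.1 (mul_ne_zero_iff.1 hn).1).2.2
    have h2 := h1.degree_eq
    have h3 := (mem_filter.1 hl).2
    have h4 : κ - ind (stripContents l κ) = l :=
      tsub_eq_of_eq_add h1.eq_add_ind
    have h5 : ind (stripContents l κ) ≤ κ := by
      conv_rhs => rw [h1.eq_add_ind]
      exact le_add_self
    rw [if_pos (by omega), if_pos (by omega), if_pos h5, h4]

/-- Where both heights vanish, a new box of content `j` requires one of content `j - 1`. So the
occupied state only continues an interval, which costs one factor `X` and starts nothing new. -/
theorem transfer_locUp_true {m k : ℕ → ℤ} {K : ℕ} (hm : ∀ j, K ≤ j → m j = 0)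
    (hk : ∀ j, K ≤ j → k j = 0) (t : ℕ) :
    transfer (locUp m k) (K + 1 + t) true = X ^ t * transfer (locUp m k) (K + 1) true := by
  induction t with
  | zero => simp
  | succ t ih =>
    rw [← add_assoc, transfer_succ, ih, show K + 1 + t = (K + t) + 1 by ring]
    have h1 : m (K + t) = m (K + t + 1) + 0 := by rw [hm _ (by omega), hm _ (by omega), add_zero]
    have h2 : k (K + t) = m (K + t) + 0 := by rw [hk _ (by omega), hm _ (by omega), add_zero]
    have h3 : k (K + t + 1) = m (K + t + 1) + 0 := by
      rw [hk _ (by omega), hm _ (by omega), add_zero]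
    rw [locUp_succ m k _ _ _ h1 h2 h3, locUp_succ m k _ _ _ h1 h2 h3]
    simp
    ring

/-- This is (1 - X) · Up = (1 + X) · Down, coefficient by coefficient. Far beyond both shapes the
difference of heights is 0, so the first relation of `TransferRel` applies; its term for the
occupied state is divisible by a power of `X` too high to affect the coefficients under
consideration. -/
theorem upSum_relation {μ κ : ℕ →₀ ℕ} (hμ : IsShape μ) (hκ : IsShape κ) :
    upSum μ κ 0 = downSum μ κ 0 ∧ ∀ r, upSum μ κ (r + 1) - upSum μ κ r =
      downSum μ κ (r + 1) + downSum μ κ r := by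
  have key : ∀ r, ∀ s, s ≤ r →
      ((1 - X) * transfer (locUp (fun j => μ j) fun j => κ j)
        (μ.degree + κ.degree + r + 1 + 1) false).coeff s =
      ((1 + X) * transfer (locDown (fun j => μ j) fun j => κ j)
        (μ.degree + κ.degree + r + 1 + 1) false).coeff s := by
    intro r s hs
    have h := transferRel (m := fun j => μ j) (k := fun j => κ j)
      (fun j => by exact_mod_cast hμ j) (fun j => by exact_mod_cast hκ j)
      (μ.degree + κ.degree + r + 1)
    have h1 := (h.1 (by
      rw [hμ.eq_zero_of_degree_le (by omega), hκ.eq_zero_of_degree_le (by omega)]; rfl)).1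
    rw [← h1, coeff_add, left_eq_add,
      show μ.degree + κ.degree + r + 1 + 1 = μ.degree + κ.degree + 1 + (r + 1) by ring,
      transfer_locUp_true, coeff_X_pow_mul', if_neg (by omega)]
    · exact fun j hj => by simp [hμ.eq_zero_of_degree_le (show μ.degree ≤ j by omega)]
    · exact fun j hj => by simp [hκ.eq_zero_of_degree_le (show κ.degree ≤ j by omega)]
  have hA : ∀ r s, s ≤ r → (transfer (locUp (fun j => μ j) fun j => κ j)
      (μ.degree + κ.degree + r + 1 + 1) false).coeff s = upSum μ κ s := fun r s hs =>
    coeff_transfer_locUp hμ hκ (by omega) (hκ.support_subset (by omega))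
  have hB : ∀ r s, (transfer (locDown (fun j => μ j) fun j => κ j)
      (μ.degree + κ.degree + r + 1 + 1) false).coeff s = downSum μ κ s := fun r s =>
    coeff_transfer_locDown hμ hκ (hμ.support_subset (by omega)) (hκ.support_subset (by omega)) s
  constructor
  · have := key 0 0 le_rfl
    rw [sub_mul, add_mul, one_mul, one_mul, coeff_sub, coeff_add, coeff_X_mul_zero,
      coeff_X_mul_zero, hA 0 0 le_rfl, hB 0 0] at this
    simpa using this
  · intro r
    have := key (r + 1) (r + 1) le_rfl
    rwa [sub_mul, add_mul, one_mul, one_mul, coeff_sub, coeff_add, coeff_X_mul,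
      coeff_X_mul, hA _ _ le_rfl, hA _ _ (Nat.le_succ r), hB, hB] at this

/-- The coefficients of `(1 + t) / (1 - t)`. -/
def qCoeff (b : ℕ) : ℤ := if b = 0 then 1 else 2

/-- Up = Down · (1 + X) / (1 - X). This factor is the contribution of one variable to the generating
function of the q_r, which drives the induction in `pieri_chainSum`. -/
theorem upSum_eq {μ κ : ℕ →₀ ℕ} (hμ : IsShape μ) (hκ : IsShape κ) (r : ℕ) :
    upSum μ κ r = ∑ b ∈ range (r + 1), qCoeff b * downSum μ κ (r - b) := by
  obtain ⟨h0, h1⟩ := upSum_relation hμ hκ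
  have h2 : ∀ r, upSum μ κ r = downSum μ κ r + 2 * ∑ s ∈ range r, downSum μ κ s := by
    intro r
    induction r with
    | zero => simpa using h0
    | succ r ih =>
      rw [sum_range_succ]
      linear_combination h1 r + ih
  rw [h2, sum_range_succ', mul_sum, ← sum_range_reflect, add_comm]
  congr 1
  · refine sum_congr rfl fun b hb => ?_
    simp only [qCoeff, Nat.add_eq_zero_iff, one_ne_zero, and_false, if_false]
    congr 2
    omega
  · simp [qCoeff]

end TypeC

end

noncomputable section

namespace TypeC

open Finset

/-! ### Sums over chains of shapes and the Pieri rule -/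

section Chains

variable {R : Type*} [CommRing R]

/-- The generating function, in the variables `x 0, …, x (N - 1)`, of the chains of strips from
the empty shape to `h`. -/
def chainSum (δ : Bool) (x : ℕ → R) : ℕ → (ℕ →₀ ℕ) → R
  | 0, h => if h = 0 then 1 else 0
  | N + 1, h => ∑ κ ∈ shapesLE h.degree,
      (stripWeight δ κ h : R) * x N ^ (h.degree - κ.degree) * chainSum δ x N κ

/-- The coefficient of `t ^ r` in `∏ i < N, (1 + x i * t) / (1 - x i * t)`. -/
def qSum (x : ℕ → R) : ℕ → ℕ → R
  | 0, r => if r = 0 then 1 else 0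
  | N + 1, r => ∑ b ∈ range (r + 1), (qCoeff b : R) * x N ^ b * qSum x N (r - b)

theorem chainSum_succ (δ : Bool) (x : ℕ → R) (N : ℕ) (h : ℕ →₀ ℕ) :
    chainSum δ x (N + 1) h = ∑ κ ∈ shapesLE h.degree,
      (stripWeight δ κ h : R) * x N ^ (h.degree - κ.degree) * chainSum δ x N κ := rfl

theorem chainSum_succ_of_le (δ : Bool) (x : ℕ → R) (N : ℕ) {h : ℕ →₀ ℕ} {D : ℕ}
    (hD : h.degree ≤ D) :
    chainSum δ x (N + 1) h = ∑ κ ∈ shapesLE D,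
      (stripWeight δ κ h : R) * x N ^ (h.degree - κ.degree) * chainSum δ x N κ := by
  refine sum_subset (fun κ hκ => ?_) fun κ hκ hn => ?_
  · rw [mem_shapesLE] at hκ ⊢
    exact ⟨hκ.1, hκ.2.trans hD⟩
  · rw [stripWeight_of_not, Int.cast_zero, zero_mul, zero_mul]
    rintro ⟨h1, h2, h3⟩
    exact hn (mem_shapesLE.2 ⟨h1, h3.degree_le⟩)

/-- Induction on the number of variables. Splitting off the last variable means adding a strip to
`μ` and then removing one. By `upSum_eq` the removal may come first, at the price of the factor (1 +
xt)/(1 - xt); the induction hypothesis treats the remaining addition, and the factor turns q_r in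
`N` variables into q_r in `N + 1` variables. -/
theorem pieri_chainSum (x : ℕ → R) (N : ℕ) {μ : ℕ →₀ ℕ} (hμ : IsShape μ) (r : ℕ) :
    ∑ l ∈ shapes (μ.degree + r), (stripWeight true μ l : R) * chainSum false x N l =
      chainSum false x N μ * qSum x N r := by
  induction N generalizing μ r with
  | zero =>
    simp only [chainSum, qSum, mul_ite, mul_one, mul_zero]
    by_cases hr : r = 0
    · subst hr
      rw [if_pos rfl]
      by_cases h0 : μ = 0
      · subst h0
        rw [sum_eq_single_of_mem 0 (mem_shapes.2 ⟨isShape_zero, by simp⟩)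
          fun b _ hb => if_neg hb, if_pos rfl, if_pos rfl, stripWeight,
          if_pos ⟨isShape_zero, isShape_zero, fun k => by simp⟩]
        simp [stripContents, starts]
      · rw [if_neg h0]
        refine sum_eq_zero fun l hl => if_neg ?_
        rintro rfl
        have h1 := (mem_shapes.1 hl).2
        rw [map_zero, add_zero, eq_comm, Finsupp.degree_eq_zero_iff] at h1
        exact h0 h1
    · rw [if_neg hr]
      refine sum_eq_zero fun l hl => if_neg ?_
      rintro rfl
      have h1 := (mem_shapes.1 hl).2
      rw [map_zero] at h1
      omega
  | succ N ih =>
    set D := μ.degree + r with hD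
    have h1 : ∀ κ ∈ shapesLE D,
        ∑ l ∈ shapes D, (stripWeight true μ l : R) *
          ((stripWeight false κ l : R) * x N ^ (l.degree - κ.degree) * chainSum false x N κ) =
        (upSum μ κ r : R) * x N ^ (D - κ.degree) * chainSum false x N κ := by
      intro κ _
      rw [upSum, Int.cast_sum, sum_mul, sum_mul]
      refine sum_congr rfl fun l hl => ?_
      rw [(mem_shapes.1 hl).2]
      push_cast
      ring
    -- Exchange of the two operations: here `ρ` is obtained by removing a strip from `μ`, and `κ` by
    -- adding a strip of size `r - b` to `ρ`.
    have h2 : ∀ κ ∈ shapesLE D,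
        (upSum μ κ r : R) * x N ^ (D - κ.degree) * chainSum false x N κ =
        ∑ b ∈ range (r + 1), ∑ ρ ∈ shapesLE D,
          if κ.degree = ρ.degree + (r - b) then
            (qCoeff b : R) * x N ^ b * (stripWeight false ρ μ : R) *
              x N ^ (μ.degree - ρ.degree) * ((stripWeight true ρ κ : R) * chainSum false x N κ)
          else 0 := by
      intro κ hκ
      obtain ⟨hκ1, hκ2⟩ := mem_shapesLE.1 hκ
      rw [upSum_eq hμ hκ1, Int.cast_sum, sum_mul, sum_mul]
      refine sum_congr rfl fun b hb => ?_
      rw [downSum, Int.cast_mul, Int.cast_sum, mul_sum, sum_mul, sum_mul, sum_filter]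
      have h4 : ∀ ρ : ℕ →₀ ℕ, (if ρ.degree + (r - b) = κ.degree then
          (qCoeff b : R) * ((stripWeight true ρ κ * stripWeight false ρ μ : ℤ) : R) *
            x N ^ (D - κ.degree) * chainSum false x N κ else 0) =
          if κ.degree = ρ.degree + (r - b) then
            (qCoeff b : R) * x N ^ b * (stripWeight false ρ μ : R) *
              x N ^ (μ.degree - ρ.degree) * ((stripWeight true ρ κ : R) * chainSum false x N κ)
          else 0 := by
        intro ρ
        by_cases h5 : κ.degree = ρ.degree + (r - b)
        · rw [if_pos h5, if_pos h5.symm]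
          by_cases h6 : stripWeight false ρ μ = 0
          · simp [h6]
          · have h7 := (stripWeight_ne_zero.1 h6).2.2.degree_le
            have h8 : D - κ.degree = b + (μ.degree - ρ.degree) := by
              simp only [mem_range] at hb
              omega
            rw [h8, pow_add]
            push_cast
            ring
        · rw [if_neg h5, if_neg (Ne.symm h5)]
      rw [← sum_congr rfl fun ρ _ => h4 ρ]
      refine sum_subset (fun ρ hρ => ?_) fun ρ hρ hn => ?_
      · rw [mem_shapesLE] at hρ ⊢
        exact ⟨hρ.1, hρ.2.trans hκ2⟩
      · rw [stripWeight_of_not (δ := true)]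
        · simp
        · rintro ⟨h1, h2, h3⟩
          exact hn (mem_shapesLE.2 ⟨h1, h3.degree_le⟩)
    have h3 : ∀ b ∈ range (r + 1), ∀ ρ ∈ shapesLE D, ∑ κ ∈ shapesLE D,
        (if κ.degree = ρ.degree + (r - b) then
            (qCoeff b : R) * x N ^ b * (stripWeight false ρ μ : R) *
              x N ^ (μ.degree - ρ.degree) * ((stripWeight true ρ κ : R) * chainSum false x N κ)
          else 0) =
        (stripWeight false ρ μ : R) * x N ^ (μ.degree - ρ.degree) * chainSum false x N ρ *
          ((qCoeff b : R) * x N ^ b * qSum x N (r - b)) := by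
      intro b hb ρ hρ
      by_cases h6 : stripWeight false ρ μ = 0
      · simp [h6]
      · have h7 := (stripWeight_ne_zero.1 h6).2.2.degree_le
        have h8 := ih (mem_shapesLE.1 hρ).1 (r - b)
        rw [← sum_filter, ← mul_sum]
        have h9 : (shapesLE D).filter (fun κ => κ.degree = ρ.degree + (r - b)) =
            shapes (ρ.degree + (r - b)) := by
          ext κ
          simp only [mem_filter, mem_shapesLE, mem_shapes]
          constructor
          · rintro ⟨⟨h1, h2⟩, h3⟩
            exact ⟨h1, h3⟩
          · rintro ⟨h1, h2⟩
            exact ⟨⟨h1, by omega⟩, h2⟩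
        rw [h9, h8]
        ring
    calc ∑ l ∈ shapes D, (stripWeight true μ l : R) * chainSum false x (N + 1) l
        = ∑ l ∈ shapes D, ∑ κ ∈ shapesLE D, (stripWeight true μ l : R) *
          ((stripWeight false κ l : R) * x N ^ (l.degree - κ.degree) * chainSum false x N κ) := by
          refine sum_congr rfl fun l hl => ?_
          rw [chainSum_succ, (mem_shapes.1 hl).2, mul_sum]
      _ = ∑ κ ∈ shapesLE D, (upSum μ κ r : R) * x N ^ (D - κ.degree) * chainSum false x N κ := by
          rw [sum_comm, sum_congr rfl h1]
      _ = ∑ b ∈ range (r + 1), ∑ ρ ∈ shapesLE D,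
            (stripWeight false ρ μ : R) * x N ^ (μ.degree - ρ.degree) * chainSum false x N ρ *
              ((qCoeff b : R) * x N ^ b * qSum x N (r - b)) := by
          rw [sum_congr rfl h2, sum_comm]
          refine sum_congr rfl fun b hb => ?_
          rw [sum_comm, sum_congr rfl (h3 b hb)]
      _ = chainSum false x (N + 1) μ * qSum x (N + 1) r := by
          rw [chainSum_succ_of_le false x N (show μ.degree ≤ D by omega), qSum, sum_mul_sum,
            sum_comm]

/-! ### The relations between the functions `q_r` -/

theorem mk_qSum_succ (x : ℕ → R) (N : ℕ) :
    PowerSeries.mk (qSum x (N + 1)) =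
      PowerSeries.mk (fun b => (qCoeff b : R) * x N ^ b) * PowerSeries.mk (qSum x N) := by
  ext r
  rw [PowerSeries.coeff_mk, PowerSeries.coeff_mul, Nat.sum_antidiagonal_eq_sum_range_succ_mk, qSum]
  simp

theorem mk_qCoeff_mul (a : R) :
    (1 - PowerSeries.C a * PowerSeries.X) * PowerSeries.mk (fun b => (qCoeff b : R) * a ^ b) =
      1 + PowerSeries.C a * PowerSeries.X := by
  ext r
  rw [sub_mul, one_mul, map_sub, PowerSeries.coeff_mk, mul_assoc, PowerSeries.coeff_C_mul, map_add,
    PowerSeries.coeff_C_mul, PowerSeries.coeff_one]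
  match r with
  | 0 => simp [qCoeff]
  | 1 => simp [qCoeff, PowerSeries.coeff_succ_X_mul]; ring
  | r + 2 =>
    simp [qCoeff, PowerSeries.coeff_succ_X_mul, PowerSeries.coeff_X]
    ring

/-- The series (1 + at)/(1 - at) is inverted by changing the sign of a. -/
theorem mk_qCoeff_mul_neg (a : R) :
    PowerSeries.mk (fun b => (qCoeff b : R) * a ^ b) *
      PowerSeries.mk (fun b => (qCoeff b : R) * (-a) ^ b) = 1 := by
  have h1 := mk_qCoeff_mul a
  have h2 := mk_qCoeff_mul (-a)
  have hu : IsUnit (1 - PowerSeries.C a * PowerSeries.X : PowerSeries R) := by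
    simp [PowerSeries.isUnit_iff_constantCoeff]
  have hv : IsUnit (1 + PowerSeries.C a * PowerSeries.X : PowerSeries R) := by
    simp [PowerSeries.isUnit_iff_constantCoeff]
  rw [map_neg, neg_mul, sub_neg_eq_add, ← sub_eq_add_neg] at h2
  refine (hu.mul hv).mul_left_cancel ?_
  linear_combination (1 + PowerSeries.C a * PowerSeries.X) *
    PowerSeries.mk (fun b => (qCoeff b : R) * (-a) ^ b) * h1 +
    (1 + PowerSeries.C a * PowerSeries.X) * h2

theorem mk_qSum_mul_neg (x : ℕ → R) (N : ℕ) :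
    PowerSeries.mk (qSum x N) * PowerSeries.mk (qSum (fun i => -x i) N) = 1 := by
  induction N with
  | zero =>
    have : ∀ y : ℕ → R, PowerSeries.mk (qSum y 0) = 1 := fun y => by
      ext r; simp [qSum, PowerSeries.coeff_one]
    simp [this]
  | succ N ih =>
    rw [mk_qSum_succ, mk_qSum_succ]
    rw [mul_mul_mul_comm, mk_qCoeff_mul_neg, ih, one_mul]

theorem qSum_neg (x : ℕ → R) (N r : ℕ) : qSum (fun i => -x i) N r = (-1) ^ r * qSum x N r := by
  induction N generalizing r with
  | zero => by_cases hr : r = 0 <;> simp [qSum, hr]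
  | succ N ih =>
    rw [qSum, qSum, mul_sum]
    refine sum_congr rfl fun b hb => ?_
    have : r = b + (r - b) := by simp only [mem_range] at hb; omega
    rw [ih, neg_pow (x N) b]
    conv_rhs => rw [this]
    rw [pow_add, Nat.add_sub_cancel_left]
    ring

/-- This is the coefficient of t^r in q(t) q(-t) = 1. -/
theorem qSum_relation (x : ℕ → R) (N : ℕ) {r : ℕ} (hr : r ≠ 0) :
    ∑ j ∈ range (r + 1), (-1) ^ j * qSum x N j * qSum x N (r - j) = 0 := by
  have h := congrArg (PowerSeries.coeff r) (mk_qSum_mul_neg x N)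
  rw [mul_comm, PowerSeries.coeff_mul, Nat.sum_antidiagonal_eq_sum_range_succ_mk,
    PowerSeries.coeff_one, if_neg hr] at h
  rw [← h]
  refine sum_congr rfl fun j _ => ?_
  rw [PowerSeries.coeff_mk, PowerSeries.coeff_mk, qSum_neg]

end Chains

end TypeC

end

noncomputable section

namespace TypeC

open Finset

/-! ### Marked shifted tableaux and chains of strips -/

theorem IsShape.le_add {h : ℕ →₀ ℕ} (hh : IsShape h) (k t : ℕ) : h k ≤ h (k + t) + t := by
  induction t with
  | zero => simp
  | succ t ih =>
    have := (hh (k + t)).2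
    rw [add_assoc] at this
    omega

/-- The cells of the shifted diagram with height function `h`. -/
def cellSet (h : ℕ →₀ ℕ) : Set (ℕ × ℕ) := {c | c.1 ≤ c.2 ∧ c.1 < h (c.2 - c.1)}

theorem mem_cellSet {h : ℕ →₀ ℕ} {i j : ℕ} : (i, j) ∈ cellSet h ↔ i ≤ j ∧ i < h (j - i) := Iff.rfl

theorem mem_cellSet_diag {h : ℕ →₀ ℕ} {i k : ℕ} : (i, i + k) ∈ cellSet h ↔ i < h k := by
  simp [mem_cellSet]

theorem cellSet_eq_coe (h : ℕ →₀ ℕ) :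
    cellSet h = ((h.support.sigma fun k => range (h k)).image
      fun p : (_ : ℕ) × ℕ => (p.2, p.2 + p.1) : Finset (ℕ × ℕ)) := by
  ext ⟨i, j⟩
  simp only [mem_cellSet, coe_image, Set.mem_image, SetLike.mem_coe, mem_sigma,
    Finsupp.mem_support_iff, mem_range, Prod.mk.injEq]
  constructor
  · rintro ⟨h1, h2⟩
    exact ⟨⟨j - i, i⟩, ⟨by simp only; omega, h2⟩, rfl, by simp only; omega⟩
  · rintro ⟨⟨k, i'⟩, ⟨h1, h2⟩, rfl, rfl⟩
    simpa using h2

theorem finite_cellSet (h : ℕ →₀ ℕ) : (cellSet h).Finite := by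
  rw [cellSet_eq_coe]
  exact finite_toSet _

theorem ncard_cellSet (h : ℕ →₀ ℕ) : (cellSet h).ncard = h.degree := by
  rw [cellSet_eq_coe, Set.ncard_coe_finset, card_image_of_injOn, card_sigma, Finsupp.degree_apply]
  · simp
  · rintro ⟨a, b⟩ _ ⟨a', b'⟩ _ hab
    simp only [Prod.mk.injEq] at hab
    obtain ⟨rfl, h2⟩ := hab
    obtain rfl : a = a' := by omega
    rfl

theorem cellSet_injective : Function.Injective cellSet := fun h h' hh => by
  ext k
  refine le_antisymm ?_ ?_ <;> refine le_of_forall_lt fun i hi => ?_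
  · exact mem_cellSet_diag.1 (hh ▸ mem_cellSet_diag.2 hi)
  · exact mem_cellSet_diag.1 (hh ▸ mem_cellSet_diag.2 hi)

theorem cellSet_subset_iff {κ h : ℕ →₀ ℕ} : cellSet κ ⊆ cellSet h ↔ κ ≤ h := by
  refine ⟨fun hs k => le_of_forall_lt fun i hi => mem_cellSet_diag.1 (hs (mem_cellSet_diag.2 hi)),
    fun hs c hc => ⟨hc.1, hc.2.trans_le (hs _)⟩⟩

theorem IsShape.mem_left {h : ℕ →₀ ℕ} (hh : IsShape h) {i j j' : ℕ} (hc : (i, j) ∈ cellSet h)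
    (hij : i ≤ j') (hj : j' ≤ j) : (i, j') ∈ cellSet h :=
  ⟨hij, hc.2.trans_le (hh.antitone (by simp only; omega))⟩

theorem IsShape.mem_above {h : ℕ →₀ ℕ} (hh : IsShape h) {i i' j : ℕ} (hc : (i, j) ∈ cellSet h)
    (hi : i' ≤ i) : (i', j) ∈ cellSet h := by
  rw [mem_cellSet] at hc ⊢
  have := hh.le_add (j - i) (i - i')
  rw [show j - i + (i - i') = j - i' by omega] at this
  omega

/-- A set of cells that is closed under moving left and up inside a shape is a shape. -/
theorem exists_shape_of_closed {h : ℕ →₀ ℕ} {S : Set (ℕ × ℕ)} (hS : S ⊆ cellSet h)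
    (hrow : ∀ i j, i ≤ j → (i, j + 1) ∈ S → (i, j) ∈ S)
    (hcol : ∀ i j, (i + 1, j) ∈ S → (i, j) ∈ S) : ∃ κ, IsShape κ ∧ cellSet κ = S := by
  classical
  have hex : ∀ k, ∃ i, (i, i + k) ∉ S := fun k =>
    ⟨h k, fun hm => absurd (mem_cellSet_diag.1 (hS hm)) (lt_irrefl _)⟩
  -- One step up followed by one step left keeps the content, so `S` meets each diagonal in an
  -- initial segment. Its length, the first missing row, is the height.
  have hdiag : ∀ i k, (i + 1, i + 1 + k) ∈ S → (i, i + k) ∈ S := fun i k hm =>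
    hrow i (i + k) (by omega) (by rw [show i + k + 1 = i + 1 + k by ring]; exact hcol _ _ hm)
  have hiff : ∀ k i, i < Nat.find (hex k) ↔ (i, i + k) ∈ S := by
    intro k i
    constructor
    · intro hi
      by_contra hn
      exact Nat.find_min (hex k) hi hn
    · intro hm
      by_contra hn
      obtain ⟨t, rfl⟩ := Nat.exists_eq_add_of_le (not_lt.1 hn)
      refine Nat.find_spec (hex k) ?_
      generalize Nat.find (hex k) = m at hm ⊢
      clear hn
      induction t with
      | zero => exact hm
      | succ t ih => exact ih (hdiag _ _ hm)
  let κ : ℕ →₀ ℕ := Finsupp.onFinset h.support (fun k => Nat.find (hex k)) fun k hk => by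
    have h1 := (hiff k 0).1 (Nat.pos_of_ne_zero hk)
    have h2 := mem_cellSet_diag.1 (hS h1)
    exact Finsupp.mem_support_iff.2 (by omega)
  have hκ : ∀ k i, i < κ k ↔ (i, i + k) ∈ S := hiff
  refine ⟨κ, fun k => ⟨le_of_forall_lt fun i hi => ?_, ?_⟩, ?_⟩
  · rw [hκ] at hi ⊢
    exact hrow _ _ (by omega) hi
  · refine le_of_forall_lt fun i hi => ?_
    cases i with
    | zero => omega
    | succ i =>
      rw [hκ] at hi
      have := hcol _ _ hi
      rw [show i + 1 + k = i + (k + 1) by ring, ← hκ] at this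
      omega
  · ext ⟨i, j⟩
    rw [mem_cellSet]
    constructor
    · rintro ⟨h1, h2⟩
      rw [hκ, show i + (j - i) = j by omega] at h2
      exact h2
    · intro hm
      have h1 := (hS hm).1
      refine ⟨h1, ?_⟩
      rw [hκ, show i + (j - i) = j by simp only at h1; omega]
      exact hm

/-- The value of a tableau outside its shape. -/
def blank : Letter := toLex (0, true)

/-- Marked shifted tableaux with indices below `N` and content `α`, as functions on all cells.
If `δ` is false there are no marks on the diagonal. -/
structure IsTab (δ : Bool) (α : ℕ → ℕ) (N : ℕ) (h : ℕ →₀ ℕ) (T : ℕ × ℕ → Letter) : Prop where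
  off : ∀ c, c ∉ cellSet h → T c = blank
  row : ∀ c ∈ cellSet h, ∀ d ∈ cellSet h, c.1 = d.1 → c.2 < d.2 →
    T c ≤ T d ∧ (T c = T d → ¬ (T c).Marked)
  col : ∀ c ∈ cellSet h, ∀ d ∈ cellSet h, c.2 = d.2 → c.1 < d.1 →
    T c ≤ T d ∧ (T c = T d → (T c).Marked)
  diag : δ = false → ∀ c ∈ cellSet h, c.1 = c.2 → ¬ (T c).Marked
  lt : ∀ c ∈ cellSet h, (T c).index < N
  content : ∀ i < N, {c ∈ cellSet h | (T c).index = i}.ncard = α i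

/-- The markings of the cells of `h / κ` that can occur in a tableau in which all these cells
have the same index; the value `false` stands for a mark. -/
structure IsFill (δ : Bool) (κ h : ℕ →₀ ℕ) (m : ℕ × ℕ → Bool) : Prop where
  off : ∀ c, c ∉ cellSet h \ cellSet κ → m c = true
  row : ∀ c ∈ cellSet h \ cellSet κ, ∀ d ∈ cellSet h \ cellSet κ, c.1 = d.1 → c.2 < d.2 →
    m d = true
  col : ∀ c ∈ cellSet h \ cellSet κ, ∀ d ∈ cellSet h \ cellSet κ, c.2 = d.2 → c.1 < d.1 →
    m c = false
  diag : δ = false → ∀ c ∈ cellSet h \ cellSet κ, c.1 = c.2 → m c = true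

/-- If h/κ has two cells of content `k`, consider the first two on that diagonal. The cell right of
the first and above the second is also in h/κ, and it would have to be unmarked because of its row
and marked because of its column. -/
theorem not_isFill {δ : Bool} {κ h : ℕ →₀ ℕ} (hκ : IsShape κ) (hh : IsShape h) (hle : κ ≤ h)
    (hs : ¬ Strip κ h) (m : ℕ × ℕ → Bool) : ¬ IsFill δ κ h m := by
  intro hm
  simp only [Strip, not_forall, not_and, not_le] at hs
  obtain ⟨k, hk⟩ := hs
  replace hk := hk (hle k)
  have h1 := hh k
  have h2 := hκ k
  have hc : ∀ i l, (i, i + l) ∈ cellSet h \ cellSet κ ↔ i < h l ∧ κ l ≤ i := fun i l => by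
    rw [Set.mem_sdiff, mem_cellSet_diag, mem_cellSet_diag, not_lt]
  have a1 := (hc (κ k) k).2 (by omega)
  have a2 := (hc (κ k) (k + 1)).2 (by omega)
  have a3 := (hc (κ k + 1) k).2 (by omega)
  have b1 := hm.row _ a1 _ a2 rfl (by simp)
  have b2 := hm.col _ a2 _ a3 (by simp only; ring) (by simp)
  rw [b1] at b2
  exact absurd b2 (by simp)

/-! ### Counting the markings of a strip. -/

section Fill

variable {δ : Bool} {κ h : ℕ →₀ ℕ}

theorem Strip.mem_skew (hs : Strip κ h) {c : ℕ × ℕ} :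
    c ∈ cellSet h \ cellSet κ ↔
      c.1 = κ (c.2 - c.1) ∧ c.1 ≤ c.2 ∧ c.2 - c.1 ∈ stripContents κ h := by
  obtain ⟨i, j⟩ := c
  have := hs (j - i)
  simp only [Set.mem_sdiff, mem_cellSet, mem_stripContents]
  omega

theorem Strip.mem_skew_diag (hs : Strip κ h) {k : ℕ} :
    (κ k, κ k + k) ∈ cellSet h \ cellSet κ ↔ k ∈ stripContents κ h := by
  rw [hs.mem_skew]
  simp

/-- The marking determined by the set `A` of marked cells among those whose mark is free. -/
def fillOf (δ : Bool) (κ h : ℕ →₀ ℕ) (A : Finset ℕ) (c : ℕ × ℕ) : Bool :=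
  open Classical in
  if c ∈ cellSet h \ cellSet κ then
    if c.2 - c.1 ∈ starts δ (stripContents κ h) then decide (c.2 - c.1 ∉ A)
    -- Forced marks: if the strip cell of the preceding content is the left neighbour, the cell is
    -- unmarked; if it is the lower neighbour, the cell is marked. A diagonal cell arrives here only
    -- if diagonal marks are forbidden.
    else decide (c.1 = c.2 ∨ κ (c.2 - c.1 - 1) = κ (c.2 - c.1))
  else true

theorem isFill_fillOf (hκ : IsShape κ) (hh : IsShape h) (hs : Strip κ h) (A : Finset ℕ) :
    IsFill δ κ h (fillOf δ κ h A) where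
  off c hc := if_neg hc
  row c hc d hd h1 h2 := by
    rw [fillOf, if_pos hd]
    obtain ⟨i, j⟩ := c
    obtain ⟨i', j'⟩ := d
    obtain rfl : i = i' := h1
    simp only at h2
    obtain ⟨c1, c2, c3⟩ := hs.mem_skew.1 hc
    obtain ⟨d1, d2, d3⟩ := hs.mem_skew.1 hd
    simp only [mem_stripContents] at c1 c2 c3 d1 d2 d3
    have e1 := hκ.antitone (show j - i ≤ j' - i - 1 by omega)
    have e2 := hκ.antitone (show j' - i - 1 ≤ j' - i by omega)
    have e3 := hh.antitone (show j' - i - 1 ≤ j' - i by omega)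
    have e4 := hs (j' - i)
    have hn : j' - i ∉ starts δ (stripContents κ h) := by
      simp only [starts, mem_filter, mem_stripContents, if_neg (show j' - i ≠ 0 by omega)]
      omega
    simp only [if_neg hn, decide_eq_true_eq]
    omega
  col c hc d hd h1 h2 := by
    rw [fillOf, if_pos hc]
    obtain ⟨i, j⟩ := c
    obtain ⟨i', j'⟩ := d
    obtain rfl : j = j' := h1
    simp only at h2
    obtain ⟨c1, c2, c3⟩ := hs.mem_skew.1 hc
    obtain ⟨d1, d2, d3⟩ := hs.mem_skew.1 hd
    simp only [mem_stripContents] at c1 c2 c3 d1 d2 d3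
    have e1 := hκ.le_add (j - i') (i' - i - 1)
    have e2 := hh.le_add (j - i') (i' - i - 1)
    rw [show j - i' + (i' - i - 1) = j - i - 1 by omega] at e1 e2
    have e3 := hκ (j - i - 1)
    have e5 := hh (j - i - 1)
    rw [show j - i - 1 + 1 = j - i by omega] at e3 e5
    have e4 := hs (j - i)
    have hn : j - i ∉ starts δ (stripContents κ h) := by
      simp only [starts, mem_filter, mem_stripContents, if_neg (show j - i ≠ 0 by omega)]
      omega
    simp only [if_neg hn, decide_eq_false_iff_not]
    omega
  diag hδ c hc h1 := by
    rw [fillOf, if_pos hc, if_neg]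
    · simp [h1]
    · simp [starts, hδ, h1]

/-- Strip cells of consecutive contents are adjacent, so in each interval of contents every cell but
the first has its mark forced by the preceding one. -/
theorem IsFill.eq_fillOf (hκ : IsShape κ) (hs : Strip κ h) {m : ℕ × ℕ → Bool}
    (hm : IsFill δ κ h m) :
    fillOf δ κ h ((starts δ (stripContents κ h)).filter fun k => m (κ k, κ k + k) = false) = m := by
  ext1 c
  by_cases hc : c ∈ cellSet h \ cellSet κ
  · rw [fillOf, if_pos hc]
    obtain ⟨i, j⟩ := c
    obtain ⟨c1, c2, c3⟩ := hs.mem_skew.1 hc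
    simp only at c1 c2 c3 ⊢
    have hij : (κ (j - i), κ (j - i) + (j - i)) = (i, j) := by rw [← c1]; congr 1; omega
    split_ifs with h1
    · simp [h1, hij]
    · simp only [starts, mem_filter, c3, true_and] at h1
      by_cases h0 : j - i = 0
      · rw [if_pos h0, Bool.not_eq_true] at h1
        rw [hm.diag h1 _ hc (by simp only; omega)]
        simp only [decide_eq_true_eq]
        omega
      · rw [if_neg h0, not_not] at h1
        have h2 := hs.mem_skew_diag.2 h1
        have e := hκ (j - i - 1)
        rw [show j - i - 1 + 1 = j - i by omega] at e
        by_cases h3 : κ (j - i - 1) = κ (j - i)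
        · rw [hm.row _ h2 _ hc (by simp only; omega) (by simp only; omega)]
          simp [h3]
        · rw [hm.col _ hc _ h2 (by simp only; omega) (by simp only; omega)]
          simp only [decide_eq_false_iff_not]
          omega
  · rw [fillOf, if_neg hc, hm.off c hc]

theorem ncard_isFill (hκ : IsShape κ) (hh : IsShape h) (hs : Strip κ h) :
    {m | IsFill δ κ h m}.ncard = 2 ^ (starts δ (stripContents κ h)).card := by
  rw [← card_powerset, ← Set.ncard_coe_finset]
  symm
  refine Set.ncard_congr (fun A _ => fillOf δ κ h A) ?_ ?_ ?_
  · exact fun A _ => isFill_fillOf hκ hh hs A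
  · intro A B hA hB hAB
    rw [SetLike.mem_coe, mem_powerset] at hA hB
    ext k
    by_cases hk : k ∈ starts δ (stripContents κ h)
    · have h1 := congrFun hAB (κ k, κ k + k)
      have h2 := hs.mem_skew_diag.2 (mem_of_mem_filter k hk)
      rw [fillOf, fillOf, if_pos h2, if_pos h2] at h1
      simpa [hk, not_iff_not] using h1
    · exact ⟨fun h => absurd (hA h) hk, fun h => absurd (hB h) hk⟩
  · exact fun m hm => ⟨_, mem_powerset.2 (filter_subset _ _), hm.eq_fillOf hκ hs⟩

end Fill

/-! ### Peeling off the largest index -/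

theorem Letter.index_le_of_le {a b : Letter} (hab : a ≤ b) : a.index ≤ b.index := by
  rcases Prod.Lex.le_iff.1 hab with h1 | h1
  · exact h1.le
  · exact h1.1.le

theorem Letter.lt_of_index_lt {a b : Letter} (hab : a.index < b.index) : a < b :=
  Prod.Lex.lt_iff.2 (Or.inl hab)

theorem Letter.eq_toLex (a : Letter) : a = toLex (a.index, (ofLex a).2) := rfl

section Peel

variable {δ : Bool} {α : ℕ → ℕ} {N : ℕ} {κ h : ℕ →₀ ℕ}

open Classical in
/-- The restriction of a tableau to a smaller shape. -/
def restrictTab (κ : ℕ →₀ ℕ) (T : ℕ × ℕ → Letter) (c : ℕ × ℕ) : Letter :=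
  if c ∈ cellSet κ then T c else blank

open Classical in
/-- The marks of a tableau on a skew shape. -/
def marksOf (κ h : ℕ →₀ ℕ) (T : ℕ × ℕ → Letter) (c : ℕ × ℕ) : Bool :=
  if c ∈ cellSet h \ cellSet κ then (ofLex (T c)).2 else true

open Classical in
/-- The extension of a tableau of shape `κ` by cells with index `N` and marks `m`. -/
def glueTab (N : ℕ) (κ h : ℕ →₀ ℕ) (T : ℕ × ℕ → Letter) (m : ℕ × ℕ → Bool) (c : ℕ × ℕ) : Letter :=
  if c ∈ cellSet κ then T c else if c ∈ cellSet h then toLex (N, m c) else blank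

/-- The cells of a tableau whose index is less than `N`. -/
def lowCells (N : ℕ) (h : ℕ →₀ ℕ) (T : ℕ × ℕ → Letter) : Set (ℕ × ℕ) :=
  {c ∈ cellSet h | (T c).index < N}

/-- Indices weakly increase along rows and columns, so the cells of small index are closed under
moving left and up. -/
theorem IsTab.exists_lowCells {T : ℕ × ℕ → Letter} (hh : IsShape h)
    (hT : IsTab δ α (N + 1) h T) : ∃ κ, IsShape κ ∧ cellSet κ = lowCells N h T := by
  refine exists_shape_of_closed (fun c hc => hc.1) ?_ ?_
  · rintro i j hij ⟨h1, h2⟩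
    have h3 := hh.mem_left h1 hij (by omega)
    exact ⟨h3, (Letter.index_le_of_le (hT.row _ h3 _ h1 rfl (by simp)).1).trans_lt h2⟩
  · rintro i j ⟨h1, h2⟩
    have h3 := hh.mem_above h1 (show i ≤ i + 1 by omega)
    exact ⟨h3, (Letter.index_le_of_le (hT.col _ h3 _ h1 rfl (by simp)).1).trans_lt h2⟩

theorem IsTab.index_eq {T : ℕ × ℕ → Letter} (hT : IsTab δ α (N + 1) h T)
    (hκ : cellSet κ = lowCells N h T) {c : ℕ × ℕ} (hc : c ∈ cellSet h \ cellSet κ) :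
    (T c).index = N := by
  have h1 := hT.lt c hc.1
  have h2 : ¬ (T c).index < N := fun h2 => hc.2 (hκ ▸ ⟨hc.1, h2⟩)
  omega

theorem IsTab.restrict {T : ℕ × ℕ → Letter} (hT : IsTab δ α (N + 1) h T)
    (hκ : cellSet κ = lowCells N h T) : IsTab δ α N κ (restrictTab κ T) := by
  have hsub : ∀ c ∈ cellSet κ, c ∈ cellSet h := fun c hc => (hκ ▸ hc : c ∈ lowCells N h T).1
  have hlt : ∀ c ∈ cellSet κ, (T c).index < N := fun c hc => (hκ ▸ hc : c ∈ lowCells N h T).2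
  refine ⟨fun c hc => if_neg hc, fun c hc d hd => ?_, fun c hc d hd => ?_, fun hδ c hc => ?_,
    fun c hc => ?_, fun i hi => ?_⟩
  · rw [restrictTab, restrictTab, if_pos hc, if_pos hd]
    exact hT.row c (hsub c hc) d (hsub d hd)
  · rw [restrictTab, restrictTab, if_pos hc, if_pos hd]
    exact hT.col c (hsub c hc) d (hsub d hd)
  · rw [restrictTab, if_pos hc]
    exact hT.diag hδ c (hsub c hc)
  · rw [restrictTab, if_pos hc]
    exact hlt c hc
  · rw [← hT.content i (by omega)]
    congr 1
    ext c
    simp only [Set.mem_ofPred_eq]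
    constructor
    · rintro ⟨h1, h2⟩
      rw [restrictTab, if_pos h1] at h2
      exact ⟨hsub c h1, h2⟩
    · rintro ⟨h1, h2⟩
      have h3 : c ∈ cellSet κ := hκ ▸ ⟨h1, by omega⟩
      rw [restrictTab, if_pos h3]
      exact ⟨h3, h2⟩

theorem IsTab.isFill_marksOf {T : ℕ × ℕ → Letter} (hT : IsTab δ α (N + 1) h T)
    (hκ : cellSet κ = lowCells N h T) : IsFill δ κ h (marksOf κ h T) := by
  have hidx : ∀ c ∈ cellSet h \ cellSet κ, T c = toLex (N, (ofLex (T c)).2) := fun c hc => by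
    conv_lhs => rw [Letter.eq_toLex (T c), hT.index_eq hκ hc]
  refine ⟨fun c hc => if_neg hc, fun c hc d hd h1 h2 => ?_, fun c hc d hd h1 h2 => ?_,
    fun hδ c hc h1 => ?_⟩
  · rw [marksOf, if_pos hd]
    obtain ⟨h3, h4⟩ := hT.row c hc.1 d hd.1 h1 h2
    rw [hidx c hc, hidx d hd] at h3 h4
    rw [Prod.Lex.toLex_le_toLex] at h3
    simp only [lt_self_iff_false, true_and, false_or, Letter.Marked, ofLex_toLex] at h3 h4
    revert h3 h4
    cases (ofLex (T c)).2 <;> cases (ofLex (T d)).2 <;> simp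
  · rw [marksOf, if_pos hc]
    obtain ⟨h3, h4⟩ := hT.col c hc.1 d hd.1 h1 h2
    rw [hidx c hc, hidx d hd] at h3 h4
    rw [Prod.Lex.toLex_le_toLex] at h3
    simp only [lt_self_iff_false, true_and, false_or, Letter.Marked, ofLex_toLex] at h3 h4
    revert h3 h4
    cases (ofLex (T c)).2 <;> cases (ofLex (T d)).2 <;> simp
  · rw [marksOf, if_pos hc]
    have h2 := hT.diag hδ c hc.1 h1
    rw [Letter.Marked] at h2
    simpa using h2

theorem isTab_glueTab (hκ : IsShape κ) (hle : κ ≤ h) (hd : κ.degree + α N = h.degree)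
    {T : ℕ × ℕ → Letter} {m : ℕ × ℕ → Bool} (hT : IsTab δ α N κ T) (hm : IsFill δ κ h m) :
    IsTab δ α (N + 1) h (glueTab N κ h T m) ∧ cellSet κ = lowCells N h (glueTab N κ h T m) := by
  have hsub := cellSet_subset_iff.2 hle
  have hin : ∀ c ∈ cellSet κ, glueTab N κ h T m c = T c := fun c hc => if_pos hc
  have hout : ∀ c ∈ cellSet h \ cellSet κ, glueTab N κ h T m c = toLex (N, m c) := fun c hc => by
    rw [glueTab, if_neg hc.2, if_pos hc.1]
  have hidx : ∀ c ∈ cellSet h \ cellSet κ, (glueTab N κ h T m c).index = N := fun c hc => by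
    rw [hout c hc]; rfl
  have hmono : ∀ c ∈ cellSet κ, ∀ d ∈ cellSet h \ cellSet κ,
      glueTab N κ h T m c < glueTab N κ h T m d := fun c hc d hd => by
    refine Letter.lt_of_index_lt ?_
    rw [hidx d hd, hin c hc]
    exact hT.lt c hc
  have hlow : ∀ c, c ∈ cellSet κ ↔ c ∈ cellSet h ∧ (glueTab N κ h T m c).index < N := by
    intro c
    constructor
    · exact fun hc => ⟨hsub hc, by rw [hin c hc]; exact hT.lt c hc⟩
    · rintro ⟨h1, h2⟩
      by_contra hc
      rw [hidx c ⟨h1, hc⟩] at h2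
      exact lt_irrefl _ h2
  refine ⟨⟨fun c hc => ?_, fun c hc d hd h1 h2 => ?_, fun c hc d hd h1 h2 => ?_,
    fun hδ c hc h1 => ?_, fun c hc => ?_, fun i hi => ?_⟩, Set.ext hlow⟩
  · rw [glueTab, if_neg fun h' => hc (hsub h'), if_neg hc]
  · by_cases hc' : c ∈ cellSet κ <;> by_cases hd' : d ∈ cellSet κ
    · rw [hin c hc', hin d hd']
      exact hT.row c hc' d hd' h1 h2
    · have h3 := hmono c hc' d ⟨hd, hd'⟩
      exact ⟨h3.le, fun h4 => absurd h4 h3.ne⟩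
    · refine absurd ?_ hc'
      have h5 : c = (d.1, c.2) := by rw [← h1]
      rw [h5]
      exact hκ.mem_left (i := d.1) (j := d.2) hd' (h1 ▸ hc.1) h2.le
    · have h3 := hm.row c ⟨hc, hc'⟩ d ⟨hd, hd'⟩ h1 h2
      rw [hout c ⟨hc, hc'⟩, hout d ⟨hd, hd'⟩, h3, Prod.Lex.toLex_le_toLex, Letter.Marked]
      cases m c <;> simp
  · by_cases hc' : c ∈ cellSet κ <;> by_cases hd' : d ∈ cellSet κ
    · rw [hin c hc', hin d hd']
      exact hT.col c hc' d hd' h1 h2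
    · have h3 := hmono c hc' d ⟨hd, hd'⟩
      exact ⟨h3.le, fun h4 => absurd h4 h3.ne⟩
    · refine absurd ?_ hc'
      have h5 : c = (c.1, d.2) := by rw [← h1]
      rw [h5]
      exact hκ.mem_above (i := d.1) (j := d.2) hd' h2.le
    · have h3 := hm.col c ⟨hc, hc'⟩ d ⟨hd, hd'⟩ h1 h2
      rw [hout c ⟨hc, hc'⟩, hout d ⟨hd, hd'⟩, h3, Prod.Lex.toLex_le_toLex, Letter.Marked]
      cases m d <;> simp
  · by_cases hc' : c ∈ cellSet κ
    · rw [hin c hc']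
      exact hT.diag hδ c hc' h1
    · rw [hout c ⟨hc, hc'⟩, hm.diag hδ c ⟨hc, hc'⟩ h1, Letter.Marked]
      simp
  · by_cases hc' : c ∈ cellSet κ
    · have := ((hlow c).1 hc').2
      omega
    · rw [hidx c ⟨hc, hc'⟩]
      omega
  · by_cases hi' : i = N
    · subst hi'
      have h1 : {c ∈ cellSet h | (glueTab i κ h T m c).index = i} = cellSet h \ cellSet κ := by
        ext c
        simp only [Set.mem_ofPred_eq, Set.mem_sdiff, hlow c]
        constructor
        · rintro ⟨h1, h2⟩
          exact ⟨h1, fun h3 => by omega⟩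
        · rintro ⟨h1, h2⟩
          exact ⟨h1, hidx c ⟨h1, fun h3 => h2 ((hlow c).1 h3)⟩⟩
      rw [h1, Set.ncard_sdiff hsub (finite_cellSet κ), ncard_cellSet, ncard_cellSet]
      omega
    · rw [← hT.content i (by omega)]
      congr 1
      ext c
      simp only [Set.mem_ofPred_eq]
      constructor
      · rintro ⟨h1, h2⟩
        have h3 : c ∈ cellSet κ := (hlow c).2 ⟨h1, by omega⟩
        rw [hin c h3] at h2
        exact ⟨h3, h2⟩
      · rintro ⟨h1, h2⟩
        rw [hin c h1]
        exact ⟨hsub h1, h2⟩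

theorem IsTab.degree_add {T : ℕ × ℕ → Letter} (hT : IsTab δ α (N + 1) h T)
    (hκ : cellSet κ = lowCells N h T) : κ.degree + α N = h.degree := by
  have hsub : cellSet κ ⊆ cellSet h := fun c hc => (hκ ▸ hc : c ∈ lowCells N h T).1
  have h1 : {c ∈ cellSet h | (T c).index = N} = cellSet h \ cellSet κ := by
    ext c
    constructor
    · rintro ⟨h1, h2⟩
      refine ⟨h1, fun h3 => ?_⟩
      have := (hκ ▸ h3 : c ∈ lowCells N h T).2
      omega
    · exact fun hc => ⟨hc.1, hT.index_eq hκ hc⟩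
  have h2 := hT.content N (by omega)
  have h3 := Finsupp.degree_mono (cellSet_subset_iff.1 hsub)
  rw [h1, Set.ncard_sdiff hsub (finite_cellSet κ), ncard_cellSet, ncard_cellSet] at h2
  omega

theorem ncard_isTab_fiber (hκ : IsShape κ) (hh : IsShape h) (hd : κ.degree + α N = h.degree) :
    ({T | IsTab δ α (N + 1) h T ∧ cellSet κ = lowCells N h T}.ncard : ℤ) =
      stripWeight δ κ h * {T | IsTab δ α N κ T}.ncard := by
  by_cases hle : κ ≤ h
  · have e : {T | IsTab δ α (N + 1) h T ∧ cellSet κ = lowCells N h T} ≃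
        {m | IsFill δ κ h m} × {T | IsTab δ α N κ T} :=
      { toFun := fun T => ⟨⟨marksOf κ h T.1, T.2.1.isFill_marksOf T.2.2⟩,
          ⟨restrictTab κ T.1, T.2.1.restrict T.2.2⟩⟩
        invFun := fun p => ⟨glueTab N κ h p.2.1 p.1.1, isTab_glueTab hκ hle hd p.2.2 p.1.2⟩
        left_inv := by
          rintro ⟨T, hT, hlow⟩
          ext1
          funext c
          simp only [glueTab, restrictTab, marksOf]
          split_ifs with h1 h2 h3
          · rfl
          · have := hT.index_eq hlow h3
            rw [Letter.eq_toLex (T c), this]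
            rfl
          · exact absurd ⟨h2, h1⟩ h3
          · exact (hT.off c h2).symm
        right_inv := by
          rintro ⟨⟨m, hm⟩, ⟨T, hT⟩⟩
          ext c
          · simp only [glueTab, marksOf]
            split_ifs with h1 h2 h3
            · exact absurd h2 h1.2
            · rfl
            · exact absurd h1.1 h3
            · exact (hm.off c h1).symm
          · simp only [glueTab, restrictTab]
            split_ifs with h1
            · rfl
            · rw [hT.off c h1] }
    have h1 := Nat.card_congr e
    rw [Nat.card_prod] at h1
    simp only [Nat.card_coe_set_eq] at h1
    rw [h1, Nat.cast_mul]
    congr 1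
    by_cases hs : Strip κ h
    · rw [ncard_isFill hκ hh hs, stripWeight, if_pos ⟨hκ, hh, hs⟩]
      push_cast
      rfl
    · rw [stripWeight_of_not fun h' => hs h'.2.2]
      have : {m | IsFill δ κ h m} = ∅ :=
        Set.eq_empty_of_forall_notMem fun m hm => not_isFill hκ hh hle hs m hm
      rw [this]
      simp
  · rw [stripWeight_of_not fun h' => hle h'.2.2.le, zero_mul, Nat.cast_eq_zero]
    have : {T | IsTab δ α (N + 1) h T ∧ cellSet κ = lowCells N h T} = ∅ :=
      Set.eq_empty_of_forall_notMem fun T hT =>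
        hle (cellSet_subset_iff.1 (hT.2 ▸ fun c hc => hc.1))
    rw [this]
    simp

theorem finite_isTab (δ : Bool) (α : ℕ → ℕ) (N : ℕ) (h : ℕ →₀ ℕ) :
    {T | IsTab δ α N h T}.Finite := by
  have := (finite_cellSet h).to_subtype
  rw [← Set.finite_coe_iff]
  refine Finite.of_injective (β := cellSet h → Fin N × Bool) (fun T c =>
    (⟨(T.1 c.1).index, T.2.lt c.1 c.2⟩, (ofLex (T.1 c.1)).2)) ?_
  rintro ⟨T, hT⟩ ⟨T', hT'⟩ hTT
  ext1
  funext c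
  by_cases hc : c ∈ cellSet h
  · have h1 := congrFun hTT ⟨c, hc⟩
    simp only [Prod.mk.injEq, Fin.mk.injEq] at h1
    change T c = T' c
    rw [Letter.eq_toLex (T c), Letter.eq_toLex (T' c), h1.1, h1.2]
  · exact (hT.off c hc).trans (hT'.off c hc).symm

/-- The weighted number of chains of strips from the empty shape to `h` with step sizes
`α 0, …, α (N - 1)`. -/
def chainCount (δ : Bool) (α : ℕ → ℕ) : ℕ → (ℕ →₀ ℕ) → ℤ
  | 0, h => if h = 0 then 1 else 0
  | N + 1, h => ∑ κ ∈ shapesLE h.degree with κ.degree + α N = h.degree,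
      stripWeight δ κ h * chainCount δ α N κ

theorem ncard_isTab (hh : IsShape h) :
    ({T | IsTab δ α N h T}.ncard : ℤ) = chainCount δ α N h := by
  classical
  induction N generalizing h with
  | zero =>
    rw [chainCount]
    split_ifs with h0
    · subst h0
      have : {T | IsTab δ α 0 0 T} = {fun _ => blank} := by
        have he : cellSet 0 = ∅ := Set.eq_empty_of_forall_notMem fun c hc => by
          simpa using hc.2
        ext T
        simp only [Set.mem_ofPred_eq, Set.mem_singleton_iff]
        constructor
        · exact fun hT => funext fun c => hT.off c (by simp [he])
        · rintro rfl
          refine ⟨fun c _ => rfl, ?_, ?_, ?_, ?_, ?_⟩ <;> simp [he]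
      rw [this]
      simp
    · have : {T | IsTab δ α 0 h T} = ∅ := Set.eq_empty_of_forall_notMem fun T hT => by
        have he : (cellSet h).Nonempty := by
          by_contra hn
          rw [Set.not_nonempty_iff_eq_empty] at hn
          have := ncard_cellSet h
          rw [hn, Set.ncard_empty, eq_comm, Finsupp.degree_eq_zero_iff] at this
          exact h0 this
        obtain ⟨c, hc⟩ := he
        exact absurd (hT.lt c hc) (by omega)
      rw [this]
      simp
  | succ N ih =>
    rw [chainCount]
    have hf := finite_isTab δ α (N + 1) h
    -- `F` sends a tableau to the shape formed by its cells of index below `N`; the value 0 is never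
    -- taken by default on actual tableaux.
    let F : (ℕ × ℕ → Letter) → (ℕ →₀ ℕ) := fun T =>
      if hT : ∃ κ, IsShape κ ∧ cellSet κ = lowCells N h T then hT.choose else 0
    have hF : ∀ T, IsTab δ α (N + 1) h T →
        IsShape (F T) ∧ cellSet (F T) = lowCells N h T := fun T hT => by
      have h1 := hT.exists_lowCells hh
      simp only [F, dif_pos h1]
      exact h1.choose_spec
    rw [Set.ncard_eq_toFinset_card _ hf, card_eq_sum_card_fiberwise (f := F)
      (t := (shapesLE h.degree).filter fun κ => κ.degree + α N = h.degree), Nat.cast_sum]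
    · refine sum_congr rfl fun κ hκ => ?_
      obtain ⟨h1, h2⟩ := mem_filter.1 hκ
      rw [← ih (mem_shapesLE.1 h1).1, ← ncard_isTab_fiber (mem_shapesLE.1 h1).1 hh h2,
        ← Set.ncard_coe_finset]
      congr 2
      ext T
      simp only [coe_filter, Set.Finite.mem_toFinset, Set.mem_ofPred_eq]
      refine and_congr_right fun hT => ⟨?_, fun h3 => ?_⟩
      · rintro rfl
        exact (hF T hT).2
      · exact cellSet_injective ((hF T hT).2.trans h3.symm)
    · intro T hT
      replace hT : IsTab δ α (N + 1) h T := by simpa using hT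
      obtain ⟨h1, h2⟩ := hF T hT
      have h3 := hT.degree_add h2
      simp only [coe_filter, Set.mem_ofPred_eq, mem_shapesLE]
      exact ⟨⟨h1, by omega⟩, h3⟩

end Peel

end TypeC

end

noncomputable section

namespace TypeC

open Finset

/-! ### Strict partitions and their height functions -/

theorem StrictPartition.ext' {lam mu : StrictPartition} (h : lam.parts = mu.parts) : lam = mu := by
  cases lam; cases mu; simp_all

theorem StrictPartition.nodup (lam : StrictPartition) : lam.parts.Nodup :=
  lam.decreasing.imp fun h => (ne_of_gt h)

/-- The height function of a strict partition. -/
def StrictPartition.ht (lam : StrictPartition) : ℕ →₀ ℕ :=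
  Finsupp.onFinset (range (lam.parts.sum + 1)) (fun k => #{p ∈ lam.parts.toFinset | k < p})
    fun k hk => by
      obtain ⟨p, hp⟩ := card_pos.1 (Nat.pos_of_ne_zero hk)
      simp only [mem_filter, List.mem_toFinset] at hp
      have := List.le_sum_of_mem hp.1
      simp only [mem_range]
      omega

theorem StrictPartition.ht_apply (lam : StrictPartition) (k : ℕ) :
    lam.ht k = #{p ∈ lam.parts.toFinset | k < p} := rfl

theorem card_filter_lt_succ (S : Finset ℕ) (k : ℕ) :
    #{p ∈ S | k < p} = #{p ∈ S | k + 1 < p} + if k + 1 ∈ S then 1 else 0 := by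
  split_ifs with h
  · rw [← card_insert_of_notMem (a := k + 1) (by simp)]
    congr 1
    ext p
    simp only [mem_filter, mem_insert]
    constructor
    · rintro ⟨h1, h2⟩
      by_cases h3 : p = k + 1
      · exact Or.inl h3
      · exact Or.inr ⟨h1, by omega⟩
    · rintro (rfl | ⟨h1, h2⟩)
      · exact ⟨h, by omega⟩
      · exact ⟨h1, by omega⟩
  · rw [add_zero]
    congr 1
    ext p
    simp only [mem_filter]
    refine and_congr_right fun hp => ⟨fun h2 => ?_, fun h2 => by omega⟩
    have : p ≠ k + 1 := fun h3 => h (h3 ▸ hp)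
    omega

theorem StrictPartition.ht_succ (lam : StrictPartition) (k : ℕ) :
    lam.ht k = lam.ht (k + 1) + if k + 1 ∈ lam.parts then 1 else 0 := by
  rw [ht_apply, card_filter_lt_succ, ht_apply]
  simp

theorem StrictPartition.isShape_ht (lam : StrictPartition) : IsShape lam.ht := fun k => by
  have := lam.ht_succ k
  split_ifs at this <;> omega

theorem StrictPartition.ht_injective : Function.Injective StrictPartition.ht := by
  intro lam mu h
  apply StrictPartition.ext'
  have h1 : lam.parts.toFinset = mu.parts.toFinset := by
    ext p
    rw [List.mem_toFinset, List.mem_toFinset]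
    cases p with
    | zero => exact ⟨fun h => absurd (lam.pos _ h) (by simp), fun h => absurd (mu.pos _ h) (by simp)⟩
    | succ k =>
      have h1 := lam.ht_succ k
      have h2 := mu.ht_succ k
      rw [h] at h1
      split_ifs at h1 h2 <;> first | omega | tauto
  exact (List.perm_of_nodup_nodup_toFinset_eq lam.nodup mu.nodup h1).eq_of_pairwise
    (fun a b _ _ h1 h2 => absurd h1 (by omega)) lam.decreasing mu.decreasing

theorem exists_ht_eq {h : ℕ →₀ ℕ} (hh : IsShape h) : ∃ lam : StrictPartition, lam.ht = h := by
  -- A part `k + 1` is counted by the height at `k` but not at `k + 1`, so the parts sit where the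
  -- height drops.
  let S : Finset ℕ := (h.support.filter fun k => h (k + 1) < h k).image Nat.succ
  have hS : ∀ k, k + 1 ∈ S ↔ h (k + 1) < h k := by
    intro k
    simp only [S, mem_image, mem_filter, Finsupp.mem_support_iff, Nat.succ_eq_add_one,
      Nat.add_right_cancel_iff, exists_eq_right]
    omega
  have hpos : ∀ p ∈ S, 0 < p := by
    intro p hp
    obtain ⟨k, -, rfl⟩ := mem_image.1 hp
    exact Nat.succ_pos k
  let lam : StrictPartition := ⟨S.sort (· ≥ ·), (S.sortedGT_sort).pairwise, by
    intro p hp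
    exact hpos p ((mem_sort _).1 hp)⟩
  refine ⟨lam, ?_⟩
  have hstep : ∀ k, lam.ht k = lam.ht (k + 1) + if h (k + 1) < h k then 1 else 0 := by
    intro k
    rw [lam.ht_succ]
    congr 1
    refine if_congr ?_ rfl rfl
    rw [← hS]
    exact mem_sort _
  -- Both height functions vanish for large contents and have the same drops, so they agree by
  -- descending induction.
  have key : ∀ t k, h.degree + lam.ht.degree ≤ k + t → lam.ht k = h k := by
    intro t
    induction t with
    | zero =>
      intro k hk
      rw [hh.eq_zero_of_degree_le (by omega), lam.isShape_ht.eq_zero_of_degree_le (by omega)]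
    | succ t ih =>
      intro k hk
      have h1 := ih (k + 1) (by omega)
      have h2 := hh k
      rw [hstep, h1]
      split_ifs <;> omega
  ext k
  exact key (h.degree + lam.ht.degree) k (by omega)

/-- The strict partition with a given height function. -/
def ofShape (h : ℕ →₀ ℕ) : StrictPartition :=
  open Classical in if hh : IsShape h then (exists_ht_eq hh).choose else ⟨[], by simp, by simp⟩

theorem ht_ofShape {h : ℕ →₀ ℕ} (hh : IsShape h) : (ofShape h).ht = h := by
  rw [ofShape, dif_pos hh]
  exact (exists_ht_eq hh).choose_spec

theorem ofShape_ht (lam : StrictPartition) : ofShape lam.ht = lam :=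
  StrictPartition.ht_injective (ht_ofShape lam.isShape_ht)

/-- In a decreasing list the entries larger than `k` come first. This turns the description of cells
by row lengths into the one by heights. -/
theorem lt_getD_iff {l : List ℕ} (hl : l.Pairwise (· > ·)) (i k : ℕ) :
    k < l.getD i 0 ↔ i < #{p ∈ l.toFinset | k < p} := by
  induction l generalizing i with
  | nil => simp
  | cons p l ih =>
    obtain ⟨h1, h2⟩ := List.pairwise_cons.1 hl
    have hp : p ∉ l.toFinset := fun h => by
      have := h1 p (List.mem_toFinset.1 h)
      omega
    rw [List.toFinset_cons, filter_insert]
    split_ifs with hk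
    · rw [card_insert_of_notMem fun h => hp (mem_filter.1 h).1]
      cases i with
      | zero => simpa using hk
      | succ i => simpa using ih h2 i
    · have h3 : #{p ∈ l.toFinset | k < p} = 0 := by
        rw [card_eq_zero, filter_eq_empty_iff]
        intro q hq
        have := h1 q (List.mem_toFinset.1 hq)
        omega
      rw [h3]
      simp only [not_lt_zero, iff_false, not_lt]
      cases i with
      | zero => simpa using hk
      | succ i =>
        have h4 := (ih h2 i).not.2 (by rw [h3]; omega)
        simpa using h4

theorem StrictPartition.mem_cells (lam : StrictPartition) (c : ℕ × ℕ) :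
    c ∈ lam.cells ↔ c ∈ cellSet lam.ht := by
  obtain ⟨i, j⟩ := c
  rw [mem_cellSet, ht_apply, ← lt_getD_iff lam.decreasing]
  simp only [cells, mem_biUnion, mem_range, mem_image, mem_Ico, Prod.mk.injEq]
  constructor
  · rintro ⟨i, h1, j, h2, rfl, rfl⟩
    omega
  · rintro ⟨h1, h2⟩
    refine ⟨i, ?_, j, by omega, rfl, rfl⟩
    by_contra h3
    rw [List.getD_eq_default _ _ (by omega)] at h2
    omega

/-! ### Schur functions as sums over chains -/

section Tableaux

variable (lam : StrictPartition)

open Classical in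
/-- The extension of a tableau by the blank letter. -/
def extendTab (T : lam.cells → Letter) (c : ℕ × ℕ) : Letter :=
  if hc : c ∈ lam.cells then T ⟨c, hc⟩ else blank

theorem extendTab_coe (T : lam.cells → Letter) (c : lam.cells) :
    extendTab lam T c = T c := dif_pos c.2

theorem natCard_index_eq (T : lam.cells → Letter) (i : ℕ) :
    Nat.card {c : lam.cells // (T c).index = i} =
      {c ∈ cellSet lam.ht | (extendTab lam T c).index = i}.ncard := by
  rw [← Nat.card_coe_set_eq]
  refine Nat.card_congr ⟨fun c => ⟨c.1.1, (lam.mem_cells _).1 c.1.2, ?_⟩,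
    fun c => ⟨⟨c.1, (lam.mem_cells _).2 c.2.1⟩, ?_⟩, fun c => rfl, fun c => rfl⟩
  · rw [extendTab_coe]; exact c.2
  · have := c.2.2
    rwa [extendTab, dif_pos ((lam.mem_cells _).2 c.2.1)] at this

theorem natCard_tableaux (δ : Bool) {α : ℕ →₀ ℕ} {N : ℕ} (hα : ∀ i, N ≤ i → α i = 0) :
    (Nat.card {T : lam.cells → Letter // IsMarkedShiftedTableau lam T ∧
      (δ = false → ∀ c : lam.cells, c.1.1 = c.1.2 → ¬ (T c).Marked) ∧ HasContent lam T α} : ℤ) =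
      chainCount δ α N lam.ht := by
  rw [← ncard_isTab lam.isShape_ht, ← Nat.card_coe_set_eq]
  congr 1
  have hin : ∀ c, c ∈ lam.cells ↔ c ∈ cellSet lam.ht := lam.mem_cells
  refine Nat.card_congr ⟨fun T => ⟨extendTab lam T.1, ?_⟩, fun T => ⟨fun c => T.1 c, ?_⟩, ?_, ?_⟩
  · obtain ⟨T, ⟨h1, h2⟩, h3, h4⟩ := T
    have hx : ∀ c (hc : c ∈ cellSet lam.ht), extendTab lam T c = T ⟨c, (hin c).2 hc⟩ :=
      fun c hc => dif_pos ((hin c).2 hc)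
    refine ⟨fun c hc => dif_neg fun h => hc ((hin c).1 h), fun c hc d hd => ?_, fun c hc d hd => ?_,
      fun hδ c hc => ?_, fun c hc => ?_, fun i hi => ?_⟩
    · rw [hx c hc, hx d hd]
      exact h1 ⟨c, (hin c).2 hc⟩ ⟨d, (hin d).2 hd⟩
    · rw [hx c hc, hx d hd]
      exact h2 ⟨c, (hin c).2 hc⟩ ⟨d, (hin d).2 hd⟩
    · rw [hx c hc]
      exact h3 hδ ⟨c, (hin c).2 hc⟩
    -- An entry of index at least `N` would contribute to a content that vanishes there.
    · by_contra hN
      have h5 := h4 (extendTab lam T c).index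
      rw [hα _ (not_lt.1 hN), natCard_index_eq,
        Set.ncard_eq_zero ((finite_cellSet _).subset fun c hc => hc.1)] at h5
      exact Set.notMem_empty c (h5 ▸ ⟨hc, rfl⟩)
    · rw [← natCard_index_eq]
      exact h4 i
  · obtain ⟨T, hT⟩ := T
    have he : extendTab lam (fun c => T c) = T := by
      funext c
      rw [extendTab]
      split_ifs with h
      · rfl
      · exact (hT.off c fun h' => h ((hin c).2 h')).symm
    refine ⟨⟨fun c d => hT.row _ ((hin _).1 c.2) _ ((hin _).1 d.2),
      fun c d => hT.col _ ((hin _).1 c.2) _ ((hin _).1 d.2)⟩,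
      fun hδ c => hT.diag hδ _ ((hin _).1 c.2), fun i => ?_⟩
    rw [natCard_index_eq, he]
    by_cases hi : i < N
    · exact hT.content i hi
    · rw [hα i (by omega), Set.ncard_eq_zero ((finite_cellSet _).subset fun c hc => hc.1)]
      refine Set.eq_empty_of_forall_notMem fun c hc => ?_
      have := hT.lt c hc.1
      rw [hc.2] at this
      exact hi this
  · rintro ⟨T, hT⟩
    ext1
    funext c
    exact extendTab_coe lam T c
  · rintro ⟨T, hT⟩
    ext1
    funext c
    simp only [extendTab]
    split_ifs with h
    · rfl
    · exact (hT.off c fun h' => h ((hin c).2 h')).symm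

theorem coeff_schurP {α : ℕ →₀ ℕ} {N : ℕ} (hα : ∀ i, N ≤ i → α i = 0) :
    MvPowerSeries.coeff α (schurP lam) = chainCount false α N lam.ht := by
  rw [← natCard_tableaux lam false hα]
  simp only [forall_const]
  rfl

theorem coeff_schurQ {α : ℕ →₀ ℕ} {N : ℕ} (hα : ∀ i, N ≤ i → α i = 0) :
    MvPowerSeries.coeff α (schurQ lam) = chainCount true α N lam.ht := by
  rw [← natCard_tableaux lam true hα]
  simp only [Bool.true_eq_false, false_imp_iff, true_and]
  rfl

end Tableaux

theorem chainCount_congr {δ : Bool} {α β : ℕ → ℕ} {N : ℕ} (hαβ : ∀ i < N, α i = β i)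
    (h : ℕ →₀ ℕ) : chainCount δ α N h = chainCount δ β N h := by
  induction N generalizing h with
  | zero => rfl
  | succ N ih =>
    rw [chainCount, chainCount, hαβ N (by omega)]
    exact sum_congr rfl fun κ _ => by rw [ih fun i hi => hαβ i (by omega)]

theorem coeff_chainSum (δ : Bool) (α : ℕ →₀ ℕ) (N : ℕ) (h : ℕ →₀ ℕ) :
    MvPowerSeries.coeff α (chainSum δ (MvPowerSeries.X : ℕ → MvPowerSeries ℕ ℤ) N h) =
      open Classical in if ∀ i, N ≤ i → α i = 0 then chainCount δ α N h else 0 := by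
  classical
  induction N generalizing α h with
  | zero =>
    have : (∀ i, 0 ≤ i → α i = 0) ↔ α = 0 := by
      simp [Finsupp.ext_iff]
    simp only [chainSum, chainCount, this]
    by_cases h1 : h = 0 <;> by_cases h2 : α = 0 <;> simp [h1, h2, MvPowerSeries.coeff_one]
  | succ N ih =>
    rw [chainSum, map_sum]
    have h1 : ∀ κ ∈ shapesLE h.degree, MvPowerSeries.coeff α
        ((stripWeight δ κ h : MvPowerSeries ℕ ℤ) * MvPowerSeries.X N ^ (h.degree - κ.degree) *
          chainSum δ MvPowerSeries.X N κ) =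
        if ∀ i, N + 1 ≤ i → α i = 0 then
          (if κ.degree + α N = h.degree then stripWeight δ κ h * chainCount δ α N κ else 0)
        else 0 := by
      intro κ hκ
      have hle := (mem_shapesLE.1 hκ).2
      rw [mul_assoc, ← map_intCast (MvPowerSeries.C (σ := ℕ) (R := ℤ)), Int.cast_id,
        MvPowerSeries.coeff_C_mul, MvPowerSeries.X_pow_eq, MvPowerSeries.coeff_monomial_mul, one_mul]
      have hsub : ∀ i, (α - Finsupp.single N (h.degree - κ.degree)) i =
          if i = N then α N - (h.degree - κ.degree) else α i := fun i => by
        rw [Finsupp.tsub_apply, Finsupp.single_apply]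
        by_cases hi : i = N
        · subst hi; simp
        · rw [if_neg (Ne.symm hi), if_neg hi]; simp
      simp only [Finsupp.single_le_iff]
      rw [ih,
        chainCount_congr (β := α) fun i hi => by rw [hsub, if_neg (by omega)]]
      have hcond : (∀ i, N ≤ i → (α - Finsupp.single N (h.degree - κ.degree)) i = 0) ↔
          (∀ i, N + 1 ≤ i → α i = 0) ∧ α N - (h.degree - κ.degree) = 0 := by
        constructor
        · intro hc
          refine ⟨fun i hi => ?_, ?_⟩
          · have := hc i (by omega)
            rwa [hsub, if_neg (by omega)] at this
          · have := hc N le_rfl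
            rwa [hsub, if_pos rfl] at this
        · rintro ⟨hc, h0⟩ i hi
          rw [hsub]
          split_ifs with h1
          · exact h0
          · exact hc i (by omega)
      simp only [hcond]
      by_cases hA : ∀ i, N + 1 ≤ i → α i = 0
      · rw [if_pos hA]
        by_cases hB : κ.degree + α N = h.degree
        · rw [if_pos hB, if_pos (by omega), if_pos ⟨hA, by omega⟩]
        · rw [if_neg hB]
          split_ifs with h3 h4
          · omega
          all_goals simp
      · rw [if_neg hA]
        split_ifs with h3 h4
        · exact absurd h4.1 hA
        all_goals simp
    rw [sum_congr rfl h1, chainCount]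
    by_cases hA : ∀ i, N + 1 ≤ i → α i = 0
    · simp only [if_pos hA, sum_filter]
    · simp only [if_neg hA, sum_const_zero]

end TypeC

end

noncomputable section

namespace TypeC

open Finset

/-! ### The Pieri rule for Schur P-functions -/

/-- The Schur P-function of a shape. -/
def shapeP (h : ℕ →₀ ℕ) : MvPowerSeries ℕ ℤ := schurP (ofShape h)

/-- Equality of all coefficients of monomials in the first `N` variables. -/
def AgreeBelow (N : ℕ) (f g : MvPowerSeries ℕ ℤ) : Prop :=
  ∀ α : ℕ →₀ ℕ, (∀ i, N ≤ i → α i = 0) → MvPowerSeries.coeff α f = MvPowerSeries.coeff α g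

/-- A divisor of a monomial in the first `N` variables involves only these variables. Identities in
finitely many variables thereby pass to power series. -/
theorem AgreeBelow.mul {N : ℕ} {f f' g g' : MvPowerSeries ℕ ℤ} (hf : AgreeBelow N f f')
    (hg : AgreeBelow N g g') : AgreeBelow N (f * g) (f' * g') := fun α hα => by
  classical
  rw [MvPowerSeries.coeff_mul, MvPowerSeries.coeff_mul]
  refine sum_congr rfl fun p hp => ?_
  have h1 : ∀ i, p.1 i + p.2 i = α i := fun i => by
    rw [← mem_antidiagonal.1 hp]; rfl
  rw [hf p.1 fun i hi => ?_, hg p.2 fun i hi => ?_] <;>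
  · have h2 := h1 i
    have h3 := hα i hi
    omega

theorem AgreeBelow.sum {ι : Type*} {N : ℕ} {s : Finset ι} {f g : ι → MvPowerSeries ℕ ℤ}
    (hfg : ∀ i ∈ s, AgreeBelow N (f i) (g i)) : AgreeBelow N (∑ i ∈ s, f i) (∑ i ∈ s, g i) :=
  fun α hα => by
    rw [map_sum, map_sum]
    exact sum_congr rfl fun i hi => hfg i hi α hα

theorem AgreeBelow.refl (N : ℕ) (f : MvPowerSeries ℕ ℤ) : AgreeBelow N f f := fun _ _ => rfl

theorem exists_bound (α : ℕ →₀ ℕ) : ∃ N, ∀ i, N ≤ i → α i = 0 := by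
  refine ⟨α.support.sup id + 1, fun i hi => ?_⟩
  by_contra h
  have := le_sup (f := id) (Finsupp.mem_support_iff.2 h)
  simp only [id] at this
  omega

theorem eq_of_agreeBelow {f g : MvPowerSeries ℕ ℤ} (hfg : ∀ N, AgreeBelow N f g) : f = g := by
  ext α
  obtain ⟨N, hN⟩ := exists_bound α
  exact hfg N α hN

theorem coeff_shapeP {h : ℕ →₀ ℕ} (hh : IsShape h) {α : ℕ →₀ ℕ} {N : ℕ}
    (hα : ∀ i, N ≤ i → α i = 0) :
    MvPowerSeries.coeff α (shapeP h) = chainCount false α N h := by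
  rw [shapeP, coeff_schurP _ hα, ht_ofShape hh]

theorem agreeBelow_shapeP {h : ℕ →₀ ℕ} (hh : IsShape h) (N : ℕ) :
    AgreeBelow N (shapeP h) (chainSum false MvPowerSeries.X N h) := fun α hα => by
  rw [coeff_shapeP hh hα, coeff_chainSum, if_pos hα]

/-- The symmetric function `q_r`. -/
def qFun (r : ℕ) : MvPowerSeries ℕ ℤ :=
  ∑ l ∈ shapes r, (stripWeight true 0 l : MvPowerSeries ℕ ℤ) * shapeP l

theorem stripWeight_self {δ : Bool} {h : ℕ →₀ ℕ} (hh : IsShape h) : stripWeight δ h h = 1 := by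
  have h1 : stripContents h h = ∅ := by
    ext k; simp [mem_stripContents]
  rw [stripWeight, if_pos ⟨hh, hh, fun k => by omega⟩, h1]
  simp [starts]

theorem chainSum_zero (δ : Bool) {R : Type*} [CommRing R] (x : ℕ → R) (N : ℕ) :
    chainSum δ x N 0 = 1 := by
  induction N with
  | zero => simp [chainSum]
  | succ N ih =>
    have h1 : shapesLE (Finsupp.degree (0 : ℕ →₀ ℕ)) = {0} := by
      ext κ
      rw [mem_shapesLE, mem_singleton, map_zero, nonpos_iff_eq_zero, Finsupp.degree_eq_zero_iff]
      exact ⟨fun h => h.2, fun h => ⟨h ▸ isShape_zero, h⟩⟩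
    rw [chainSum_succ, h1, sum_singleton, ih, stripWeight_self isShape_zero]
    simp

/-- `qFun` is the left side of the Pieri rule for the empty shape, which makes it independent of the
number of variables by definition. -/
theorem agreeBelow_qFun (r N : ℕ) : AgreeBelow N (qFun r) (qSum MvPowerSeries.X N r) := by
  have h1 := pieri_chainSum (MvPowerSeries.X : ℕ → MvPowerSeries ℕ ℤ) N isShape_zero r
  rw [chainSum_zero, one_mul, map_zero, zero_add] at h1
  rw [qFun, ← h1]
  exact AgreeBelow.sum fun l hl =>
    (AgreeBelow.refl _ _).mul (agreeBelow_shapeP (mem_shapes.1 hl).1 N)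

theorem pieri {μ : ℕ →₀ ℕ} (hμ : IsShape μ) (r : ℕ) :
    ∑ l ∈ shapes (μ.degree + r), (stripWeight true μ l : MvPowerSeries ℕ ℤ) * shapeP l =
      shapeP μ * qFun r := by
  refine eq_of_agreeBelow fun N α hα => ?_
  rw [(agreeBelow_shapeP hμ N).mul (agreeBelow_qFun r N) α hα, ← pieri_chainSum _ N hμ]
  exact AgreeBelow.sum (fun l hl =>
    (AgreeBelow.refl _ _).mul (agreeBelow_shapeP (mem_shapes.1 hl).1 N)) α hα

/-- The shape with a single row of length `r`. -/
def rowShape (r : ℕ) : ℕ →₀ ℕ := ind (range r)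

theorem rowShape_apply (r k : ℕ) : rowShape r k = if k < r then 1 else 0 := by
  simp [rowShape, ind_apply]

theorem isShape_rowShape (r : ℕ) : IsShape (rowShape r) := fun k => by
  simp only [rowShape_apply]
  split_ifs <;> omega

theorem degree_rowShape (r : ℕ) : (rowShape r).degree = r := by
  rw [rowShape, degree_ind, card_range]

theorem IsShape.support_eq {h : ℕ →₀ ℕ} (hh : IsShape h) : h.support = range h.support.card := by
  have hex : ∃ k, h k = 0 := ⟨h.degree, hh.eq_zero_of_degree_le le_rfl⟩
  have h1 : h.support = range (Nat.find hex) := by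
    ext k
    rw [Finsupp.mem_support_iff, mem_range]
    constructor
    · intro hk
      by_contra hn
      have := hh.antitone (not_lt.1 hn)
      rw [Nat.find_spec hex] at this
      omega
    · exact fun hk => Nat.find_min hex hk
  conv_lhs => rw [h1]
  rw [h1, card_range]

theorem eq_rowShape_of_strip {l : ℕ →₀ ℕ} (hl : IsShape l) (hs : Strip 0 l) :
    l = rowShape l.degree := by
  have h1 := hs.eq_add_ind
  have h2 : stripContents 0 l = l.support := by
    ext k; simp [mem_stripContents, Nat.pos_iff_ne_zero]
  have h3 := hs.degree_eq
  rw [h2, hl.support_eq, card_range, map_zero, zero_add] at h3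
  rw [h2, hl.support_eq, zero_add, ← h3] at h1
  exact h1

theorem starts_range (δ : Bool) (r : ℕ) :
    starts δ (range r) = if δ = true ∧ r ≠ 0 then {0} else ∅ := by
  ext k
  simp only [starts, mem_filter, mem_range]
  split_ifs with h1 h2 h2 <;> simp <;> grind

theorem stripWeight_rowShape {r : ℕ} (hr : r ≠ 0) : stripWeight true 0 (rowShape r) = 2 := by
  have h1 : stripContents 0 (rowShape r) = range r := by
    rw [← zero_add (rowShape r), rowShape, stripContents_add_ind]
  have h2 : Strip 0 (rowShape r) := by
    rw [← zero_add (rowShape r)]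
    exact strip_add_ind _ _
  rw [stripWeight, if_pos ⟨isShape_zero, isShape_rowShape r, h2⟩, h1, starts_range,
    if_pos ⟨rfl, hr⟩]
  simp

theorem qFun_eq {r : ℕ} (hr : r ≠ 0) : qFun r = 2 * shapeP (rowShape r) := by
  rw [qFun, sum_eq_single_of_mem (rowShape r)
    (mem_shapes.2 ⟨isShape_rowShape r, degree_rowShape r⟩), stripWeight_rowShape hr]
  · simp
  · intro l hl hn
    rw [stripWeight_of_not, Int.cast_zero, zero_mul]
    rintro ⟨-, h1, h2⟩
    apply hn
    rw [eq_rowShape_of_strip h1 h2, (mem_shapes.1 hl).2]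

theorem shapeP_zero : shapeP 0 = 1 := eq_of_agreeBelow fun N α hα => by
  rw [agreeBelow_shapeP isShape_zero N α hα, chainSum_zero]

theorem qFun_zero : qFun 0 = 1 := by
  have h1 : shapes 0 = {0} := by
    ext κ
    rw [mem_shapes, mem_singleton, Finsupp.degree_eq_zero_iff]
    exact ⟨fun h => h.2, fun h => ⟨h ▸ isShape_zero, h⟩⟩
  rw [qFun, h1, sum_singleton, stripWeight_self isShape_zero, shapeP_zero]
  simp

theorem qFun_relation {r : ℕ} (hr : r ≠ 0) :
    ∑ j ∈ range (r + 1), (-1) ^ j * qFun j * qFun (r - j) = 0 := by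
  refine eq_of_agreeBelow fun N α hα => ?_
  rw [AgreeBelow.sum (fun j _ => ((AgreeBelow.refl N ((-1) ^ j)).mul (agreeBelow_qFun j N)).mul
    (agreeBelow_qFun (r - j) N)) α hα, qSum_relation _ N hr]

/-! ### Schur P-functions are polynomials in those of odd rows -/

theorem schurP_oddRow (i : ℕ) : schurP (oddRow i) = shapeP (rowShape (2 * i + 1)) := by
  rw [shapeP]
  congr 1
  rw [← ofShape_ht (oddRow i)]
  congr 1
  ext k
  rw [StrictPartition.ht_apply, rowShape_apply]
  simp only [oddRow, List.toFinset_cons, List.toFinset_nil, insert_empty_eq, filter_singleton]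
  split_ifs <;> simp

/-- Odd rows are generators. For even r, `qFun_relation` expresses 2 q_r through the products q_j
q_{r-j} with 0 < j < r. Since q_j = 2 P_j for j > 0, all terms are divisible by 4, so P_r is an
integral polynomial in the shorter rows. -/
theorem shapeP_rowShape_mem {n r : ℕ} (hr : r ≠ 0) (hrn : r ≤ 2 * n) :
    shapeP (rowShape r) ∈ GammaLower n := by
  induction r using Nat.strong_induction_on with
  | _ r ih =>
    rcases Nat.even_or_odd' r with ⟨i, rfl | rfl⟩
    · obtain ⟨m, hm⟩ := Nat.exists_eq_succ_of_ne_zero hr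
      rw [Nat.succ_eq_add_one] at hm
      have h1 := qFun_relation hr
      rw [sum_range_succ, hm, sum_range_succ', Nat.sub_self, Nat.sub_zero, qFun_zero, ← hm,
        qFun_eq hr, Even.neg_one_pow (even_two_mul i), pow_zero] at h1
      have h2 : ∀ j ∈ range m, (-1) ^ (j + 1) * qFun (j + 1) * qFun (2 * i - (j + 1)) =
          4 * ((-1) ^ (j + 1) * (shapeP (rowShape (j + 1)) * shapeP (rowShape (m - j)))) := by
        intro j hj
        rw [mem_range] at hj
        rw [show 2 * i - (j + 1) = m - j by omega, qFun_eq (by omega), qFun_eq (by omega)]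
        ring
      rw [sum_congr rfl h2, ← mul_sum] at h1
      have h3 : shapeP (rowShape (2 * i)) = -∑ j ∈ range m,
          (-1) ^ (j + 1) * (shapeP (rowShape (j + 1)) * shapeP (rowShape (m - j))) := by
        have h4 : (4 : MvPowerSeries ℕ ℤ) ≠ 0 := by
          intro h
          have := congrArg (MvPowerSeries.constantCoeff (σ := ℕ) (R := ℤ)) h
          rw [map_ofNat, map_zero] at this
          norm_num at this
        refine mul_left_cancel₀ h4 ?_
        linear_combination h1
      rw [h3]
      refine neg_mem (sum_mem fun j hj => mul_mem (pow_mem (neg_mem (one_mem _)) _) (mul_mem ?_ ?_))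
      all_goals rw [mem_range] at hj
      · exact ih (j + 1) (by omega) (by omega) (by omega)
      · exact ih (m - j) (by omega) (by omega) (by omega)
    · refine Algebra.subset_adjoin ⟨i, by omega, ?_⟩
      rw [schurP_oddRow]

/-- The smallest content of a nonempty strip is a start, even if it is 0. This divisibility allows
the Pieri rule to be divided by 2 over ℤ. -/
theorem two_dvd_stripWeight {μ l : ℕ →₀ ℕ} (hd : μ.degree ≠ l.degree) :
    2 ∣ stripWeight true μ l := by
  rw [stripWeight]
  split_ifs with h
  · refine dvd_pow_self 2 (card_ne_zero.2 ?_)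
    have hne : (stripContents μ l).Nonempty := by
      rw [nonempty_iff_ne_empty]
      intro he
      have := h.2.2.degree_eq
      rw [he, card_empty] at this
      omega
    refine ⟨(stripContents μ l).min' hne, mem_filter.2 ⟨min'_mem _ _, ?_⟩⟩
    split_ifs with h0
    · rfl
    · intro h1
      have := min'_le _ _ h1
      omega
  · exact dvd_zero 2

/-- Among sets of given size an initial segment has the smallest sum: exchanging it for `U` replaces
elements below the cardinality by elements that are not. It gives the triangularity in `shapeP_mem`.
-/
theorem sum_range_lt_sum {U : Finset ℕ} (hU : U ≠ range U.card) :
    ∑ k ∈ range U.card, k < ∑ k ∈ U, k := by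
  set R := range U.card with hR
  have hcard : (U \ R).card = (R \ U).card := card_sdiff_comm (by rw [hR, card_range])
  have hne : (U \ R).Nonempty := by
    rw [sdiff_nonempty]
    intro h
    exact hU (eq_of_subset_of_card_le h (by rw [hR, card_range]))
  rw [← sum_inter_add_sum_sdiff R U, ← sum_inter_add_sum_sdiff U R, inter_comm]
  refine Nat.add_lt_add_left ?_ _
  have hne' : (R \ U).Nonempty := card_pos.1 (hcard ▸ card_pos.2 hne)
  calc ∑ k ∈ R \ U, k < ∑ k ∈ R \ U, U.card := sum_lt_sum_of_nonempty hne' fun k hk => by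
        simpa [hR] using (mem_sdiff.1 hk).1
    _ = ∑ k ∈ U \ R, U.card := by rw [sum_const, sum_const, hcard]
    _ ≤ ∑ k ∈ U \ R, k := sum_le_sum fun k hk => by
        simpa [hR] using (mem_sdiff.1 hk).2

/-- Every nonempty shape is obtained by adding a new shortest row to a shape. -/
theorem IsShape.exists_last_row {h : ℕ →₀ ℕ} (hh : IsShape h) (h0 : h ≠ 0) :
    ∃ μ p, IsShape μ ∧ p ≠ 0 ∧ h = μ + ind (range p) := by
  have hpos : h 0 ≠ 0 := fun hz => h0 (by
    ext k
    have := hh.antitone (Nat.zero_le k)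
    simp only [Finsupp.coe_zero, Pi.zero_apply]
    omega)
  have hex : ∃ k, h k < h 0 := ⟨h.degree, by rw [hh.eq_zero_of_degree_le le_rfl]; omega⟩
  classical
  set p := Nat.find hex with hp
  have hlow : ∀ k, k < p → h k = h 0 := fun k hk => by
    have h1 := Nat.find_min hex hk
    have h2 := hh.antitone (Nat.zero_le k)
    omega
  have hpp : h p < h 0 := Nat.find_spec hex
  have hp0 : p ≠ 0 := fun h1 => by rw [h1] at hpp; exact lt_irrefl _ hpp
  have hle : ind (range p) ≤ h := fun k => by
    rw [ind_apply]
    split_ifs with h1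
    · rw [hlow k (mem_range.1 h1)]; omega
    · omega
  refine ⟨h - ind (range p), p, fun k => ?_, hp0, (tsub_add_cancel_of_le hle).symm⟩
  simp only [Finsupp.tsub_apply, ind_apply, mem_range]
  have h1 := hh k
  by_cases h2 : k + 1 < p
  · rw [if_pos h2, if_pos (by omega)]
    have := hlow _ h2
    omega
  · rw [if_neg h2]
    by_cases h3 : k < p
    · have h4 : k + 1 = p := by omega
      have := hlow k h3
      rw [if_pos h3]
      rw [← h4] at hpp
      omega
    · rw [if_neg h3]
      omega

/-- Let `μ` be `h` without its shortest row, of length `p`. Half of the Pieri rule for P_μ q_p reads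
P_μ P_p = P_h + an integral combination of other P_l of the same size. Each such l has its new boxes
on larger contents in total, so it is treated earlier in the induction, and P_μ has smaller degree.
-/
theorem shapeP_mem {n : ℕ} {h : ℕ →₀ ℕ} (hh : IsShape h) (hn : h.degree ≤ 2 * n) :
    shapeP h ∈ GammaLower n := by
  obtain ⟨d, hd⟩ : ∃ d, h.degree = d := ⟨_, rfl⟩
  induction d using Nat.strong_induction_on generalizing h with
  | _ d ihd =>
  -- The sum of all contents orders the shapes of size `d`. It is at most `d * d`, so the inner
  -- induction runs on the deficit.
  let mom : (ℕ →₀ ℕ) → ℕ := fun h => ∑ k ∈ range d, k * h k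
  have hmom : ∀ l, IsShape l → l.degree = d → mom l ≤ d * d := by
    intro l hl hld
    calc mom l ≤ ∑ k ∈ range d, d * l k :=
          sum_le_sum fun k hk => Nat.mul_le_mul_right _ (mem_range.1 hk).le
      _ = d * d := by
          rw [← mul_sum, ← degree_eq_sum_range (hl.support_subset hld.le), hld]
  obtain ⟨t, ht⟩ : ∃ t, d * d - mom h = t := ⟨_, rfl⟩
  induction t using Nat.strong_induction_on generalizing h with
  | _ t iht =>
  by_cases h0 : h = 0
  · rw [h0, shapeP_zero]; exact one_mem _
  obtain ⟨μ, p, hμ, hp, hhμ⟩ := hh.exists_last_row h0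
  have hdeg : μ.degree + p = d := by
    rw [← hd, hhμ, map_add, degree_ind, card_range]
  have hcont : stripContents μ h = range p := by rw [hhμ, stripContents_add_ind]
  have hW : stripWeight true μ h = 2 := by
    rw [stripWeight, if_pos ⟨hμ, hh, hhμ ▸ strip_add_ind μ (range p)⟩, hcont, starts_range,
      if_pos ⟨rfl, hp⟩]
    simp
  have hmem : h ∈ shapes (μ.degree + p) := mem_shapes.2 ⟨hh, by omega⟩
  have key := pieri hμ p
  rw [← add_sum_erase _ _ hmem, hW, qFun_eq hp] at key
  have hdvd : ∀ l ∈ (shapes (μ.degree + p)).erase h,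
      (stripWeight true μ l : MvPowerSeries ℕ ℤ) * shapeP l =
        2 * (((stripWeight true μ l / 2 : ℤ) : MvPowerSeries ℕ ℤ) * shapeP l) := by
    intro l hl
    have h1 := (mem_shapes.1 (mem_of_mem_erase hl)).2
    have h2 := Int.mul_ediv_cancel' (two_dvd_stripWeight (μ := μ) (l := l) (by omega))
    rw [← mul_assoc]
    congr 1
    conv_lhs => rw [← h2]
    push_cast
    rfl
  rw [sum_congr rfl hdvd, ← mul_sum, Int.cast_ofNat, ← mul_add, mul_left_comm] at key
  have h2 : (2 : MvPowerSeries ℕ ℤ) ≠ 0 := by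
    intro h
    have := congrArg (MvPowerSeries.constantCoeff (σ := ℕ) (R := ℤ)) h
    rw [map_ofNat, map_zero] at this
    norm_num at this
  have key2 := mul_left_cancel₀ h2 key
  rw [← eq_sub_iff_add_eq] at key2
  rw [key2]
  refine sub_mem (mul_mem ?_ ?_) (sum_mem fun l hl => ?_)
  · exact ihd μ.degree (by omega) hμ (by omega) rfl
  · exact shapeP_rowShape_mem hp (by omega)
  · obtain ⟨hlh, hl⟩ := mem_erase.1 hl
    obtain ⟨hl1, hl2⟩ := mem_shapes.1 hl
    by_cases hz : stripWeight true μ l = 0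
    · rw [hz]; simp [zero_mem]
    refine mul_mem (intCast_mem _ _) ?_
    have hs := (stripWeight_ne_zero.1 hz).2.2
    have hcard := hs.degree_eq
    refine iht (d * d - mom l) ?_ hl1 (by omega) (by omega) rfl
    have h3 : mom h < mom l := by
      have hadd : ∀ U ⊆ range d, mom (μ + ind U) = mom μ + ∑ k ∈ U, k := by
        intro U hU
        simp only [mom, Finsupp.add_apply, mul_add, sum_add_distrib, ind_apply, mul_ite, mul_one,
          mul_zero]
        rw [← sum_filter, filter_mem_eq_inter, inter_eq_right.2 hU]
      have h4 : (stripContents μ l).card = p := by omega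
      have h5 : stripContents μ l ≠ range p := fun h' =>
        hlh (by rw [hs.eq_add_ind, h', ← hhμ])
      have h6 := sum_range_lt_sum (U := stripContents μ l) (by rwa [h4])
      rw [h4] at h6
      rw [hhμ, hs.eq_add_ind, hadd _ (range_mono (by omega)),
        hadd _ (stripContents_subset (hl1.support_subset (by omega)))]
      omega
    have := hmom l hl1 (by omega)
    omega

end TypeC

end

noncomputable section

namespace TypeC

open Finset

/-! ### Linear independence -/

theorem sum_eq_degree_of_chainCount_ne_zero {δ : Bool} {α : ℕ → ℕ} {N : ℕ} {h : ℕ →₀ ℕ}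
    (hc : chainCount δ α N h ≠ 0) : ∑ i ∈ range N, α i = h.degree := by
  induction N generalizing h with
  | zero =>
    rw [chainCount, ite_ne_right_iff] at hc
    simp [hc.1]
  | succ N ih =>
    rw [chainCount] at hc
    obtain ⟨κ, hκ, h1⟩ := exists_ne_zero_of_sum_ne_zero hc
    rw [sum_range_succ, ih (mul_ne_zero_iff.1 h1).2, (mem_filter.1 hκ).2]

/-- Lowering every positive height by one amounts to deleting the largest part. -/
theorem IsShape.isShape_sub {h : ℕ →₀ ℕ} (hh : IsShape h) :
    IsShape (h - ind h.support) ∧ h = (h - ind h.support) + ind h.support ∧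
      Strip (h - ind h.support) h := by
  have hle : ind h.support ≤ h := fun k => by
    rw [ind_apply]
    split_ifs with h1
    · rw [Finsupp.mem_support_iff] at h1; omega
    · omega
  have heq := (tsub_add_cancel_of_le hle).symm
  refine ⟨fun k => ?_, heq, ?_⟩
  · have := hh k
    simp only [Finsupp.tsub_apply, ind_apply, Finsupp.mem_support_iff]
    split_ifs <;> omega
  · conv_rhs => rw [heq]
    exact strip_add_ind _ _

/-- If the last step has the largest possible size then it removes a cell of each content. -/
theorem chainCount_succ_of_card_support_le {α : ℕ → ℕ} {N : ℕ} {h : ℕ →₀ ℕ} (hh : IsShape h)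
    (hα : h.support.card ≤ α N) :
    chainCount false α (N + 1) h =
      if h.support.card = α N then chainCount false α N (h - ind h.support) else 0 := by
  obtain ⟨h1, h2, h3⟩ := hh.isShape_sub
  have hcont : stripContents (h - ind h.support) h = h.support := by
    conv_lhs => arg 2; rw [h2]
    exact stripContents_add_ind _ _
  have hdeg : h.degree = (h - ind h.support).degree + h.support.card := by
    rw [h3.degree_eq, hcont]
  have hzero : ∀ κ : ℕ →₀ ℕ, κ.degree + α N = h.degree → stripWeight false κ h ≠ 0 →
      κ = h - ind h.support ∧ h.support.card = α N := by
    intro κ hκ hw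
    have hs := (stripWeight_ne_zero.1 hw).2.2
    have h4 := hs.degree_eq
    have h5 : stripContents κ h ⊆ h.support := filter_subset _ _
    have h6 := eq_of_subset_of_card_le h5 (by omega)
    refine ⟨?_, by rw [← h6]; omega⟩
    rw [← h6]
    exact (tsub_eq_of_eq_add hs.eq_add_ind).symm
  rw [chainCount]
  split_ifs with hc
  · rw [sum_eq_single_of_mem (h - ind h.support)]
    · have : stripWeight false (h - ind h.support) h = 1 := by
        rw [stripWeight, if_pos ⟨h1, hh, h3⟩, hcont, hh.support_eq, starts_range]
        simp
      rw [this, one_mul]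
    · rw [mem_filter, mem_shapesLE]
      exact ⟨⟨h1, by omega⟩, by omega⟩
    · intro κ hκ hne
      by_cases hw : stripWeight false κ h = 0
      · rw [hw, zero_mul]
      · exact absurd (hzero κ (mem_filter.1 hκ).2 hw).1 hne
  · refine sum_eq_zero fun κ hκ => ?_
    by_cases hw : stripWeight false κ h = 0
    · rw [hw, zero_mul]
    · exact absurd (hzero κ (mem_filter.1 hκ).2 hw).2 hc

/-- A leading monomial argument, by induction on the number of variables. Let L be the largest first
part among the shapes with nonzero coefficient. Exponent L in the last variable singles out the
shapes with first part L, each with weight 1, and deletes this part; the heights at 0, i.e. the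
numbers of parts, stay bounded by the number of remaining variables. -/
theorem chainCount_independent {N : ℕ} {s : Finset (ℕ →₀ ℕ)}
    (hs : ∀ h ∈ s, IsShape h ∧ h 0 ≤ N) {a : (ℕ →₀ ℕ) → ℤ}
    (ha : ∀ α : ℕ → ℕ, ∑ h ∈ s, a h * chainCount false α N h = 0) : ∀ h ∈ s, a h = 0 := by
  classical
  induction N generalizing s a with
  | zero =>
    intro h hh
    have h0 : ∀ h ∈ s, h = 0 := fun h hh => by
      ext k
      have := (hs h hh).1.antitone (Nat.zero_le k)
      have := (hs h hh).2
      simp only [Finsupp.coe_zero, Pi.zero_apply]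
      omega
    have h1 := ha 0
    obtain rfl := h0 h hh
    rw [sum_eq_single_of_mem 0 hh fun b hb hne => absurd (h0 b hb) hne] at h1
    simpa [chainCount] using h1
  | succ N ih =>
    by_contra! hne
    obtain ⟨g, hgs, hg⟩ := hne
    set s' := s.filter fun h => a h ≠ 0 with hs'
    obtain ⟨m, hms, hmax⟩ := exists_max_image s' (fun h => h.support.card)
      ⟨g, mem_filter.2 ⟨hgs, hg⟩⟩
    set L := m.support.card with hL
    set t := s'.filter fun h => h.support.card = L with ht
    have htS : ∀ h ∈ t, h ∈ s ∧ a h ≠ 0 ∧ h.support = range L := fun h hh => by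
      obtain ⟨h1, h2⟩ := mem_filter.1 hh
      obtain ⟨h3, h4⟩ := mem_filter.1 h1
      exact ⟨h3, h4, by rw [(hs h h3).1.support_eq, h2]⟩
    have hinv : ∀ h ∈ t, h = (h - ind (range L)) + ind (range L) := fun h hh => by
      have := (hs h (htS h hh).1).1.isShape_sub.2.1
      rwa [(htS h hh).2.2] at this
    have key : ∀ α : ℕ → ℕ, ∑ κ ∈ t.image (fun h => h - ind (range L)),
        a (κ + ind (range L)) * chainCount false α N κ = 0 := by
      intro α
      -- The exponent `L` kills every shape with a shorter first part, since a strip in such a shape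
      -- has fewer than `L` cells.
      have h1 := ha (Function.update α N L)
      rw [sum_image fun x hx y hy hxy => by rw [hinv x hx, hinv y hy]; simp only [hxy], ← h1,
        ← sum_subset (filter_subset (fun h => a h ≠ 0) s), ← hs', ht, sum_filter]
      · refine sum_congr rfl fun h hh => ?_
        obtain ⟨h3, h4⟩ := mem_filter.1 hh
        have h5 := hmax h hh
        rw [chainCount_succ_of_card_support_le (hs h h3).1 (by simpa using h5),
          Function.update_self,
          chainCount_congr (α := Function.update α N L) (β := α) fun i hi =>
            Function.update_of_ne (by omega) _ _]
        split_ifs with h6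
        · have h7 : h ∈ t := mem_filter.2 ⟨hh, h6⟩
          rw [← hinv h h7, (htS h h7).2.2]
        · simp
      · intro h h2 h3
        simp only [mem_filter, h2, true_and, not_not] at h3
        rw [h3, zero_mul]
    have hmt : m ∈ t := mem_filter.2 ⟨hms, rfl⟩
    refine (htS m hmt).2.1 ?_
    rw [hinv m hmt]
    refine ih (s := t.image fun h => h - ind (range L)) (a := fun κ => a (κ + ind (range L)))
      ?_ key _ (mem_image_of_mem _ hmt)
    intro κ hκ
    obtain ⟨h, hh, rfl⟩ := mem_image.1 hκ
    obtain ⟨h1, h2, h3⟩ := htS h hh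
    have h4 := (hs h h1).1.isShape_sub.1
    rw [h3] at h4
    refine ⟨h4, ?_⟩
    have h5 := (hs h h1).2
    simp only [Finsupp.tsub_apply, ind_apply, mem_range]
    have h6 : h 0 ≠ 0 ↔ 0 < L := by
      rw [← Finsupp.mem_support_iff, h3, mem_range]
    split_ifs with h7 <;> omega

theorem coeff_zsmul (α : ℕ →₀ ℕ) (x : ℤ) (f : MvPowerSeries ℕ ℤ) :
    MvPowerSeries.coeff α (x • f) = x * MvPowerSeries.coeff α f := by
  rw [map_zsmul, smul_eq_mul]

theorem shapeP_independent {s : Finset (ℕ →₀ ℕ)} (hs : ∀ h ∈ s, IsShape h) {a : (ℕ →₀ ℕ) → ℤ}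
    (ha : ∑ h ∈ s, a h • shapeP h = 0) : ∀ h ∈ s, a h = 0 := by
  refine chainCount_independent (N := s.sup fun h => h 0)
    (fun h hh => ⟨hs h hh, le_sup (f := fun h : ℕ →₀ ℕ => h 0) hh⟩) fun α => ?_
  set N := s.sup fun h => h 0
  let β : ℕ →₀ ℕ := Finsupp.onFinset (range N) (fun i => if i < N then α i else 0) fun i hi => by
    simpa using (ite_ne_right_iff.1 hi).1
  have hβ : ∀ i, N ≤ i → β i = 0 := fun i hi => if_neg (by omega)
  have h1 := congrArg (MvPowerSeries.coeff β) ha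
  rw [map_sum, map_zero] at h1
  rw [← h1]
  refine sum_congr rfl fun h hh => ?_
  rw [coeff_zsmul, coeff_shapeP (hs h hh) hβ,
    chainCount_congr (α := β) (β := α) fun i hi => if_pos hi]

theorem schurP_independent {a : StrictPartition →₀ ℤ}
    (ha : (a.sum fun lam x => x • schurP lam) = 0) : a = 0 := by
  classical
  ext lam
  by_cases hlam : lam ∈ a.support
  · have h1 : ∑ h ∈ a.support.image StrictPartition.ht, a (ofShape h) • shapeP h = 0 := by
      rw [sum_image fun x _ y _ h => StrictPartition.ht_injective h, ← ha]
      refine sum_congr rfl fun mu _ => ?_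
      rw [shapeP, ofShape_ht]
    have h2 := shapeP_independent (fun h hh => by
      obtain ⟨mu, -, rfl⟩ := mem_image.1 hh
      exact mu.isShape_ht) h1 lam.ht (mem_image_of_mem _ hlam)
    rwa [ofShape_ht] at h2
  · simpa using hlam

/-! ### Schur Q-functions are multiples of Schur P-functions -/

/-- Allowing diagonal marks adds one start exactly if the strip contains a diagonal cell, that is,
if the height at 0 increases. Along a chain these factors multiply to 2 to the number of parts. -/
theorem stripWeight_true (κ h : ℕ →₀ ℕ) :
    2 ^ κ 0 * stripWeight true κ h = 2 ^ h 0 * stripWeight false κ h := by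
  simp only [stripWeight]
  split_ifs with hs
  · set U := stripContents κ h with hU
    have h1 := hs.2.2 0
    rw [← pow_add, ← pow_add]
    congr 1
    by_cases h0 : 0 ∈ U
    · have h2 : starts true U = insert 0 (starts false U) := by
        ext k
        by_cases hk : k = 0 <;> simp [starts, hk, h0]
      rw [h2, card_insert_of_notMem (by simp [starts])]
      rw [hU, mem_stripContents] at h0
      omega
    · have h2 : starts true U = starts false U := by
        ext k
        by_cases hk : k = 0 <;> simp [starts, hk, h0]
      rw [h2]
      rw [hU, mem_stripContents] at h0
      omega
  · simp

theorem chainCount_true (α : ℕ → ℕ) (N : ℕ) (h : ℕ →₀ ℕ) :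
    chainCount true α N h = 2 ^ h 0 * chainCount false α N h := by
  induction N generalizing h with
  | zero =>
    simp only [chainCount]
    split_ifs with h0 <;> simp [h0]
  | succ N ih =>
    rw [chainCount, chainCount, mul_sum]
    refine sum_congr rfl fun κ _ => ?_
    rw [ih]
    linear_combination chainCount false α N κ * stripWeight_true κ h

theorem schurQ_eq (lam : StrictPartition) : schurQ lam = (2 ^ lam.ht 0 : ℤ) • schurP lam := by
  ext α
  obtain ⟨N, hN⟩ := exists_bound α
  rw [coeff_zsmul, coeff_schurQ lam hN, coeff_schurP lam hN, chainCount_true]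

theorem schurQ_independent {a : StrictPartition →₀ ℤ}
    (ha : (a.sum fun lam x => x • schurQ lam) = 0) : a = 0 := by
  let b : StrictPartition →₀ ℤ := Finsupp.onFinset a.support (fun lam => a lam * 2 ^ lam.ht 0)
    fun lam h => by
      rw [Finsupp.mem_support_iff]
      exact (mul_ne_zero_iff.1 h).1
  have h2 : b = 0 := by
    refine schurP_independent ?_
    rw [Finsupp.onFinset_sum, ← ha]
    · refine sum_congr rfl fun lam _ => ?_
      simp only [schurQ_eq, smul_smul]
    · simp
  ext lam
  have h3 := DFunLike.congr_fun h2 lam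
  have h4 : a lam * 2 ^ lam.ht 0 = 0 := h3
  simpa using h4

theorem coeff_schurP_eq_zero {lam : StrictPartition} {α : ℕ →₀ ℕ} (hα : α.degree ≠ lam.ht.degree) :
    MvPowerSeries.coeff α (schurP lam) = 0 := by
  obtain ⟨N, hN⟩ := exists_bound α
  rw [coeff_schurP lam hN]
  by_contra h
  apply hα
  rw [← sum_eq_degree_of_chainCount_ne_zero h, degree_eq_sum_range]
  intro i hi
  rw [Finsupp.mem_support_iff] at hi
  by_contra h'
  exact hi (hN i (by simpa using h'))

theorem coeff_schurQ_eq_zero {lam : StrictPartition} {α : ℕ →₀ ℕ} (hα : α.degree ≠ lam.ht.degree) :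
    MvPowerSeries.coeff α (schurQ lam) = 0 := by
  rw [schurQ_eq, coeff_zsmul, coeff_schurP_eq_zero hα, mul_zero]

/-! ### Commutation of the strip operators -/

/-- The operator that adds a strip of size `a`. -/
def stripOp (a : ℕ) (f : (ℕ →₀ ℕ) → ℤ) (h : ℕ →₀ ℕ) : ℤ :=
  ∑ κ ∈ shapesLE h.degree with κ.degree + a = h.degree, stripWeight true κ h * f κ

theorem chainCount_succ_eq (α : ℕ → ℕ) (N : ℕ) :
    chainCount true α (N + 1) = stripOp (α N) (chainCount true α N) := rfl

/-- Both sides are the coefficient of P_h in P_ρ q_a q_b, by two applications of the Pieri rule and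
linear independence. -/
theorem sum_stripWeight_comm {ρ h : ℕ →₀ ℕ} (hρ : IsShape ρ) (hh : IsShape h) {a b : ℕ}
    (hd : h.degree = ρ.degree + a + b) :
    ∑ κ ∈ shapes (ρ.degree + a), stripWeight true ρ κ * stripWeight true κ h =
      ∑ κ ∈ shapes (ρ.degree + b), stripWeight true ρ κ * stripWeight true κ h := by
  have key : ∀ a b : ℕ, ∑ h ∈ shapes (ρ.degree + a + b),
      (∑ κ ∈ shapes (ρ.degree + a), stripWeight true ρ κ * stripWeight true κ h) • shapeP h =
      shapeP ρ * qFun a * qFun b := by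
    intro a b
    rw [← pieri hρ a, sum_mul]
    have h1 : ∀ κ ∈ shapes (ρ.degree + a),
        (stripWeight true ρ κ : MvPowerSeries ℕ ℤ) * shapeP κ * qFun b =
        ∑ h ∈ shapes (ρ.degree + a + b), (stripWeight true ρ κ * stripWeight true κ h) • shapeP h := by
      intro κ hκ
      obtain ⟨h1, h2⟩ := mem_shapes.1 hκ
      rw [mul_assoc, ← pieri h1 b, h2, mul_sum]
      refine sum_congr rfl fun h _ => ?_
      rw [zsmul_eq_mul]
      push_cast
      ring
    rw [sum_congr rfl h1, sum_comm]
    exact sum_congr rfl fun h _ => by rw [sum_smul]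
  have h1 := key a b
  have h2 := key b a
  rw [show ρ.degree + b + a = ρ.degree + a + b by ring, mul_right_comm, ← h1, eq_comm,
    ← sub_eq_zero, ← sum_sub_distrib] at h2
  simp only [← sub_smul] at h2
  have h3 := shapeP_independent (fun h hh => (mem_shapes.1 hh).1) h2 h (mem_shapes.2 ⟨hh, hd⟩)
  exact sub_eq_zero.1 h3

theorem stripOp_stripOp (a b : ℕ) (f : (ℕ →₀ ℕ) → ℤ) (h : ℕ →₀ ℕ) :
    stripOp a (stripOp b f) h = ∑ ρ ∈ shapesLE h.degree with ρ.degree + b + a = h.degree,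
      (∑ κ ∈ shapes (ρ.degree + b), stripWeight true ρ κ * stripWeight true κ h) * f ρ := by
  simp only [stripOp, mul_sum, sum_mul]
  rw [sum_sigma', sum_sigma']
  refine sum_bij' (fun p _ => ⟨p.2, p.1⟩) (fun p _ => ⟨p.2, p.1⟩) ?_ ?_ ?_ ?_ ?_
  · rintro ⟨κ, ρ⟩ hp
    simp only [mem_sigma, mem_filter, mem_shapesLE, mem_shapes] at hp ⊢
    obtain ⟨⟨⟨h1, h2⟩, h3⟩, ⟨h4, h5⟩, h6⟩ := hp
    exact ⟨⟨⟨h4, by omega⟩, by omega⟩, h1, by omega⟩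
  · rintro ⟨ρ, κ⟩ hp
    simp only [mem_sigma, mem_filter, mem_shapesLE, mem_shapes] at hp ⊢
    obtain ⟨⟨⟨h1, h2⟩, h3⟩, h4, h5⟩ := hp
    exact ⟨⟨⟨h4, by omega⟩, by omega⟩, ⟨h1, by omega⟩, by omega⟩
  · exact fun _ _ => rfl
  · exact fun _ _ => rfl
  · rintro ⟨κ, ρ⟩ _
    ring

theorem stripOp_comm (a b : ℕ) (f : (ℕ →₀ ℕ) → ℤ) :
    stripOp a (stripOp b f) = stripOp b (stripOp a f) := by
  funext h
  by_cases hh : IsShape h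
  · rw [stripOp_stripOp, stripOp_stripOp]
    refine sum_congr (filter_congr fun ρ _ => by omega) fun ρ hρ => ?_
    rw [mem_filter, mem_shapesLE] at hρ
    rw [sum_stripWeight_comm hρ.1.1 hh (a := b) (b := a) (by omega)]
  · have : ∀ a f, stripOp a f h = 0 := fun a f => sum_eq_zero fun κ _ => by
      rw [stripWeight_of_not fun h' => hh h'.2.1, zero_mul]
    rw [this, this]

/-- The first step of a chain may be exchanged with the others. -/
theorem chainCount_succ' (α : ℕ → ℕ) (N : ℕ) :
    chainCount true α (N + 1) = stripOp (α 0) (chainCount true (fun i => α (i + 1)) N) := by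
  induction N with
  | zero => rfl
  | succ N ih => rw [chainCount_succ_eq, ih, stripOp_comm]; rfl

end TypeC

end

noncomputable section

namespace TypeC

open Finset

/-! ### Adding boxes to shapes -/

theorem single_one_apply (c k : ℕ) :
    (Finsupp.single c 1 : ℕ →₀ ℕ) k = if k = c then 1 else 0 := by
  rw [Finsupp.single_apply]
  exact if_congr eq_comm rfl rfl

theorem isShape_add_single {h : ℕ →₀ ℕ} (hh : IsShape h) {c : ℕ} (h1 : h c ≤ h (c + 1))
    (h2 : c = 0 ∨ h c < h (c - 1)) : IsShape (h + Finsupp.single c 1) := fun k => by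
  have := hh k
  simp only [Finsupp.add_apply, single_one_apply]
  by_cases hk : k = c
  · subst hk
    simp
    omega
  · by_cases hk' : k + 1 = c
    · subst hk'
      simp at h2 ⊢
      omega
    · rw [if_neg hk, if_neg hk']
      omega

theorem exists_eq_add_single {h : ℕ →₀ ℕ} (hh : IsShape h) {c : ℕ} (h1 : h (c + 1) < h c)
    (h2 : c = 0 ∨ h (c - 1) ≤ h c) : ∃ κ, IsShape κ ∧ h = κ + Finsupp.single c 1 := by
  have hle : Finsupp.single c 1 ≤ h := by
    rw [Finsupp.single_le_iff]
    omega
  refine ⟨h - Finsupp.single c 1, fun k => ?_, (tsub_add_cancel_of_le hle).symm⟩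
  have := hh k
  simp only [Finsupp.tsub_apply, single_one_apply]
  by_cases hk : k = c
  · subst hk
    simp
    omega
  · by_cases hk' : k + 1 = c
    · subst hk'
      simp at h2 ⊢
      omega
    · rw [if_neg hk, if_neg hk']
      omega

theorem IsShape.exists_corner {h : ℕ →₀ ℕ} (hh : IsShape h) (h0 : h ≠ 0) :
    ∃ c κ, IsShape κ ∧ h = κ + Finsupp.single c 1 := by
  have hex : ∃ k, h (k + 1) < h k := by
    by_contra! hn
    have : ∀ k, h 0 ≤ h k := fun k => by
      induction k with
      | zero => exact le_rfl
      | succ k ih => exact ih.trans (hn k)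
    have h1 := this h.degree
    rw [hh.eq_zero_of_degree_le le_rfl] at h1
    apply h0
    ext k
    have := hh.antitone (Nat.zero_le k)
    simp only [Finsupp.coe_zero, Pi.zero_apply]
    omega
  classical
  refine ⟨Nat.find hex, exists_eq_add_single hh (Nat.find_spec hex) ?_⟩
  by_cases hz : Nat.find hex = 0
  · exact Or.inl hz
  · right
    have := Nat.find_min hex (m := Nat.find hex - 1) (by omega)
    rw [show Nat.find hex - 1 + 1 = Nat.find hex by omega] at this
    omega

/-- At each content a shape has an addable box, or a removable box, or neither, in which case the
height function is affine there. -/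
theorem IsShape.trichotomy {h : ℕ →₀ ℕ} (hh : IsShape h) (c : ℕ) :
    IsShape (h + Finsupp.single c 1) ∨ (∃ κ, IsShape κ ∧ h = κ + Finsupp.single c 1) ∨
      (c ≠ 0 ∧ h (c - 1) + h (c + 1) = 2 * h c) := by
  have h1 := hh c
  by_cases hc : c = 0
  · by_cases h2 : h c ≤ h (c + 1)
    · exact Or.inl (isShape_add_single hh h2 (Or.inl hc))
    · exact Or.inr (Or.inl (exists_eq_add_single hh (by omega) (Or.inl hc)))
  · have h2 := hh (c - 1)
    rw [show c - 1 + 1 = c by omega] at h2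
    by_cases h3 : h c ≤ h (c + 1)
    · by_cases h4 : h c < h (c - 1)
      · exact Or.inl (isShape_add_single hh h3 (Or.inr h4))
      · exact Or.inr (Or.inr ⟨hc, by omega⟩)
    · by_cases h4 : h c < h (c - 1)
      · exact Or.inr (Or.inr ⟨hc, by omega⟩)
      · exact Or.inr (Or.inl (exists_eq_add_single hh (by omega) (Or.inr (by omega))))

/-- `Builds ω μ h`: the letters of `ω`, read from right to left, are the contents of boxes that
are successively added to the shape `μ` to obtain the shape `h`. -/
inductive Builds : List ℕ → (ℕ →₀ ℕ) → (ℕ →₀ ℕ) → Prop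
  | nil {h} (hh : IsShape h) : Builds [] h h
  | cons {c ω μ κ} (hb : Builds ω μ κ) (hh : IsShape (κ + Finsupp.single c 1)) :
      Builds (c :: ω) μ (κ + Finsupp.single c 1)

namespace Builds

variable {ω ω' : List ℕ} {μ κ h : ℕ →₀ ℕ}

theorem isShape_right (hb : Builds ω μ h) : IsShape h := by
  cases hb <;> assumption

theorem isShape_left (hb : Builds ω μ h) : IsShape μ := by
  induction hb <;> assumption

theorem apply_eq (hb : Builds ω μ h) (k : ℕ) : h k = μ k + ω.count k := by
  induction hb with
  | nil => simp
  | cons hb hh ih =>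
    rw [Finsupp.add_apply, ih, single_one_apply, List.count_cons]
    simp only [beq_iff_eq, eq_comm (a := k)]
    ring

theorem degree_eq (hb : Builds ω μ h) : h.degree = μ.degree + ω.length := by
  induction hb with
  | nil => simp
  | cons hb hh ih =>
    rw [map_add, ih, Finsupp.degree_single, List.length_cons]
    ring

theorem append (hb : Builds ω κ h) (hb' : Builds ω' μ κ) : Builds (ω ++ ω') μ h := by
  induction hb with
  | nil => exact hb'
  | cons hb hh ih => exact cons (ih hb') hh

theorem exists_of_append (hb : Builds (ω ++ ω') μ h) : ∃ κ, Builds ω κ h ∧ Builds ω' μ κ := by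
  induction ω generalizing h with
  | nil => exact ⟨h, nil hb.isShape_right, hb⟩
  | cons c ω ih =>
    cases hb with
    | cons hb hh =>
      obtain ⟨κ, h1, h2⟩ := ih hb
      exact ⟨κ, cons h1 hh, h2⟩

theorem cons_of_eq {c : ℕ} (hb : Builds ω μ κ) (hh : IsShape h)
    (he : h = κ + Finsupp.single c 1) : Builds (c :: ω) μ h := by
  subst he
  exact cons hb hh

theorem lt_degree (hb : Builds ω μ h) {c : ℕ} (hc : c ∈ ω) : c < h.degree := by
  refine hb.isShape_right.lt_degree ?_
  rw [hb.apply_eq]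
  have := List.count_pos_iff.2 hc
  omega

end Builds

theorem exists_builds {h : ℕ →₀ ℕ} (hh : IsShape h) : ∃ ω, Builds ω 0 h := by
  obtain ⟨d, hd⟩ : ∃ d, h.degree = d := ⟨_, rfl⟩
  induction d generalizing h with
  | zero =>
    rw [Finsupp.degree_eq_zero_iff] at hd
    exact ⟨[], by rw [hd]; exact Builds.nil isShape_zero⟩
  | succ d ih =>
    obtain ⟨c, κ, h1, h2⟩ := hh.exists_corner (by rintro rfl; simp at hd)
    obtain ⟨ω, hω⟩ := ih h1 (by
      rw [h2, map_add, Finsupp.degree_single] at hd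
      omega)
    exact ⟨c :: ω, hω.cons_of_eq hh h2⟩

/-! ### Relations in the affine Weyl group -/

section Relations

variable {n : ℕ}

/-- The simple generator with a natural number as index. -/
def gen (n c : ℕ) : AffineC n := if h : c < n + 1 then (coxC n).simple ⟨c, h⟩ else 1

/-- The product of the generators of a word. -/
def wordVal (n : ℕ) (ω : List ℕ) : AffineC n := (ω.map (gen n)).prod

theorem gen_val (i : Fin (n + 1)) : gen n i = (coxC n).simple i := dif_pos i.2

theorem wordProd_eq (ω : List (Fin (n + 1))) :
    (coxC n).wordProd ω = wordVal n (ω.map Fin.val) := by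
  rw [wordVal, List.map_map, CoxeterSystem.wordProd]
  congr 2
  funext i
  exact (gen_val i).symm

theorem wordVal_cons (c : ℕ) (ω : List ℕ) : wordVal n (c :: ω) = gen n c * wordVal n ω := by
  simp [wordVal]

theorem wordVal_append (ω ω' : List ℕ) :
    wordVal n (ω ++ ω') = wordVal n ω * wordVal n ω' := by
  simp [wordVal]

theorem wordVal_nil : wordVal n [] = 1 := rfl

theorem gen_mul_self (c : ℕ) : gen n c * gen n c = 1 := by
  rw [gen]
  split_ifs
  · exact (coxC n).simple_mul_simple_self _
  · simp

theorem gen_mul_self_mul (c : ℕ) (w : AffineC n) : gen n c * (gen n c * w) = w := by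
  rw [← mul_assoc, gen_mul_self, one_mul]

theorem gen_inv (c : ℕ) : (gen n c)⁻¹ = gen n c := inv_eq_of_mul_eq_one_left (gen_mul_self c)

theorem gen_mul_pow {c d : ℕ} (hc : c < n + 1) (hd : d < n + 1) :
    (gen n c * gen n d) ^ (affineCMatrix n).M ⟨c, hc⟩ ⟨d, hd⟩ = 1 := by
  rw [gen, gen, dif_pos hc, dif_pos hd]
  exact (coxC n).simple_mul_simple_pow _ _

theorem gen_comm {c d : ℕ} (hcd : c + 2 ≤ d) : gen n c * gen n d = gen n d * gen n c := by
  by_cases hd : d < n + 1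
  · have h1 := gen_mul_pow (n := n) (show c < n + 1 by omega) hd
    have h2 : (affineCMatrix n).M ⟨c, by omega⟩ ⟨d, hd⟩ = 2 := by
      simp only [affineCMatrix, Matrix.of_apply, Fin.mk.injEq]
      rw [if_neg (by omega), if_neg (by omega)]
    rw [h2, pow_two] at h1
    have h3 := eq_inv_of_mul_eq_one_left h1
    rwa [mul_inv_rev, gen_inv, gen_inv] at h3
  -- Beyond the last node `gen` takes the default value 1, which commutes with everything.
  · rw [gen, gen, dif_neg hd]
    simp

theorem gen_braid {c : ℕ} (hc : 1 ≤ c) (hcn : c + 1 < n) :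
    gen n c * gen n (c + 1) * gen n c = gen n (c + 1) * gen n c * gen n (c + 1) := by
  have h1 := gen_mul_pow (n := n) (show c < n + 1 by omega) (show c + 1 < n + 1 by omega)
  have h2 : (affineCMatrix n).M ⟨c, by omega⟩ ⟨c + 1, by omega⟩ = 3 := by
    have h1 : n ≠ 1 := by omega
    have h2 : c ≠ 0 := by omega
    have h3 : c ≠ n := by omega
    have h4 : c + 1 ≠ n := by omega
    simp [affineCMatrix, h1, h2, h3, h4]
  rw [h2] at h1
  have h3 : (gen n c * gen n (c + 1) * gen n c) * (gen n (c + 1) * gen n c * gen n (c + 1)) = 1 := by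
    rw [← h1]; simp only [pow_succ, pow_zero, one_mul, mul_assoc]
  have h4 := eq_inv_of_mul_eq_one_left h3
  rw [mul_inv_rev, mul_inv_rev, gen_inv, gen_inv] at h4
  rw [h4, mul_assoc]

theorem gen_braid_zero (hn : 2 ≤ n) :
    gen n 1 * gen n 0 * gen n 1 * gen n 0 = gen n 0 * gen n 1 * gen n 0 * gen n 1 := by
  have h1 := gen_mul_pow (n := n) (show 1 < n + 1 by omega) (show 0 < n + 1 by omega)
  have h2 : (affineCMatrix n).M ⟨1, by omega⟩ ⟨0, by omega⟩ = 4 := by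
    have h1 : n ≠ 1 := by omega
    simp [affineCMatrix, h1]
  rw [h2] at h1
  have h3 : (gen n 1 * gen n 0 * gen n 1 * gen n 0) * (gen n 1 * gen n 0 * gen n 1 * gen n 0) = 1 := by
    rw [← h1]; simp only [pow_succ, pow_zero, one_mul, mul_assoc]
  have h4 := eq_inv_of_mul_eq_one_left h3
  simp only [mul_inv_rev, gen_inv] at h4
  rw [h4]
  simp only [mul_assoc]

/-! ### The element of a shape -/

/-- The product of a word only depends on the shape that the word builds. -/
theorem wordVal_eq_of_builds {ω ω' : List ℕ} {h : ℕ →₀ ℕ} (hb : Builds ω 0 h)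
    (hb' : Builds ω' 0 h) : wordVal n ω = wordVal n ω' := by
  obtain ⟨d, hd⟩ : ∃ d, h.degree = d := ⟨_, rfl⟩
  induction d generalizing h ω ω' with
  | zero =>
    have h1 := hb.degree_eq
    have h2 := hb'.degree_eq
    rw [hd, map_zero, zero_add, eq_comm, List.length_eq_zero_iff] at h1 h2
    rw [h1, h2]
  | succ d ih =>
    generalize hh : h = h' at hb'
    rcases hb with _ | @⟨c, ω, _, κ, hb, hs⟩
    · simp at hd
    rcases hb' with _ | @⟨c', ω', _, κ', hb', hs'⟩
    · rw [hh] at hd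
      simp at hd
    have hdeg : κ.degree = d := by
      rw [map_add, Finsupp.degree_single] at hd; omega
    have hdeg' : κ'.degree = d := by
      rw [hh, map_add, Finsupp.degree_single] at hd; omega
    rw [wordVal_cons, wordVal_cons]
    by_cases hc : c = c'
    · subst hc
      rw [add_left_inj] at hh
      subst hh
      rw [ih hb hb' hdeg]
    · have hk : ∀ k, κ k + (if k = c then 1 else 0) = κ' k + (if k = c' then 1 else 0) := fun k => by
        have := DFunLike.congr_fun hh k
        simpa only [Finsupp.add_apply, single_one_apply] using this
      have s1 := hb.isShape_right
      have s2 := hb'.isShape_right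
      have hc1 := hk c
      have hc2 := hk c'
      rw [if_pos rfl, if_neg hc] at hc1
      rw [if_pos rfl, if_neg (Ne.symm hc)] at hc2
      -- Two different contents with removable boxes cannot be adjacent. Hence both boxes can be
      -- removed, in either order, and their generators commute.
      have hfar : c + 2 ≤ c' ∨ c' + 2 ≤ c := by
        by_contra hn
        rcases (show c' = c + 1 ∨ c = c' + 1 by omega) with rfl | rfl
        · have := s1 c
          have := s2 c
          omega
        · have := s1 c'
          have := s2 c'
          omega
      have hle : Finsupp.single c' 1 ≤ κ := by rw [Finsupp.single_le_iff]; omega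
      obtain ⟨ρ, hρ⟩ : ∃ ρ, κ = ρ + Finsupp.single c' 1 := ⟨_, (tsub_add_cancel_of_le hle).symm⟩
      have hρ' : κ' = ρ + Finsupp.single c 1 := by
        rw [hρ, add_right_comm] at hh
        exact (add_right_cancel hh).symm
      have hρs : IsShape ρ := fun k => by
        have t1 := s1 k
        have t2 := s2 k
        rw [hρ] at t1
        rw [hρ'] at t2
        simp only [Finsupp.add_apply, single_one_apply] at t1 t2
        split_ifs at t1 t2 <;> omega
      obtain ⟨τ, hτ⟩ := exists_builds hρs
      rw [ih hb (hτ.cons_of_eq s1 hρ) hdeg, ih hb' (hτ.cons_of_eq s2 hρ') hdeg', wordVal_cons,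
        wordVal_cons, ← mul_assoc, ← mul_assoc]
      congr 1
      rcases hfar with hf | hf
      · exact gen_comm hf
      · exact (gen_comm hf).symm

/-- If a shape has neither an addable nor a removable box of content `c`, then the generator
`s_c` can be moved to the other side of its element. -/
theorem exists_gen_mul_wordVal {ω : List ℕ} {h : ℕ →₀ ℕ} (hb : Builds ω 0 h) (hn : h.degree < n)
    {c : ℕ} (hc : c ≠ 0) (hcn : c ≤ n) (hneu : h (c - 1) + h (c + 1) = 2 * h c) :
    ∃ d, d ≠ 0 ∧ d ≤ n ∧ gen n c * wordVal n ω = wordVal n ω * gen n d := by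
  obtain ⟨m, hm⟩ : ∃ m, h.degree = m := ⟨_, rfl⟩
  induction m using Nat.strong_induction_on generalizing h ω c with
  | _ m ih =>
  rcases hb with _ | @⟨b, ω, _, κ, hb, hs⟩
  · exact ⟨c, hc, hcn, by rw [wordVal_nil, one_mul, mul_one]⟩
  have hb1 := hb.isShape_right
  have hbn : b < (κ + Finsupp.single b 1).degree := (hb.cons hs).lt_degree (by simp)
  have hdeg : (κ + Finsupp.single b 1).degree = κ.degree + 1 := by
    rw [map_add, Finsupp.degree_single]
  simp only [Finsupp.add_apply, single_one_apply] at hneu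
  rw [wordVal_cons]
  by_cases hfar : c + 2 ≤ b ∨ b + 2 ≤ c
  -- The last box is far from `c`: the generators commute, and `c` is already neutral for the
  -- smaller shape.
  · rw [if_neg (by omega), if_neg (by omega), if_neg (by omega)] at hneu
    obtain ⟨d, hd0, hdn, hd⟩ := ih κ.degree (by omega) hb (by omega) hc hcn (by omega) rfl
    refine ⟨d, hd0, hdn, ?_⟩
    have hcomm : gen n c * gen n b = gen n b * gen n c := by
      rcases hfar with hf | hf
      · exact gen_comm hf
      · exact (gen_comm hf).symm
    rw [← mul_assoc, hcomm, mul_assoc, hd, mul_assoc]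
  have t1 := hb1 (c - 1)
  have t2 := hb1 c
  have t3 := hs (c - 1)
  have t4 := hs c
  simp only [Finsupp.add_apply, single_one_apply, show c - 1 + 1 = c by omega] at t1 t3 t4
  rcases (show b = c ∨ b = c + 1 ∨ c = b + 1 by omega) with rfl | rfl | rfl
  -- The last box cannot have content `c`, for it would be removable there.
  · rw [if_neg (by omega), if_pos rfl, if_neg (by omega)] at hneu
    simp only [if_true, if_neg (show b - 1 ≠ b by omega), if_neg (show b + 1 ≠ b by omega)] at t3 t4
    omega
  -- The last box has content `c + 1`. Neutrality makes a box of content `c` removable before it;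
  -- after the braid relation, s_{c+1} meets the shape `ρ` without these two boxes, for which `c +
  -- 1` is neutral.
  · simp only [if_true, if_neg (show c - 1 ≠ c + 1 by omega), if_neg (show c ≠ c + 1 by omega)]
      at hneu t3 t4
    have t5 := hb1 (c + 1)
    obtain ⟨ρ, hρ, hκ⟩ := exists_eq_add_single hb1 (c := c) (by omega) (Or.inr (by omega))
    obtain ⟨ω', hω'⟩ := exists_builds hρ
    have hk : ∀ k, κ k = ρ k + if k = c then 1 else 0 := fun k => by
      rw [hκ, Finsupp.add_apply, single_one_apply]
    have hρd : κ.degree = ρ.degree + 1 := by rw [hκ, map_add, Finsupp.degree_single]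
    have e1 := hk c
    have e2 := hk (c + 1)
    have e3 := hk (c + 1 + 1)
    simp only [if_true, if_neg (show c + 1 ≠ c by omega), if_neg (show c + 1 + 1 ≠ c by omega)]
      at e1 e2 e3
    have t6 := hs (c + 1)
    simp only [Finsupp.add_apply, single_one_apply, if_true,
      if_neg (show c + 1 + 1 ≠ c + 1 by omega)] at t6
    obtain ⟨d, hd0, hdn, hd⟩ := ih ρ.degree (by omega) hω' (by omega) (c := c + 1) (by omega)
      (by omega) (by simp only [Nat.add_sub_cancel]; omega) rfl
    refine ⟨d, hd0, hdn, ?_⟩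
    rw [wordVal_eq_of_builds hb (hω'.cons_of_eq hb1 hκ), wordVal_cons, ← mul_assoc, ← mul_assoc,
      gen_braid (by omega) (by omega), mul_assoc, hd]
    simp only [mul_assoc]
  · simp only [if_true, Nat.add_sub_cancel, if_neg (show b + 1 ≠ b by omega),
      if_neg (show b + 1 + 1 ≠ b by omega)] at hneu t1 t3 t4
    obtain ⟨ρ, hρ, hκ⟩ := exists_eq_add_single hb1 (c := b + 1) (by omega) (Or.inr (by
      simp only [Nat.add_sub_cancel]; omega))
    have hk : ∀ k, κ k = ρ k + if k = b + 1 then 1 else 0 := fun k => by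
      rw [hκ, Finsupp.add_apply, single_one_apply]
    have hρd : κ.degree = ρ.degree + 1 := by rw [hκ, map_add, Finsupp.degree_single]
    have e1 := hk b
    have e2 := hk (b + 1)
    have e3 := hk (b + 2)
    simp only [if_true, if_neg (show b ≠ b + 1 by omega), if_neg (show b + 2 ≠ b + 1 by omega)]
      at e1 e2 e3
    obtain ⟨ω', hω'⟩ := exists_builds hρ
    -- For `b = 0` the label of the edge is 4, so a third box, of content 0, has to be removed
    -- before the relation of length four applies; content 1 is neutral for what is left.
    by_cases hb0 : b = 0
    · subst hb0
      obtain ⟨σ, hσ, hρσ⟩ := exists_eq_add_single hρ (c := 0)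
        (by simp only [zero_add] at *; omega) (Or.inl rfl)
      obtain ⟨τ, hτ⟩ := exists_builds hσ
      have hk' : ∀ k, ρ k = σ k + if k = 0 then 1 else 0 := fun k => by
        rw [hρσ, Finsupp.add_apply, single_one_apply]
      have f1 := hk' 0
      have f2 := hk' 1
      have f3 := hk' 2
      simp only [if_true, one_ne_zero, if_false, OfNat.ofNat_ne_zero] at f1 f2 f3
      have hσd : ρ.degree = σ.degree + 1 := by rw [hρσ, map_add, Finsupp.degree_single]
      obtain ⟨d, hd0, hdn, hd⟩ := ih σ.degree (by omega) hτ (by omega) (c := 1) (by omega)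
        (by omega) (by simp only [Nat.sub_self, zero_add, Nat.reduceAdd] at *; omega) rfl
      refine ⟨d, hd0, hdn, ?_⟩
      rw [wordVal_eq_of_builds hb (((hτ.cons_of_eq hρ hρσ).cons_of_eq hb1 hκ)), wordVal_cons,
        wordVal_cons]
      have hbr := gen_braid_zero (n := n) (by omega)
      simp only [zero_add]
      calc gen n 1 * (gen n 0 * (gen n 1 * (gen n 0 * wordVal n τ)))
          = (gen n 1 * gen n 0 * gen n 1 * gen n 0) * wordVal n τ := by simp only [mul_assoc]
        _ = gen n 0 * gen n 1 * gen n 0 * (gen n 1 * wordVal n τ) := by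
            rw [hbr]; simp only [mul_assoc]
        _ = _ := by rw [hd]; simp only [mul_assoc]
    · have t5 := hρ (b - 1)
      have e4 := hk (b - 1)
      simp only [if_neg (show b - 1 ≠ b + 1 by omega), add_zero] at e4
      have t6 := hs (b - 1)
      simp only [Finsupp.add_apply, single_one_apply, show b - 1 + 1 = b by omega, if_true,
        if_neg (show b - 1 ≠ b by omega)] at t5 t6
      obtain ⟨d, hd0, hdn, hd⟩ := ih ρ.degree (by omega) hω' (by omega) (c := b) hb0
        (by omega) (by omega) rfl
      refine ⟨d, hd0, hdn, ?_⟩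
      rw [wordVal_eq_of_builds hb (hω'.cons_of_eq hb1 hκ), wordVal_cons, ← mul_assoc, ← mul_assoc,
        ← gen_braid (by omega) (by omega), mul_assoc, hd]
      simp only [mul_assoc]

end Relations

end TypeC

end

noncomputable section

namespace TypeC

open Finset

/-! ### An action of the affine Weyl group on height functions -/

/-- The action of a generator: the affine reflection that toggles a box of content `c`. -/
def reflOp (c : ℕ) : Function.End (ℕ → ℤ) := fun f k =>
  if k = c then (if c = 0 then 2 * f 1 + 1 - f 0 else f (c - 1) + f (c + 1) - f c) else f k

theorem reflOp_self (f : ℕ → ℤ) (c : ℕ) :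
    reflOp c f c = if c = 0 then 2 * f 1 + 1 - f 0 else f (c - 1) + f (c + 1) - f c := if_pos rfl

theorem reflOp_of_ne (f : ℕ → ℤ) {c k : ℕ} (hk : k ≠ c) : reflOp c f k = f k := if_neg hk

theorem reflOp_mul_self (c : ℕ) : reflOp c * reflOp c = 1 := by
  funext f k
  change reflOp c (reflOp c f) k = f k
  by_cases hk : k = c
  · subst hk
    cases k with
    | zero =>
      rw [reflOp_self, if_pos rfl, reflOp_self, if_pos rfl, reflOp_of_ne f (by omega)]
      ring
    | succ c =>
      rw [reflOp_self, if_neg (by omega), reflOp_self, if_neg (by omega), reflOp_of_ne f (by omega),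
        reflOp_of_ne f (by omega)]
      ring
  · rw [reflOp_of_ne _ hk, reflOp_of_ne _ hk]

theorem reflOp_comm {c d : ℕ} (hcd : c + 2 ≤ d) : reflOp c * reflOp d = reflOp d * reflOp c := by
  funext f k
  change reflOp c (reflOp d f) k = reflOp d (reflOp c f) k
  obtain ⟨e, rfl⟩ : ∃ e, d = e + 1 := ⟨d - 1, by omega⟩
  simp only [reflOp, Nat.add_sub_cancel]
  by_cases h1 : k = c
  · subst h1
    cases k with
    | zero => simp [show e ≠ 0 by omega]
    | succ k =>
      simp [show k ≠ e + 1 by omega, show k ≠ e by omega, show k + 1 ≠ e by omega]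
  · by_cases h2 : k = e + 1
    · subst h2
      simp [show e ≠ c by omega, show e + 1 + 1 ≠ c by omega, show e + 1 ≠ c by omega]
    · simp [h1, h2]

theorem reflOp_braid {c : ℕ} (hc : c ≠ 0) :
    reflOp c * reflOp (c + 1) * reflOp c = reflOp (c + 1) * reflOp c * reflOp (c + 1) := by
  funext f k
  change reflOp c (reflOp (c + 1) (reflOp c f)) k =
    reflOp (c + 1) (reflOp c (reflOp (c + 1) f)) k
  obtain ⟨e, rfl⟩ := Nat.exists_eq_succ_of_ne_zero hc
  simp only [Nat.succ_eq_add_one, reflOp, Nat.add_sub_cancel]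
  by_cases h1 : k = e + 1
  · subst h1
    simp [show e ≠ e + 1 + 1 by omega, show e + 1 + 1 ≠ e by omega]
    ring
  · by_cases h2 : k = e + 1 + 1
    · subst h2
      simp [show e ≠ e + 1 + 1 by omega, show e + 1 + 1 ≠ e by omega]
      ring
    · simp [h1, h2]

theorem reflOp_braid_zero :
    reflOp 0 * reflOp 1 * reflOp 0 * reflOp 1 = reflOp 1 * reflOp 0 * reflOp 1 * reflOp 0 := by
  funext f k
  change reflOp 0 (reflOp 1 (reflOp 0 (reflOp 1 f))) k =
    reflOp 1 (reflOp 0 (reflOp 1 (reflOp 0 f))) k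
  simp only [reflOp]
  by_cases h1 : k = 0
  · subst h1
    simp
    ring
  · by_cases h2 : k = 1
    · subst h2
      simp
      ring
    · simp [h1, h2]

section Involutions

variable {G : Type*} [Monoid G] {a b : G}

theorem mul_pow_two_of_comm (ha : a * a = 1) (hb : b * b = 1) (h : a * b = b * a) :
    (a * b) ^ 2 = 1 := by
  rw [pow_two, mul_assoc, ← mul_assoc b, ← h, mul_assoc a, hb, mul_one, ha]

theorem mul_pow_three_of_braid (ha : a * a = 1) (hb : b * b = 1) (h : a * b * a = b * a * b) :
    (a * b) ^ 3 = 1 := by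
  calc (a * b) ^ 3 = (a * b * a) * (b * a * b) := by
        simp only [pow_succ, pow_zero, one_mul, mul_assoc]
    _ = b * (a * ((b * b) * (a * b))) := by rw [h]; simp only [mul_assoc]
    _ = b * ((a * a) * b) := by rw [hb, one_mul, mul_assoc]
    _ = 1 := by rw [ha, one_mul, hb]

theorem mul_pow_four_of_braid (ha : a * a = 1) (hb : b * b = 1)
    (h : a * b * a * b = b * a * b * a) : (a * b) ^ 4 = 1 := by
  calc (a * b) ^ 4 = (a * b * a * b) * (a * b * a * b) := by
        simp only [pow_succ, pow_zero, one_mul, mul_assoc]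
    _ = a * b * a * b * (b * a * b * a) := by rw [← h]
    _ = a * (b * (a * ((b * b) * (a * (b * a))))) := by simp only [mul_assoc]
    _ = a * (b * ((a * a) * (b * a))) := by rw [hb, one_mul, mul_assoc]
    _ = a * ((b * b) * a) := by rw [ha, one_mul, mul_assoc]
    _ = 1 := by rw [hb, one_mul, ha]

end Involutions

/-! ### The action of the affine Weyl group on shapes and its consequences for lengths. -/

section Action

variable {n : ℕ}

/-- The images of the generators under the action; the last generator acts trivially. -/
def reflGen (n : ℕ) (i : Fin (n + 1)) : Function.End (ℕ → ℤ) := if i.val = n then 1 else reflOp i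

theorem reflGen_mul_self (i : Fin (n + 1)) : reflGen n i * reflGen n i = 1 := by
  rw [reflGen]
  split_ifs
  · simp
  · exact reflOp_mul_self _

/-- The last generator may act trivially: the label of its edge is even, or imposes no relation if
`n = 1`, and elsewhere it only has to commute. -/
theorem isLiftable_reflGen (n : ℕ) : (affineCMatrix n).IsLiftable (reflGen n) := by
  intro i j
  wlog hij : i ≤ j generalizing i j with H
  · have h1 := H j i (not_le.1 hij).le
    rw [(affineCMatrix n).symmetric] at h1
    have hinv : (reflGen n i * reflGen n j) * (reflGen n j * reflGen n i) = 1 := by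
      rw [mul_assoc, ← mul_assoc (reflGen n j), reflGen_mul_self, one_mul, reflGen_mul_self]
    have hinv' : (reflGen n j * reflGen n i) * (reflGen n i * reflGen n j) = 1 := by
      rw [mul_assoc, ← mul_assoc (reflGen n i), reflGen_mul_self, one_mul, reflGen_mul_self]
    have hc : Commute (reflGen n i * reflGen n j) (reflGen n j * reflGen n i) :=
      hinv.trans hinv'.symm
    have h2 := hc.mul_pow ((affineCMatrix n).M i j)
    rwa [hinv, one_pow, h1, mul_one, eq_comm] at h2
  obtain ⟨i, hi⟩ := i
  obtain ⟨j, hj⟩ := j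
  simp only [Fin.mk_le_mk] at hij
  by_cases h1 : i = j
  · subst h1
    rw [reflGen_mul_self, one_pow]
  have hii := reflGen_mul_self (⟨i, hi⟩ : Fin (n + 1))
  have hjj := reflGen_mul_self (⟨j, hj⟩ : Fin (n + 1))
  by_cases h2 : i + 2 ≤ j
  · have hM : (affineCMatrix n).M ⟨i, hi⟩ ⟨j, hj⟩ = 2 := by
      simp only [affineCMatrix, Matrix.of_apply, Fin.mk.injEq]
      rw [if_neg h1, if_neg (by omega)]
    rw [hM]
    refine mul_pow_two_of_comm hii hjj ?_
    simp only [reflGen]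
    split_ifs
    · rfl
    · simp
    · simp
    · exact reflOp_comm h2
  obtain rfl : j = i + 1 := by omega
  by_cases h3 : n = 1
  · have hM : (affineCMatrix n).M ⟨i, hi⟩ ⟨i + 1, hj⟩ = 0 := by simp [affineCMatrix, h3]
    rw [hM, pow_zero]
  by_cases h4 : i = 0
  · subst h4
    have hM : (affineCMatrix n).M ⟨0, hi⟩ ⟨0 + 1, hj⟩ = 4 := by
      simp [affineCMatrix, h3]
    rw [hM]
    refine mul_pow_four_of_braid hii hjj ?_
    simp only [reflGen]
    rw [if_neg (by omega), if_neg (by omega)]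
    exact reflOp_braid_zero
  by_cases h5 : i + 1 = n
  · have hM : (affineCMatrix n).M ⟨i, hi⟩ ⟨i + 1, hj⟩ = 4 := by
      simp [affineCMatrix, h3, h5, show i ≠ n by omega]
    rw [hM]
    have : reflGen n ⟨i + 1, hj⟩ = 1 := if_pos h5
    rw [this, mul_one, show 4 = 2 + 2 from rfl, pow_add, pow_two, hii, one_mul]
  have hM : (affineCMatrix n).M ⟨i, hi⟩ ⟨i + 1, hj⟩ = 3 := by
    simp [affineCMatrix, h3, h4, h5, show i ≠ n by omega]
  rw [hM]
  refine mul_pow_three_of_braid hii hjj ?_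
  simp only [reflGen]
  rw [if_neg (by omega), if_neg (by omega)]
  exact reflOp_braid h4

/-- The action of the affine Weyl group on functions, which factors through a finite Weyl
group. -/
def reflHom (n : ℕ) : AffineC n →* Function.End (ℕ → ℤ) :=
  (coxC n).lift ⟨reflGen n, isLiftable_reflGen n⟩

theorem reflHom_simple (i : Fin (n + 1)) : reflHom n ((coxC n).simple i) = reflGen n i :=
  (coxC n).lift_apply_simple (isLiftable_reflGen n) i

theorem reflHom_gen {c : ℕ} (hc : c < n) : reflHom n (gen n c) = reflOp c := by
  rw [gen, dif_pos (show c < n + 1 by omega), reflHom_simple, reflGen, if_neg (by simp only; omega)]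

/-- A height function as a function with integer values. -/
def toFun (h : ℕ →₀ ℕ) : ℕ → ℤ := fun k => h k

theorem toFun_injective : Function.Injective toFun := fun h h' hh => by
  ext k
  have := congrFun hh k
  simp only [toFun] at this
  exact_mod_cast this

theorem reflOp_toFun_add_single {h : ℕ →₀ ℕ} {c : ℕ} (hh : IsShape h)
    (hs : IsShape (h + Finsupp.single c 1)) :
    reflOp c (toFun h) = toFun (h + Finsupp.single c 1) := by
  funext k
  simp only [reflOp, toFun, Finsupp.add_apply, single_one_apply]
  split_ifs with h1 h2
  · subst h1 h2
    have t1 := hh 0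
    have t2 := hs 0
    simp only [Finsupp.add_apply, single_one_apply, zero_add, if_true, one_ne_zero, if_false]
      at t1 t2
    push_cast
    omega
  · subst h1
    obtain ⟨c, rfl⟩ := Nat.exists_eq_succ_of_ne_zero h2
    have t1 := hh c
    have t2 := hs c
    have t3 := hh (c + 1)
    have t4 := hs (c + 1)
    simp only [Finsupp.add_apply, single_one_apply, Nat.succ_eq_add_one, if_true,
      if_neg (show c ≠ c + 1 by omega), if_neg (show c + 1 + 1 ≠ c + 1 by omega)] at t1 t2 t3 t4
    simp only [Nat.succ_eq_add_one, Nat.add_sub_cancel]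
    push_cast
    omega
  · simp

theorem reflOp_reflOp (c : ℕ) (f : ℕ → ℤ) : reflOp c (reflOp c f) = f :=
  congrFun (reflOp_mul_self c) f

theorem reflOp_neutral {f : ℕ → ℤ} {c : ℕ} (hc : c ≠ 0) (hf : f (c - 1) + f (c + 1) = 2 * f c) :
    reflOp c f = f := by
  funext k
  simp only [reflOp]
  split_ifs with h1
  · subst h1; linarith
  · rfl

/-- A generator maps shapes to shapes and increases the size by at most one. -/
theorem exists_reflGen_toFun {h : ℕ →₀ ℕ} (hh : IsShape h) (i : Fin (n + 1)) :
    ∃ h', IsShape h' ∧ h'.degree ≤ h.degree + 1 ∧ reflGen n i (toFun h) = toFun h' := by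
  rw [reflGen]
  split_ifs
  · exact ⟨h, hh, Nat.le_succ _, rfl⟩
  rcases hh.trichotomy i with h1 | ⟨κ, h1, rfl⟩ | ⟨h1, h2⟩
  · exact ⟨_, h1, by rw [map_add, Finsupp.degree_single], reflOp_toFun_add_single hh h1⟩
  · refine ⟨κ, h1, by rw [map_add]; omega, ?_⟩
    rw [← reflOp_toFun_add_single h1 hh, reflOp_reflOp]
  · exact ⟨h, hh, Nat.le_succ _, reflOp_neutral h1 (by simp only [toFun]; exact_mod_cast h2)⟩

theorem exists_reflHom_wordProd (ω : List (Fin (n + 1))) :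
    ∃ h, IsShape h ∧ h.degree ≤ ω.length ∧ reflHom n ((coxC n).wordProd ω) (toFun 0) = toFun h := by
  induction ω with
  | nil => exact ⟨0, isShape_zero, by simp, by rw [CoxeterSystem.wordProd_nil, map_one]; rfl⟩
  | cons i ω ih =>
    obtain ⟨h, h1, h2, h3⟩ := ih
    obtain ⟨h', h4, h5, h6⟩ := exists_reflGen_toFun h1 i
    refine ⟨h', h4, by rw [List.length_cons]; omega, ?_⟩
    rw [CoxeterSystem.wordProd_cons, map_mul, reflHom_simple]
    change reflGen n i (reflHom n ((coxC n).wordProd ω) (toFun 0)) = _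
    rw [h3, h6]

/-- Each generator adds at most one box, so the size of the shape reached from the empty one is a
lower bound for the length. -/
theorem exists_reflHom (w : AffineC n) :
    ∃ h, IsShape h ∧ h.degree ≤ len w ∧ reflHom n w (toFun 0) = toFun h := by
  obtain ⟨ω, h1, h2⟩ := (coxC n).exists_isReduced w
  obtain ⟨h, h3, h4, h5⟩ := exists_reflHom_wordProd ω
  refine ⟨h, h3, ?_, by rw [h2]; exact h5⟩
  rw [len, h2, h1.eq]
  exact h4

/-- The empty shape is neutral at every nonzero content. The shape reached from it therefore depends
only on the coset, and its size bounds the length of every element of the coset from below. -/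
theorem reflHom_of_mem_finiteWeyl {u : AffineC n} (hu : u ∈ finiteWeyl n) :
    reflHom n u (toFun 0) = toFun 0 := by
  induction hu using Subgroup.closure_induction with
  | mem x hx =>
    obtain ⟨i, hi, rfl⟩ := hx
    rw [reflHom_simple, reflGen]
    split_ifs
    · rfl
    · exact reflOp_neutral (fun h => hi (Fin.ext h)) (by simp [toFun])
  | one => rw [map_one]; rfl
  | mul x y _ _ hx hy =>
    rw [map_mul]
    change reflHom n x (reflHom n y (toFun 0)) = _
    rw [hy, hx]
  | inv x _ hx =>
    have h1 : reflHom n x⁻¹ (reflHom n x (toFun 0)) = toFun 0 := by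
      change (reflHom n x⁻¹ * reflHom n x) (toFun 0) = _
      rw [← map_mul, inv_mul_cancel, map_one]
      rfl
    rwa [hx] at h1

theorem Builds.reflHom_wordVal {ω : List ℕ} {μ h : ℕ →₀ ℕ} (hb : Builds ω μ h)
    (hn : ∀ c ∈ ω, c < n) : reflHom n (wordVal n ω) (toFun μ) = toFun h := by
  induction hb with
  | nil => rw [wordVal_nil, map_one]; rfl
  | @cons c ω μ κ hb hs ih =>
    rw [wordVal_cons, map_mul, reflHom_gen (hn c (by simp))]
    change reflOp c (reflHom n (wordVal n ω) (toFun μ)) = _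
    rw [ih fun c hc => hn c (by simp [hc]), reflOp_toFun_add_single hb.isShape_right hs]

theorem len_wordVal_le {ω : List ℕ} (hn : ∀ c ∈ ω, c ≤ n) : len (wordVal n ω) ≤ ω.length := by
  obtain ⟨ω', rfl⟩ : ∃ ω' : List (Fin (n + 1)), ω = ω'.map Fin.val := by
    refine ⟨ω.pmap (fun c hc => ⟨c, hc⟩) fun c hc => Nat.lt_succ_of_le (hn c hc), ?_⟩
    rw [List.map_pmap]
    simp
  rw [← wordProd_eq, List.length_map]
  exact (coxC n).length_wordProd_le ω'

theorem len_mul_le (v w : AffineC n) : len (v * w) ≤ len v + len w := (coxC n).length_mul_le v w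

theorem gen_mem_finiteWeyl {c : ℕ} (hc : c ≠ 0) (hcn : c ≤ n) : gen n c ∈ finiteWeyl n := by
  refine Subgroup.subset_closure ⟨⟨c, by omega⟩, fun h => hc (by simpa using congrArg Fin.val h), ?_⟩
  rw [gen, dif_pos]

/-- The element of a shape has the size of the shape as its length, and it is minimal. -/
theorem Builds.len_eq {ω : List ℕ} {h : ℕ →₀ ℕ} (hb : Builds ω 0 h) (hn : h.degree ≤ n) :
    len (wordVal n ω) = h.degree ∧ IsMinimalRep (wordVal n ω) := by
  have hlt : ∀ c ∈ ω, c < n := fun c hc => (hb.lt_degree hc).trans_le hn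
  have h1 : len (wordVal n ω) ≤ h.degree := by
    rw [hb.degree_eq, map_zero, zero_add]
    exact len_wordVal_le fun c hc => (hlt c hc).le
  have h2 : ∀ u ∈ finiteWeyl n, h.degree ≤ len (wordVal n ω * u) := by
    intro u hu
    obtain ⟨h', h3, h4, h5⟩ := exists_reflHom (wordVal n ω * u)
    rw [map_mul] at h5
    change reflHom n (wordVal n ω) (reflHom n u (toFun 0)) = _ at h5
    rw [reflHom_of_mem_finiteWeyl hu, hb.reflHom_wordVal hlt] at h5
    rwa [toFun_injective h5]
  refine ⟨le_antisymm h1 ?_, fun u hu => h1.trans (h2 u hu)⟩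
  simpa using h2 1 (one_mem _)

/-- If `w * u` were shorter than `w`, then `v * w * u` would be shorter than `v * w` by
subadditivity. -/
theorem isMinimalRep_of_mul {v w : AffineC n} (hm : IsMinimalRep (v * w))
    (hl : len (v * w) = len v + len w) : IsMinimalRep w := fun u hu => by
  have h1 := hm u hu
  rw [mul_assoc] at h1
  have h2 := len_mul_le v (w * u)
  omega

/-- Every reduced word of a minimal representative of length less than `n` builds a shape. -/
theorem exists_builds_of_isMinimalRep {ω : List (Fin (n + 1))} (hr : (coxC n).IsReduced ω)
    (hm : IsMinimalRep ((coxC n).wordProd ω)) (hn : ω.length < n) :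
    ∃ h, Builds (ω.map Fin.val) 0 h := by
  induction ω with
  | nil => exact ⟨0, Builds.nil isShape_zero⟩
  | cons i ω ih =>
    have hr' : (coxC n).IsReduced ω := by simpa using hr.drop 1
    have hl1 : len ((coxC n).wordProd (i :: ω)) = ω.length + 1 := by
      rw [len, hr.eq, List.length_cons]
    have hl2 : len ((coxC n).wordProd ω) = ω.length := hr'.eq
    rw [List.length_cons] at hn
    have hcons : (coxC n).wordProd (i :: ω) = gen n i * (coxC n).wordProd ω := by
      rw [CoxeterSystem.wordProd_cons, gen_val]
    have hm' : IsMinimalRep ((coxC n).wordProd ω) := by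
      rw [hcons] at hm hl1
      refine isMinimalRep_of_mul hm ?_
      rw [hl1, hl2, gen_val]
      have : len ((coxC n).simple i) = 1 := (coxC n).length_simple i
      omega
    obtain ⟨h, hb⟩ := ih hr' hm' (by omega)
    have hdeg := hb.degree_eq
    rw [map_zero, zero_add, List.length_map] at hdeg
    rcases hb.isShape_right.trichotomy i with h1 | ⟨κ, h1, h2⟩ | ⟨h1, h2⟩
    · exact ⟨_, hb.cons h1⟩
    -- If the box is removable, the letter cancels and the length drops, against reducedness.
    · exfalso
      obtain ⟨ω', hω'⟩ := exists_builds h1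
      have h3 := wordVal_eq_of_builds (n := n) hb (hω'.cons_of_eq hb.isShape_right h2)
      rw [hcons, wordProd_eq, h3, wordVal_cons, gen_mul_self_mul] at hl1
      have h4 : h.degree = κ.degree + 1 := by rw [h2, map_add, Finsupp.degree_single]
      have h5 := (hω'.len_eq (n := n) (by omega)).1
      omega
    -- If the content is neutral, the generator moves to the right end as a generator of the finite
    -- group, against minimality.
    · exfalso
      obtain ⟨d, hd0, hdn, hd⟩ := exists_gen_mul_wordVal (n := n) hb (by omega) h1
        (Nat.lt_succ_iff.1 i.2) h2
      have h3 := hm _ (gen_mem_finiteWeyl hd0 hdn)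
      rw [hl1, hcons, wordProd_eq, hd, mul_assoc, gen_mul_self, mul_one, ← wordProd_eq, hl2] at h3
      omega

end Action

end TypeC

end

noncomputable section

namespace TypeC

open Finset

/-! ### Strips and subwords of the cyclic word -/

/-- The word `K ⋯ 1 0 1 ⋯ K`. -/
def vWord (K : ℕ) : List ℕ := (List.range' 1 K).reverse ++ List.range (K + 1)

theorem vWord_succ (K : ℕ) : vWord (K + 1) = (K + 1) :: (vWord K ++ [K + 1]) := by
  rw [vWord, List.range'_concat, List.range_succ (n := K + 1), vWord]
  simp [add_comm]

/-- The box of largest content is either addable to `κ` at once, or removable from `h`. It is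
accordingly added first, by the rightmost letter of `vWord`, or last, by the leftmost one; the other
boxes are handled by induction. -/
theorem Strip.exists_builds {κ h : ℕ →₀ ℕ} (hκ : IsShape κ) (hh : IsShape h) (hs : Strip κ h)
    {K : ℕ} (hK : ∀ k, K < k → κ k = h k) : ∃ ω, Builds ω κ h ∧ ω.Sublist (vWord K) := by
  induction K generalizing κ h with
  | zero =>
    have h0 := hs 0
    by_cases h1 : κ 0 = h 0
    · have : κ = h := by
        ext k
        rcases Nat.eq_zero_or_pos k with rfl | hk
        exacts [h1, hK k hk]
      subst this
      exact ⟨[], Builds.nil hκ, List.nil_sublist _⟩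
    · refine ⟨[0], (Builds.nil hκ).cons_of_eq hh ?_, by simp [vWord]⟩
      ext k
      rw [Finsupp.add_apply, single_one_apply]
      rcases Nat.eq_zero_or_pos k with rfl | hk
      · simp only [if_true]; omega
      · rw [if_neg (by omega), hK k hk, add_zero]
  | succ K ih =>
    rw [vWord_succ]
    have hsK := hs (K + 1)
    have hsK' := hs K
    have hK2 := hK (K + 1 + 1) (by omega)
    have a1 := hκ (K + 1)
    have a2 := hh (K + 1)
    have a3 := hκ K
    have a4 := hh K
    by_cases h1 : κ (K + 1) = h (K + 1)
    · obtain ⟨ω, hb, hω⟩ := ih hκ hh hs fun k hk => by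
        rcases (show k = K + 1 ∨ K + 1 < k by omega) with rfl | hk'
        exacts [h1, hK k hk']
      exact ⟨ω, hb, (hω.trans (List.sublist_append_left _ _)).cons _⟩
    by_cases h2 : κ (K + 1) < κ K
    · have hκ' := isShape_add_single hκ (c := K + 1) (by omega) (Or.inr (by simpa using h2))
      obtain ⟨ω, hb, hω⟩ := ih hκ' hh (fun k => by
          have := hs k
          rw [Finsupp.add_apply, single_one_apply]
          split_ifs with hk
          · subst hk; omega
          · omega) fun k hk => by
        rw [Finsupp.add_apply, single_one_apply]
        split_ifs with hk'
        · subst hk'; omega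
        · exact hK k (by omega)
      exact ⟨ω ++ [K + 1], hb.append ((Builds.nil hκ).cons hκ'),
        (hω.append (List.Sublist.refl _)).cons _⟩
    · obtain ⟨μ, hμ, hμh⟩ := exists_eq_add_single hh (c := K + 1) (by omega)
        (Or.inr (by simp only [Nat.add_sub_cancel]; omega))
      have hk : ∀ k, h k = μ k + if k = K + 1 then 1 else 0 := fun k => by
        rw [hμh, Finsupp.add_apply, single_one_apply]
      obtain ⟨ω, hb, hω⟩ := ih hκ hμ (fun k => by
          have h3 := hs k
          have h4 := hk k
          split_ifs at h4 with hk
          · subst hk; omega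
          · omega) fun k hk1 => by
        have h4 := hk k
        split_ifs at h4 with hk
        · subst hk; omega
        · rw [hK k (by omega)]; omega
      exact ⟨(K + 1) :: ω, hb.cons_of_eq hh hμh,
        (hω.trans (List.sublist_append_left _ _)).cons_cons _⟩

theorem cyclicWord_map_val {n : ℕ} (hn : 0 < n) : (cyclicWord n).map Fin.val =
    (List.range (2 * n)).map fun j => if j ≤ n then j else 2 * n - j := by
  refine List.ext_getElem (by simp [cyclicWord]; omega) fun i h1 h2 => ?_
  simp only [List.length_map, List.length_range] at h2
  simp only [cyclicWord, List.map_append, List.map_reverse, List.getElem_append, List.getElem_map,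
    List.getElem_range, List.length_map, List.length_finRange, List.getElem_reverse,
    List.getElem_dropLast, List.getElem_tail, List.getElem_finRange, List.length_dropLast,
    List.length_tail, Fin.val_cast]
  split_ifs <;> omega

theorem rotate_cyclicWord {n : ℕ} (hn : 0 < n) :
    ((cyclicWord n).rotate n).map Fin.val = n :: vWord (n - 1) := by
  rw [List.map_rotate, cyclicWord_map_val hn]
  refine List.ext_getElem (by simp [vWord]; omega) fun i h1 h2 => ?_
  simp only [List.length_rotate, List.length_map, List.length_range] at h1
  simp only [List.getElem_rotate, List.length_map, List.length_range, List.getElem_map,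
    List.getElem_range, vWord]
  rw [List.getElem_cons]
  simp only [List.getElem_append, List.length_reverse, List.length_range', List.getElem_reverse,
    List.getElem_range', List.getElem_range]
  rcases lt_or_ge (i + n) (2 * n) with h | h
  · rw [Nat.mod_eq_of_lt h]
    split_ifs <;> omega
  · rw [Nat.mod_eq_sub_mod h, Nat.mod_eq_of_lt (by omega)]
    split_ifs <;> omega

theorem getElem_rotate_cyclicWord {n : ℕ} (hn : 0 < n) (k : ℕ) :
    ∃ r < 2 * n, ∀ i (hi : i < (((cyclicWord n).rotate k).map Fin.val).length), i < 2 * n ∧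
      ∃ j < 2 * n, (j = i + r ∨ j + 2 * n = i + r) ∧
        (((cyclicWord n).rotate k).map Fin.val)[i] = if j ≤ n then j else 2 * n - j := by
  have hk : k % (2 * n) < 2 * n := Nat.mod_lt _ (by omega)
  refine ⟨k % (2 * n), hk, fun i hi => ?_⟩
  have hl : ((cyclicWord n).map Fin.val).length = 2 * n := by rw [cyclicWord_map_val hn]; simp
  simp only [List.length_map, List.length_rotate] at hi hl
  have hi' : i < 2 * n := by omega
  refine ⟨hi', (i + k) % (2 * n), Nat.mod_lt _ (by omega), ?_, ?_⟩
  · rw [Nat.add_mod, Nat.mod_eq_of_lt hi']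
    rcases lt_or_ge (i + k % (2 * n)) (2 * n) with h | h
    · exact Or.inl (Nat.mod_eq_of_lt h)
    · right
      rw [Nat.mod_eq_sub_mod h, Nat.mod_eq_of_lt (by omega)]
      omega
  · simp only [List.map_rotate, cyclicWord_map_val hn, List.getElem_rotate, List.length_map,
      List.length_range, List.getElem_map, List.getElem_range]

theorem exists_of_triple_sublist {a x b : ℕ} {l : List ℕ} (h : [a, x, b].Sublist l) :
    ∃ (i j k : ℕ) (hi : i < l.length) (hj : j < l.length) (hk : k < l.length),
      i < j ∧ j < k ∧ l[i] = a ∧ l[j] = x ∧ l[k] = b := by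
  obtain ⟨f, hf⟩ := List.sublist_iff_exists_fin_orderEmbedding_get_eq.1 h
  refine ⟨f 0, f 1, f 2, (f 0).2, (f 1).2, (f 2).2, ?_, ?_, (hf 0).symm, (hf 1).symm, (hf 2).symm⟩
  · exact f.strictMono (show (0 : Fin 3) < 1 by decide)
  · exact f.strictMono (show (1 : Fin 3) < 2 by decide)

/-- Place the letters on a cycle of length 2n, where `c` sits at `c` and at 2n - c. The arc from the
first place to the second carries the letters larger than `c`, the arc back carries the smaller
ones. A rotation reads the cycle once, so the order of the two places decides which arc is
traversed. -/
theorem positions_of_triple {n r c x i₁ i₂ i₃ j₁ j₂ j₃ : ℕ} (h₁₂ : i₁ < i₂) (h₂₃ : i₂ < i₃)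
    (l₁ : j₁ < 2 * n) (l₃ : j₃ < 2 * n) (m₁ : j₁ = i₁ + r ∨ j₁ + 2 * n = i₁ + r)
    (m₂ : j₂ = i₂ + r ∨ j₂ + 2 * n = i₂ + r) (m₃ : j₃ = i₃ + r ∨ j₃ + 2 * n = i₃ + r)
    (v₁ : j₁ = c ∨ j₁ + c = 2 * n) (v₂ : j₂ = x ∨ j₂ + x = 2 * n)
    (v₃ : j₃ = c ∨ j₃ + c = 2 * n) (hi : i₃ < 2 * n) (hc : c ≤ n) (hx : x ≤ n) :
    (c < x → j₁ = c ∧ j₃ + c = 2 * n ∧ c ≠ 0) ∧ (x < c → j₁ + c = 2 * n ∧ j₃ = c) := by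
  rcases m₁ with m₁ | m₁ <;> rcases m₂ with m₂ | m₂ <;> rcases m₃ with m₃ | m₃ <;>
    rcases v₁ with v₁ | v₁ <;> rcases v₃ with v₃ | v₃ <;> omega

/-- Between two equal letters of a rotation of the cyclic word all letters are larger, or all are
smaller. -/
theorem not_triple_sublist {n k c x y : ℕ} (hn : 0 < n)
    (hx : [c, x, c].Sublist (((cyclicWord n).rotate k).map Fin.val))
    (hy : c = 0 ∨ [c, y, c].Sublist (((cyclicWord n).rotate k).map Fin.val)) (hcx : c < x)
    (hyc : c = 0 ∨ y < c) : False := by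
  obtain ⟨r, hr, hget⟩ := getElem_rotate_cyclicWord hn k
  have key : ∀ z, [c, z, c].Sublist (((cyclicWord n).rotate k).map Fin.val) →
      ∃ i₁ i₃ j₁ j₃, i₁ < i₃ ∧ i₃ < 2 * n ∧ (j₁ = i₁ + r ∨ j₁ + 2 * n = i₁ + r) ∧
        (j₃ = i₃ + r ∨ j₃ + 2 * n = i₃ + r) ∧
        (c < z → j₁ = c ∧ j₃ + c = 2 * n ∧ c ≠ 0) ∧ (z < c → j₁ + c = 2 * n ∧ j₃ = c) := by
    intro z hz
    obtain ⟨i₁, i₂, i₃, h₁, h₂, h₃, h₁₂, h₂₃, e₁, e₂, e₃⟩ := exists_of_triple_sublist hz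
    obtain ⟨-, j₁, l₁, m₁, v₁⟩ := hget i₁ h₁
    obtain ⟨-, j₂, l₂, m₂, v₂⟩ := hget i₂ h₂
    obtain ⟨b₃, j₃, l₃, m₃, v₃⟩ := hget i₃ h₃
    rw [e₁] at v₁
    rw [e₂] at v₂
    rw [e₃] at v₃
    refine ⟨i₁, i₃, j₁, j₃, h₁₂.trans h₂₃, b₃, m₁, m₃, positions_of_triple h₁₂ h₂₃ l₁ l₃ m₁ m₂ m₃
      ?_ ?_ ?_ b₃ ?_ ?_⟩
    · clear v₂ v₃; split_ifs at v₁ <;> omega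
    · clear v₁ v₃; split_ifs at v₂ <;> omega
    · clear v₁ v₂; split_ifs at v₃ <;> omega
    · clear v₂ v₃; split_ifs at v₁ <;> omega
    · clear v₁ v₃; split_ifs at v₂ <;> omega
  obtain ⟨i₁, i₃, j₁, j₃, h₁₃, h₃, m₁, m₃, h, -⟩ := key x hx
  obtain ⟨e₁, e₃, hc⟩ := h hcx
  obtain ⟨i₄, i₆, j₄, j₆, h₄₆, h₆, m₄, m₆, -, h'⟩ := key y (hy.resolve_left hc)
  obtain ⟨e₄, e₆⟩ := h' (hyc.resolve_left hc)
  omega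

/-- Between two boxes of the same content, boxes of the neighbouring contents are added. -/
theorem Builds.mem_between {c : ℕ} {ω ω' τ : List ℕ} {κ h : ℕ →₀ ℕ}
    (hb : Builds (τ ++ c :: (ω ++ c :: ω')) κ h) : c + 1 ∈ ω ∧ (c = 0 ∨ c - 1 ∈ ω) := by
  obtain ⟨σ, -, hσ⟩ := hb.exists_of_append
  rcases hσ with _ | @⟨_, _, _, ρ, hρ, hρc⟩
  obtain ⟨τ, h1, h2⟩ := hρ.exists_of_append
  rcases h2 with _ | @⟨_, _, _, μ, hμ, hμc⟩
  have s0 := hμ.isShape_right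
  have s1 := h1.isShape_right
  have e : ∀ k, ρ k = μ k + (if k = c then 1 else 0) + ω.count k := fun k => by
    rw [h1.apply_eq, Finsupp.add_apply, single_one_apply]
  have f : ∀ k, (ρ + Finsupp.single c 1 : ℕ →₀ ℕ) k = ρ k + if k = c then 1 else 0 := fun k => by
    rw [Finsupp.add_apply, single_one_apply]
  constructor
  · rw [← List.count_pos_iff]
    have t1 := e c
    have t2 := e (c + 1)
    have t3 := hρc c
    have t4 := s0 c
    rw [f, f] at t3
    simp only [if_true, if_neg (show c + 1 ≠ c by omega)] at t1 t2 t3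
    omega
  · by_cases hc : c = 0
    · exact Or.inl hc
    right
    obtain ⟨d, rfl⟩ := Nat.exists_eq_succ_of_ne_zero hc
    rw [← List.count_pos_iff, Nat.succ_eq_add_one, Nat.add_sub_cancel]
    have t1 := e d
    have t2 := e (d + 1)
    have t3 := hρc d
    have t4 := s0 d
    rw [f, f] at t3
    simp only [Nat.succ_eq_add_one, if_true, if_neg (show d ≠ d + 1 by omega)] at t1 t2 t3
    omega

/-- Two boxes of content `c` would force letters `c + 1` and, unless `c = 0`, `c - 1` between two
letters `c`. A rotation cannot contain both patterns, and it contains 0 only once. -/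
theorem Builds.strip {n k : ℕ} (hn : 0 < n) {ω : List ℕ} {κ h : ℕ →₀ ℕ} (hb : Builds ω κ h)
    (hω : ω.Sublist (((cyclicWord n).rotate k).map Fin.val)) :
    Strip κ h := fun c => by
  rw [hb.apply_eq]
  refine ⟨Nat.le_add_right _ _, Nat.add_le_add_left ?_ _⟩
  by_contra hc
  obtain ⟨ω₁, ω₂, rfl, h1⟩ := List.eq_append_cons_of_mem (List.count_pos_iff.1 (by omega : 0 < ω.count c))
  rw [List.count_append, List.count_eq_zero_of_not_mem h1, List.count_cons_self] at hc
  obtain ⟨ω₃, ω₄, rfl, -⟩ := List.eq_append_cons_of_mem (List.count_pos_iff.1 (by omega : 0 < ω₂.count c))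
  obtain ⟨h2, h3⟩ := hb.mem_between
  have key : ∀ x ∈ ω₃, [c, x, c].Sublist (((cyclicWord n).rotate k).map Fin.val) := fun x hx => by
    refine List.Sublist.trans ?_ hω
    refine List.Sublist.trans ?_ (List.sublist_append_right _ _)
    refine List.Sublist.cons_cons _ ?_
    exact (List.singleton_sublist.2 hx).append (l₁ := [x]) (List.Sublist.cons_cons c (List.nil_sublist _))
  refine not_triple_sublist hn (key _ h2) (h3.imp_right (key _)) (Nat.lt_succ_self c) ?_
  omega

end TypeC

end

noncomputable section

namespace TypeC

open Finset

/-! ### Connected components of subsets of a path -/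

/-- The smallest element of the interval of `U` that ends in `k`. -/
def intervalStart (U : Finset ℕ) : ℕ → ℕ
  | 0 => 0
  | k + 1 => if k ∈ U then intervalStart U k else k + 1

theorem intervalStart_mem {U : Finset ℕ} {k : ℕ} (hk : k ∈ U) :
    intervalStart U k ∈ starts true U := by
  induction k with
  | zero => simp [intervalStart, starts, hk]
  | succ k ih =>
    rw [intervalStart]
    split_ifs with h1
    · exact ih h1
    · simp [starts, hk, h1]

theorem intervalStart_of_mem {U : Finset ℕ} {k : ℕ} (hk : k ∈ starts true U) :
    intervalStart U k = k := by
  cases k with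
  | zero => rfl
  | succ k =>
    simp only [starts, mem_filter, Nat.add_sub_cancel, if_neg (Nat.succ_ne_zero k)] at hk
    rw [intervalStart, if_neg hk.2]

theorem mem_of_mem_starts {U : Finset ℕ} {k : ℕ} (hk : k ∈ starts true U) : k ∈ U :=
  (mem_filter.1 hk).1

/-- Components of a subset of a path are maximal intervals, and each is represented by its smallest
element. -/
theorem card_connectedComponent_pathGraph {n : ℕ} {S : Set (Fin (n + 1))} {U : Finset ℕ}
    (hU : ∀ k ∈ U, k < n + 1) (hS : ∀ i, i ∈ S ↔ i.val ∈ U) :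
    Nat.card ((SimpleGraph.pathGraph (n + 1)).induce S).ConnectedComponent =
      (starts true U).card := by
  set G := (SimpleGraph.pathGraph (n + 1)).induce S with hG
  have hadj : ∀ v w : S, G.Adj v w → intervalStart U v.1 = intervalStart U w.1 := by
    intro v w hvw
    rw [hG, SimpleGraph.induce_adj, SimpleGraph.pathGraph_adj] at hvw
    have hv := (hS v).1 v.2
    have hw := (hS w).1 w.2
    rcases hvw with h | h
    · rw [← h, intervalStart, if_pos hv]
    · rw [← h, intervalStart, if_pos hw]
  have hwalk : ∀ (v w : S) (_ : G.Walk v w), intervalStart U v.1 = intervalStart U w.1 := by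
    intro v w p
    induction p with
    | nil => rfl
    | cons h _ ih => exact (hadj _ _ h).trans ih
  have hreach : ∀ (k : ℕ) (hk : k ∈ U), G.Reachable
      ⟨⟨intervalStart U k, hU _ (mem_of_mem_starts (intervalStart_mem hk))⟩,
        (hS _).2 (mem_of_mem_starts (intervalStart_mem hk))⟩ ⟨⟨k, hU k hk⟩, (hS _).2 hk⟩ := by
    intro k hk
    induction k with
    | zero => rfl
    | succ k ih =>
      by_cases h1 : k ∈ U
      · have h2 : intervalStart U (k + 1) = intervalStart U k := if_pos h1
        simp only [h2]
        refine (ih h1).trans (SimpleGraph.Adj.reachable ?_)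
        rw [hG, SimpleGraph.induce_adj, SimpleGraph.pathGraph_adj]
        exact Or.inl rfl
      · have h2 : intervalStart U (k + 1) = k + 1 := if_neg h1
        simp only [h2]
        rfl
  rw [← Nat.card_eq_finsetCard]
  refine Nat.card_congr ?_
  refine
    { toFun := SimpleGraph.ConnectedComponent.lift
        (fun v : S => (⟨intervalStart U v.1, intervalStart_mem ((hS v).1 v.2)⟩ : starts true U))
        fun v w p _ => Subtype.ext (hwalk v w p)
      invFun := fun k => G.connectedComponentMk
        ⟨⟨k, hU k (mem_of_mem_starts k.2)⟩, (hS _).2 (mem_of_mem_starts k.2)⟩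
      left_inv := ?_
      right_inv := ?_ }
  · intro C
    induction C using SimpleGraph.ConnectedComponent.ind with
    | _ v =>
    exact SimpleGraph.ConnectedComponent.sound (hreach v.1 ((hS v).1 v.2))
  · intro k
    exact Subtype.ext (intervalStart_of_mem k.2)

/-! ### Elements of shapes -/

section Elements

variable {n : ℕ}

open Classical in
/-- The element of the affine Weyl group that belongs to a shape. -/
def shapeElt (n : ℕ) (h : ℕ →₀ ℕ) : AffineC n :=
  if hh : IsShape h then wordVal n (exists_builds hh).choose else 1

theorem Builds.wordVal_eq {ω : List ℕ} {h : ℕ →₀ ℕ} (hb : Builds ω 0 h) :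
    wordVal n ω = shapeElt n h := by
  rw [shapeElt, dif_pos hb.isShape_right]
  exact wordVal_eq_of_builds hb (exists_builds hb.isShape_right).choose_spec

theorem shapeElt_zero : shapeElt n 0 = 1 := (Builds.nil isShape_zero).wordVal_eq.symm

theorem Builds.wordVal_mul {ω : List ℕ} {κ h : ℕ →₀ ℕ} (hb : Builds ω κ h) :
    wordVal n ω * shapeElt n κ = shapeElt n h := by
  obtain ⟨ω', hω'⟩ := TypeC.exists_builds hb.isShape_left
  rw [← hω'.wordVal_eq, ← wordVal_append, (hb.append hω').wordVal_eq]

theorem IsShape.len_shapeElt {h : ℕ →₀ ℕ} (hh : IsShape h) (hn : h.degree ≤ n) :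
    len (shapeElt n h) = h.degree := by
  obtain ⟨ω, hω⟩ := exists_builds hh
  rw [← hω.wordVal_eq]
  exact (hω.len_eq hn).1

theorem IsShape.isMinimalRep_shapeElt {h : ℕ →₀ ℕ} (hh : IsShape h) (hn : h.degree ≤ n) :
    IsMinimalRep (shapeElt n h) := by
  obtain ⟨ω, hω⟩ := exists_builds hh
  rw [← hω.wordVal_eq]
  exact (hω.len_eq hn).2

/-- The shape is recovered by letting its element act on the empty shape. -/
theorem shapeElt_injOn {h h' : ℕ →₀ ℕ} (hh : IsShape h) (hh' : IsShape h') (hn : h.degree ≤ n)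
    (hm : h'.degree ≤ n) (he : shapeElt n h = shapeElt n h') : h = h' := by
  obtain ⟨ω, hω⟩ := exists_builds hh
  obtain ⟨ω', hω'⟩ := exists_builds hh'
  rw [← hω.wordVal_eq, ← hω'.wordVal_eq] at he
  apply toFun_injective
  rw [← hω.reflHom_wordVal fun c hc => (hω.lt_degree hc).trans_le hn, he,
    hω'.reflHom_wordVal fun c hc => (hω'.lt_degree hc).trans_le hm]

/-- The minimal representatives of length less than `n` are the elements of shapes. -/
theorem IsMinimalRep.exists_shape {w : AffineC n} (hw : IsMinimalRep w) (hn : len w < n) :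
    ∃ h, IsShape h ∧ h.degree = len w ∧ shapeElt n h = w := by
  obtain ⟨ω, h1, rfl⟩ := (coxC n).exists_isReduced w
  have hl : len ((coxC n).wordProd ω) = ω.length := h1.eq
  obtain ⟨h, hb⟩ := exists_builds_of_isMinimalRep h1 hw (by omega)
  refine ⟨h, hb.isShape_right, ?_, ?_⟩
  · rw [hb.degree_eq, hl, map_zero, zero_add, List.length_map]
  · rw [← hb.wordVal_eq, wordProd_eq]

/-- In a length-additive factorization of the element of a shape, each reduced word of the left
factor adds boxes to the shape of the right factor. -/
theorem IsReducedWordOf.builds {ω : List (Fin (n + 1))} {v : AffineC n} {κ h : ℕ →₀ ℕ}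
    (hω : IsReducedWordOf ω v) (hκ : IsShape κ) (hh : IsShape h) (hn : h.degree < n)
    (hv : v * shapeElt n κ = shapeElt n h) (hl : len v + κ.degree = h.degree) :
    Builds (ω.map Fin.val) κ h := by
  obtain ⟨hω1, rfl⟩ := hω
  have hlv : len ((coxC n).wordProd ω) = ω.length := hω1.eq
  obtain ⟨ω', h1, h2⟩ := (coxC n).exists_isReduced (shapeElt n κ)
  have hlκ : ω'.length = κ.degree := by
    rw [← hκ.len_shapeElt (n := n) (by omega), h2]
    exact h1.eq.symm
  have hlh := hh.len_shapeElt (n := n) hn.le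
  rw [h2, ← CoxeterSystem.wordProd_append] at hv
  -- By additivity of lengths the concatenation is a reduced word of the element of `h`, so it
  -- builds a shape, which is `h` by injectivity; its right part builds `κ`.
  have hred : (coxC n).IsReduced (ω ++ ω') := by
    change len _ = _
    rw [hv, hlh, List.length_append]
    omega
  obtain ⟨h', hb⟩ := exists_builds_of_isMinimalRep hred
    (hv ▸ hh.isMinimalRep_shapeElt hn.le) (by rw [List.length_append]; omega)
  have hdeg := hb.degree_eq
  rw [map_zero, zero_add, List.length_map, List.length_append] at hdeg
  have he : h' = h := by
    refine shapeElt_injOn (n := n) hb.isShape_right hh (by omega) hn.le ?_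
    rw [← hb.wordVal_eq, ← wordProd_eq, hv]
  subst he
  rw [List.map_append] at hb
  obtain ⟨κ', hb1, hb2⟩ := hb.exists_of_append
  have hdeg' := hb2.degree_eq
  rw [map_zero, zero_add, List.length_map] at hdeg'
  have he : κ' = κ := by
    refine shapeElt_injOn (n := n) hb2.isShape_right hκ (by omega) (by omega) ?_
    rw [← hb2.wordVal_eq, ← wordProd_eq, h2]
  rwa [he] at hb1

theorem strip_of_mem_ZSet {v : AffineC n} {κ h : ℕ →₀ ℕ} (hv : v ∈ ZSet n) (hκ : IsShape κ)
    (hh : IsShape h) (hn : h.degree < n) (hm : v * shapeElt n κ = shapeElt n h)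
    (hl : len v + κ.degree = h.degree) : Strip κ h := by
  obtain ⟨ω, hω, k, hk⟩ := hv
  exact (hω.builds hκ hh hn hm hl).strip (n := n) (k := k) (by omega) (hk.map _)

/-- The strip is built by a subword of the rotation n, n-1, …, 1, 0, 1, …, n-1. This word is reduced
because its length equals the lower bound that subadditivity gives for the length of `v`. -/
theorem mem_ZSet_of_strip {v : AffineC n} {κ h : ℕ →₀ ℕ} (hs : Strip κ h) (hκ : IsShape κ)
    (hh : IsShape h) (hn : h.degree < n) (hm : v * shapeElt n κ = shapeElt n h) :
    v ∈ ZSet n ∧ len v + κ.degree = h.degree := by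
  obtain ⟨ω, hb, hω⟩ := hs.exists_builds hκ hh (K := n - 1) fun k hk => by
    rw [hh.eq_zero_of_degree_le (by omega),
      hκ.eq_zero_of_degree_le (hs.degree_le.trans (by omega))]
  have h1 : ω.Sublist (((cyclicWord n).rotate n).map Fin.val) := by
    rw [rotate_cyclicWord (by omega)]
    exact hω.cons _
  obtain ⟨ω', h2, rfl⟩ := List.sublist_map_iff.1 h1
  have hv : (coxC n).wordProd ω' = v := by
    have h3 := hb.wordVal_mul (n := n)
    rw [← hm, ← wordProd_eq] at h3
    exact mul_right_cancel h3
  have hdeg := hb.degree_eq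
  rw [List.length_map] at hdeg
  have h4 : len v ≤ ω'.length := by
    rw [← hv]
    exact (coxC n).length_wordProd_le ω'
  have h5 := len_mul_le v (shapeElt n κ)
  rw [hm, hh.len_shapeElt hn.le, hκ.len_shapeElt (by omega)] at h5
  refine ⟨⟨ω', ⟨?_, hv⟩, n, h2⟩, by omega⟩
  change len _ = _
  rw [hv]
  omega

/-- Every reduced word of `v` builds h/κ, so its letters are the contents of the strip. -/
theorem numComponents_eq {v : AffineC n} {κ h : ℕ →₀ ℕ} (hκ : IsShape κ)
    (hh : IsShape h) (hn : h.degree < n) (hm : v * shapeElt n κ = shapeElt n h)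
    (hl : len v + κ.degree = h.degree) :
    numComponents v = (starts true (stripContents κ h)).card := by
  have key : ∀ ω, IsReducedWordOf ω v → ∀ i, i ∈ ω ↔ i.val ∈ stripContents κ h := by
    intro ω hω i
    rw [mem_stripContents, (hω.builds hκ hh hn hm hl).apply_eq, lt_add_iff_pos_right,
      List.count_pos_iff, List.mem_map_of_injective Fin.val_injective]
  refine card_connectedComponent_pathGraph (fun k hk => ?_) fun i => ⟨?_, fun hi => ?_⟩
  · rw [mem_stripContents] at hk
    have := hh.lt_degree (k := k) (by omega)
    omega
  · rintro ⟨ω, hω, hi⟩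
    exact (key ω hω i).1 hi
  · obtain ⟨ω, h1, h2⟩ := (coxC n).exists_isReduced v
    exact ⟨ω, ⟨h1, h2.symm⟩, (key ω ⟨h1, h2.symm⟩ i).2 hi⟩

theorem eq_one_of_len_eq_zero {v : AffineC n} (hv : len v = 0) : v = 1 :=
  (coxC n).length_eq_zero_iff.1 hv

theorem len_one : len (1 : AffineC n) = 0 := (coxC n).length_one

theorem numComponents_one : numComponents (1 : AffineC n) = 0 := by
  have : IsEmpty (support (1 : AffineC n)) := by
    refine ⟨?_⟩
    rintro ⟨i, ω, ⟨h1, h2⟩, hi⟩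
    have h3 := h1.eq
    rw [h2, (coxC n).length_one, eq_comm, List.length_eq_zero_iff] at h3
    simp [h3] at hi
  rw [numComponents, Nat.card_eq_zero]
  left
  refine ⟨fun C => ?_⟩
  induction C using SimpleGraph.ConnectedComponent.ind with
  | _ v => exact this.false v

theorem one_mem_ZSet : (1 : AffineC n) ∈ ZSet n :=
  ⟨[], ⟨by simp [CoxeterSystem.IsReduced], by simp⟩, 0, List.nil_sublist _⟩

end Elements

end TypeC

end

noncomputable section

namespace TypeC

open Finset

/-! ### The generating functions of factorizations -/

section Factorizations

variable {n : ℕ}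

/-- The factorizations of `w` into `N` factors of given lengths. -/
def boundedFactorizations (N : ℕ) (a : ℕ → ℕ) (w : AffineC n) : Set (ℕ → AffineC n) :=
  {v | (∀ i, v i ∈ ZSet n) ∧ (∀ i, len (v i) = a i) ∧ ((List.range N).map v).prod = w ∧
    ∑ i ∈ range N, a i = len w}

theorem prod_map_range_eq {M : Type*} [Monoid M] {v : ℕ → M} {N N' : ℕ}
    (hv : ∀ i, N ≤ i → v i = 1) (hN : N ≤ N') :
    ((List.range N').map v).prod = ((List.range N).map v).prod := by
  induction N', hN using Nat.le_induction with
  | base => rfl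
  | succ N' h ih => rw [List.range_succ, List.map_append, List.prod_append, ih]; simp [hv N' h]

theorem sum_range_eq_of_le {a : ℕ → ℕ} {N N' : ℕ} (ha : ∀ i, N ≤ i → a i = 0) (hN : N ≤ N') :
    ∑ i ∈ range N', a i = ∑ i ∈ range N, a i := by
  symm
  refine sum_subset (range_mono hN) fun i _ hi => ha i ?_
  simpa using hi

theorem setOf_factorizations_eq {N : ℕ} {a : ℕ → ℕ} (ha : ∀ i, N ≤ i → a i = 0) (w : AffineC n) :
    {v ∈ factorizations w | ∀ i, len (v i) = a i} = boundedFactorizations N a w := by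
  ext v
  constructor
  · rintro ⟨⟨hZ, N', h1, h2, h3⟩, hl⟩
    have hv : ∀ i, N ≤ i → v i = 1 := fun i hi => eq_one_of_len_eq_zero (by rw [hl, ha i hi])
    have ha' : ∀ i, N' ≤ i → a i = 0 := fun i hi => by rw [← hl, h1 i hi, len_one]
    refine ⟨hZ, hl, ?_, ?_⟩
    · rw [← h2, ← prod_map_range_eq hv (le_max_left N N'),
        ← prod_map_range_eq h1 (le_max_right N N')]
    · rw [← h3, sum_congr rfl fun i _ => hl i, ← sum_range_eq_of_le ha (le_max_left N N'),
        ← sum_range_eq_of_le ha' (le_max_right N N')]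
  · rintro ⟨hZ, hl, h1, h2⟩
    refine ⟨⟨hZ, N, fun i hi => eq_one_of_len_eq_zero (by rw [hl, ha i hi]), h1, ?_⟩, hl⟩
    rw [sum_congr rfl fun i _ => hl i, h2]

/-- The sequence `v` with `g` added at the front. -/
def consSeq {G : Type*} (g : G) (v : ℕ → G) : ℕ → G
  | 0 => g
  | i + 1 => v i

theorem consSeq_injective {G : Type*} (g : G) : Function.Injective (consSeq g) := fun v v' h => by
  funext i
  exact congrFun h (i + 1)

theorem prod_map_range_succ {M : Type*} [Monoid M] (v : ℕ → M) (N : ℕ) :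
    ((List.range (N + 1)).map v).prod = v 0 * ((List.range N).map fun i => v (i + 1)).prod := by
  rw [List.range_succ_eq_map, List.map_cons, List.prod_cons, List.map_map]
  rfl

theorem len_prod_le (v : ℕ → AffineC n) (N : ℕ) :
    len ((List.range N).map v).prod ≤ ∑ i ∈ range N, len (v i) := by
  induction N with
  | zero => simp [len_one]
  | succ N ih =>
    rw [List.range_succ, List.map_append, List.prod_append, sum_range_succ]
    refine (len_mul_le _ _).trans ?_
    simpa using ih

open Classical in
/-- The shapes that are obtained from `h` by removing a strip of size `a`. -/
def stripShapes (a : ℕ) (h : ℕ →₀ ℕ) : Finset (ℕ →₀ ℕ) :=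
  {κ ∈ shapesLE h.degree | κ.degree + a = h.degree ∧ Strip κ h}

theorem mem_stripShapes {a : ℕ} {κ h : ℕ →₀ ℕ} :
    κ ∈ stripShapes a h ↔ IsShape κ ∧ κ.degree + a = h.degree ∧ Strip κ h := by
  simp only [stripShapes, mem_filter, mem_shapesLE]
  constructor
  · rintro ⟨⟨h1, -⟩, h2⟩
    exact ⟨h1, h2⟩
  · rintro ⟨h1, h2, h3⟩
    exact ⟨⟨h1, by omega⟩, h2, h3⟩

theorem stripOp_eq {h : ℕ →₀ ℕ} (hh : IsShape h) (a : ℕ) (f : (ℕ →₀ ℕ) → ℤ) :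
    stripOp a f h = ∑ κ ∈ stripShapes a h, 2 ^ (starts true (stripContents κ h)).card * f κ := by
  classical
  rw [stripOp, stripShapes, ← filter_filter, sum_filter (s := filter _ _)]
  refine sum_congr rfl fun κ hκ => ?_
  rw [mem_filter, mem_shapesLE] at hκ
  by_cases hs : Strip κ h
  · rw [stripWeight, if_pos ⟨hκ.1.1, hh, hs⟩, if_pos hs]
  · rw [stripWeight_of_not fun h' => hs h'.2.2, if_neg hs, zero_mul]

/-- The product of the factors after the first is again a minimal representative, hence the element
of a shape `κ`; membership of the first factor in 𝒵 means that h/κ is a strip. -/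
theorem boundedFactorizations_succ {h : ℕ →₀ ℕ} (hh : IsShape h) (hn : h.degree < n) (N : ℕ)
    (a : ℕ → ℕ) : boundedFactorizations (N + 1) a (shapeElt n h) =
      ⋃ κ ∈ (stripShapes (a 0) h : Set (ℕ →₀ ℕ)),
        Set.image (consSeq (shapeElt n h * (shapeElt n κ)⁻¹))
          (boundedFactorizations N (fun i => a (i + 1)) (shapeElt n κ)) := by
  have hlh := hh.len_shapeElt (n := n) hn.le
  ext v
  simp only [Set.mem_iUnion, Set.mem_image, exists_prop, mem_coe, mem_stripShapes]
  constructor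
  · rintro ⟨hZ, hl, hp, hs⟩
    rw [prod_map_range_succ] at hp
    rw [sum_range_succ', hlh] at hs
    have h1 := len_prod_le (fun i => v (i + 1)) N
    simp only [hl] at h1
    have h2 := len_mul_le (v 0) ((List.range N).map fun i => v (i + 1)).prod
    rw [hp, hlh, hl] at h2
    generalize hu : ((List.range N).map fun i => v (i + 1)).prod = u at *
    have hlu : len u = ∑ i ∈ range N, a (i + 1) := by omega
    have hum : IsMinimalRep u := by
      refine isMinimalRep_of_mul (v := v 0) ?_ ?_
      · rw [hp]
        exact hh.isMinimalRep_shapeElt hn.le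
      · rw [hp, hlh, hl, hlu]
        omega
    obtain ⟨κ, hκ, hκd, rfl⟩ := hum.exists_shape (by omega)
    have hld : len (v 0) + κ.degree = h.degree := by rw [hl]; omega
    refine ⟨κ, ⟨hκ, by omega, strip_of_mem_ZSet (hZ 0) hκ hh hn hp hld⟩, fun i => v (i + 1),
      ⟨fun i => hZ _, fun i => hl _, hu, hlu.symm⟩, ?_⟩
    funext i
    cases i with
    | zero => rw [consSeq, ← hp, mul_inv_cancel_right]
    | succ i => rfl
  · rintro ⟨κ, ⟨hκ, hd, hs⟩, v, ⟨hZ, hl, hp, hsum⟩, rfl⟩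
    have hlκ := hκ.len_shapeElt (n := n) (by omega)
    have hm : shapeElt n h * (shapeElt n κ)⁻¹ * shapeElt n κ = shapeElt n h :=
      inv_mul_cancel_right _ _
    obtain ⟨hZ0, hl0⟩ := mem_ZSet_of_strip hs hκ hh hn hm
    refine ⟨?_, ?_, ?_, ?_⟩
    · rintro (_ | i)
      exacts [hZ0, hZ i]
    · rintro (_ | i)
      · rw [consSeq]
        omega
      · exact hl i
    · rw [prod_map_range_succ]
      change _ * ((List.range N).map v).prod = _
      rw [hp]
      exact hm
    · rw [sum_range_succ', hsum, hlκ, hlh, hd]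

/-- The first factor adds the last strip, whereas `chainCount` puts the last exponent on the last
strip. The order is reversed by `chainCount_succ'`, which relies on the commutation of the strip
operators. -/
theorem finsum_boundedFactorizations {h : ℕ →₀ ℕ} (hh : IsShape h) (hn : h.degree < n) {N : ℕ}
    {a : ℕ → ℕ} (ha : ∀ i, N ≤ i → a i = 0) :
    (boundedFactorizations N a (shapeElt n h)).Finite ∧
      ∑ᶠ v ∈ boundedFactorizations N a (shapeElt n h),
        ∏ i ∈ range N, (2 : ℤ) ^ numComponents (v i) = chainCount true a N h := by
  induction N generalizing h a with
  | zero =>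
    have hlh := hh.len_shapeElt (n := n) hn.le
    by_cases h0 : h = 0
    · subst h0
      have : boundedFactorizations 0 a (shapeElt n 0) = {1} := by
        rw [shapeElt_zero]
        ext v
        rw [Set.mem_singleton_iff]
        constructor
        · rintro ⟨-, hl, -⟩
          funext i
          exact eq_one_of_len_eq_zero (by rw [hl, ha i (Nat.zero_le i)])
        · rintro rfl
          exact ⟨fun i => one_mem_ZSet, fun i => by rw [Pi.one_apply, len_one, ha i (Nat.zero_le i)],
            rfl, by simp [len_one]⟩
      rw [this]
      exact ⟨Set.finite_singleton _, by rw [finsum_mem_singleton]; simp [chainCount]⟩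
    · have : boundedFactorizations 0 a (shapeElt n h) = ∅ := by
        refine Set.eq_empty_of_forall_notMem ?_
        rintro v ⟨-, -, -, h4⟩
        rw [hlh, sum_range_zero, eq_comm, Finsupp.degree_eq_zero_iff] at h4
        exact h0 h4
      rw [this]
      exact ⟨Set.finite_empty, by rw [finsum_mem_empty]; simp [chainCount, h0]⟩
  | succ N ih =>
    have hih : ∀ κ ∈ stripShapes (a 0) h, _ := fun κ hκ =>
      ih (h := κ) (a := fun i => a (i + 1)) (mem_stripShapes.1 hκ).1
        (by have := (mem_stripShapes.1 hκ).2.1; omega) fun i hi => ha (i + 1) (by omega)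
    have hfin : ∀ κ ∈ (stripShapes (a 0) h : Set (ℕ →₀ ℕ)),
        (Set.image (consSeq (shapeElt n h * (shapeElt n κ)⁻¹))
          (boundedFactorizations N (fun i => a (i + 1)) (shapeElt n κ))).Finite :=
      fun κ hκ => (hih κ hκ).1.image _
    rw [boundedFactorizations_succ hh hn]
    refine ⟨(Finset.finite_toSet _).biUnion hfin, ?_⟩
    rw [finsum_mem_biUnion ?_ (Finset.finite_toSet _) hfin, finsum_mem_coe_finset,
      chainCount_succ', stripOp_eq hh]
    · refine sum_congr rfl fun κ hκ => ?_
      rw [finsum_mem_image (consSeq_injective _).injOn, ← (hih κ hκ).2, mul_finsum_mem]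
      rw [mem_stripShapes] at hκ
      have hm : shapeElt n h * (shapeElt n κ)⁻¹ * shapeElt n κ = shapeElt n h :=
        inv_mul_cancel_right _ _
      rw [← numComponents_eq hκ.1 hh hn hm (mem_ZSet_of_strip hκ.2.2 hκ.1 hh hn hm).2]
      refine finsum_mem_congr rfl fun v _ => ?_
      rw [prod_range_succ', mul_comm]
      rfl
    · intro κ hκ κ' hκ' hne
      rw [Function.onFun, Set.disjoint_left]
      rintro _ ⟨v, -, rfl⟩ ⟨v', -, hv⟩
      have h1 := congrFun hv 0
      simp only [consSeq, mul_right_inj, inv_inj] at h1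
      rw [mem_coe, mem_stripShapes] at hκ hκ'
      exact hne (shapeElt_injOn (n := n) hκ.1 hκ'.1 (by omega) (by omega) h1.symm)

theorem typeCQ_shapeElt {h : ℕ →₀ ℕ} (hh : IsShape h) (hn : h.degree < n) :
    typeCQ n (shapeElt n h) = schurQ (ofShape h) := by
  ext α
  obtain ⟨N, hN⟩ := exists_bound α
  rw [coeff_schurQ _ hN, ht_ofShape hh, ← (finsum_boundedFactorizations hh hn hN).2,
    ← setOf_factorizations_eq hN]
  refine finsum_mem_congr rfl fun v hv => prod_subset (fun i hi => ?_) fun i _ hi => ?_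
  · by_contra h1
    rw [mem_range, not_lt] at h1
    exact Finsupp.mem_support_iff.1 hi (hN i h1)
  -- Outside the support of `α` the factor is 1, whose support has no component.
  · rw [eq_one_of_len_eq_zero (v := v i) (by rw [hv.2 i]; simpa using hi), numComponents_one,
      pow_zero]

end Factorizations

end TypeC

end

noncomputable section

namespace TypeC

open Finset

/-! ### Expansions in a graded family -/

section Graded

variable {F : StrictPartition → MvPowerSeries ℕ ℤ}

theorem coeff_linearCombination (a : StrictPartition →₀ ℤ) (α : ℕ →₀ ℕ) :
    MvPowerSeries.coeff α (a.sum fun lam x => x • F lam) =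
      ∑ lam ∈ a.support, a lam * MvPowerSeries.coeff α (F lam) := by
  rw [Finsupp.sum, map_sum]
  exact sum_congr rfl fun lam _ => coeff_zsmul _ _ _

theorem eq_of_sum_eq (hF : ∀ a : StrictPartition →₀ ℤ, (a.sum fun lam x => x • F lam) = 0 → a = 0)
    {a b : StrictPartition →₀ ℤ}
    (hab : (a.sum fun lam x => x • F lam) = b.sum fun lam x => x • F lam) : a = b := by
  rw [← sub_eq_zero]
  refine hF _ ?_
  rw [Finsupp.sum_sub_index fun lam x y => sub_smul x y (F lam), hab, sub_self]

/-- The part of an expansion in a given degree is determined by the coefficients of the monomials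
of this degree. -/
theorem filter_degree_eq
    (hF : ∀ a : StrictPartition →₀ ℤ, (a.sum fun lam x => x • F lam) = 0 → a = 0)
    (hdeg : ∀ (lam : StrictPartition) (α : ℕ →₀ ℕ), α.degree ≠ lam.ht.degree →
      MvPowerSeries.coeff α (F lam) = 0) {m : ℕ} {a b : StrictPartition →₀ ℤ}
    (hab : ∀ α : ℕ →₀ ℕ, α.degree = m → MvPowerSeries.coeff α (a.sum fun lam x => x • F lam) =
      MvPowerSeries.coeff α (b.sum fun lam x => x • F lam)) :
    a.filter (fun lam => lam.ht.degree = m) = b.filter fun lam => lam.ht.degree = m := by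
  have key : ∀ (a : StrictPartition →₀ ℤ) (α : ℕ →₀ ℕ), MvPowerSeries.coeff α
      ((a.filter fun lam => lam.ht.degree = m).sum fun lam x => x • F lam) =
      if α.degree = m then MvPowerSeries.coeff α (a.sum fun lam x => x • F lam) else 0 := by
    intro a α
    rw [coeff_linearCombination, coeff_linearCombination, Finsupp.support_filter, sum_filter]
    split_ifs with hα
    · refine sum_congr rfl fun lam _ => ?_
      split_ifs with h1
      · rw [Finsupp.filter_apply_pos (fun lam : StrictPartition => lam.ht.degree = m) a h1]
      · rw [hdeg lam α (by omega), mul_zero]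
    · refine sum_eq_zero fun lam _ => ?_
      split_ifs with h1
      · rw [hdeg lam α (by omega), mul_zero]
      · rfl
  refine eq_of_sum_eq hF ?_
  ext α
  rw [key, key]
  split_ifs with hα
  · exact hab α hα
  · rfl

end Graded

theorem sum_single_smul (F : StrictPartition → MvPowerSeries ℕ ℤ) (lam : StrictPartition) :
    ((Finsupp.single lam (1 : ℤ)).sum fun lam x => x • F lam) = F lam := by
  exact (Finsupp.sum_single_index (zero_smul ℤ (F lam))).trans (one_smul ℤ _)

/-! ### Type C k-Schur functions -/

section KSchur

variable {n : ℕ}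

/-- No exponent exceeds the degree, so truncation is invisible in degree at most 2n. -/
theorem coeff_truncation (f : MvPowerSeries ℕ ℤ) {α : ℕ →₀ ℕ} (hα : α.degree ≤ 2 * n) :
    MvPowerSeries.coeff α (truncation n f) = MvPowerSeries.coeff α f :=
  if_pos fun i => (Finsupp.le_degree i α).trans hα

theorem truncation_schurQ {lam : StrictPartition} (hn : lam.ht.degree ≤ 2 * n) :
    truncation n (schurQ lam) = schurQ lam := by
  ext α
  by_cases hα : α.degree ≤ 2 * n
  · exact coeff_truncation _ hα
  · have h1 : MvPowerSeries.coeff α (schurQ lam) = 0 := coeff_schurQ_eq_zero (by omega)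
    rw [h1]
    classical
    change ite _ (MvPowerSeries.coeff α (schurQ lam)) (0 : ℤ) = 0
    rw [h1, ite_self]

theorem isHomogeneous_schurP (lam : StrictPartition) :
    (schurP lam).IsHomogeneous lam.ht.degree := fun {d} hd => by
  by_contra h
  refine hd (coeff_schurP_eq_zero fun h' => h ?_)
  rw [← h', Finsupp.degree_eq_weight_one]
  rfl

theorem schurP_mem_GammaLower {lam : StrictPartition} (hn : lam.ht.degree ≤ 2 * n) :
    schurP lam ∈ GammaLower n := by
  have := shapeP_mem lam.isShape_ht hn
  rwa [shapeP, ofShape_ht] at this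

theorem typeCQ_eq {lam : StrictPartition} (hn : lam.ht.degree < n) :
    typeCQ n (shapeElt n lam.ht) = schurQ lam := by
  rw [typeCQ_shapeElt lam.isShape_ht hn, ofShape_ht]

theorem pairingEq_schurP_schurQ {lam mu : StrictPartition} (hn : mu.ht.degree ≤ 2 * n) :
    PairingEq n (schurP lam) (schurQ mu) (open Classical in if mu = lam then 1 else 0) := by
  classical
  refine ⟨Finsupp.single lam 1, Finsupp.single mu 1, (sum_single_smul _ _).symm, ?_, ?_⟩
  · rw [sum_single_smul, truncation_schurQ hn]
  · rw [Finsupp.sum_single_index (zero_mul _), one_mul, Finsupp.single_apply]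

/-- Pairing a homogeneous combination of Schur P-functions with a Schur Q-function extracts a
coefficient. -/
theorem PairingEq.eq_coeff {a : StrictPartition →₀ ℤ} {mu : StrictPartition} {c : ℤ}
    (hp : PairingEq n (a.sum fun lam x => x • schurP lam) (schurQ mu) c)
    (ha : ∀ lam ∈ a.support, lam.ht.degree = mu.ht.degree) (hn : mu.ht.degree ≤ 2 * n) :
    c = a mu := by
  obtain ⟨a', b, h1, h2, rfl⟩ := hp
  obtain rfl := eq_of_sum_eq (fun _ => schurP_independent) h1
  -- The lift of a truncated series is not unique, but its part in the degree of `mu` is, because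
  -- truncation keeps that degree and the Q-functions are independent.
  have hb : b.filter (fun lam => lam.ht.degree = mu.ht.degree) = Finsupp.single mu 1 := by
    have h3 : (Finsupp.single mu (1 : ℤ)).filter (fun lam => lam.ht.degree = mu.ht.degree) =
        Finsupp.single mu 1 := Finsupp.filter_single_of_pos _ rfl
    rw [← h3]
    refine filter_degree_eq (fun _ => schurQ_independent) (fun _ _ => coeff_schurQ_eq_zero)
      fun α hα => ?_
    rw [sum_single_smul, h2, coeff_truncation _ (by omega)]
  rw [Finsupp.sum, sum_congr rfl fun lam hlam => by
    rw [← Finsupp.filter_apply_pos (fun lam : StrictPartition => lam.ht.degree = mu.ht.degree) b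
      (ha lam hlam), hb]]
  by_cases hmu : mu ∈ a.support
  · rw [sum_eq_single_of_mem mu hmu fun lam _ hne => by rw [Finsupp.single_eq_of_ne hne, mul_zero],
      Finsupp.single_eq_same, mul_one]
  · rw [sum_eq_zero fun lam hlam => by
      rw [Finsupp.single_eq_of_ne (ne_of_mem_of_not_mem hlam hmu), mul_zero]]
    exact (Finsupp.notMem_support_iff.1 hmu).symm

/-- Homogeneity restricts the P-expansion of `f` to shapes of the size of `lam`. For each of them
the pairing condition at the corresponding minimal representative prescribes the coefficient, as its
Q-function is a Schur Q-function. -/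
theorem isTypeCKSchur_iff {lam : StrictPartition} (hn : lam.ht.degree < n)
    (f : MvPowerSeries ℕ ℤ) : IsTypeCKSchur n (shapeElt n lam.ht) f ↔ f = schurP lam := by
  have hlen : ∀ {mu : StrictPartition}, mu.ht.degree < n → len (shapeElt n mu.ht) = mu.ht.degree :=
    fun {mu} hmu => mu.isShape_ht.len_shapeElt hmu.le
  constructor
  · rintro ⟨-, hhom, hpair⟩
    rw [hlen hn] at hhom hpair
    -- The pairing with the element of `lam` itself supplies an expansion of `f` in Schur
    -- P-functions.
    obtain ⟨a, -, rfl, -⟩ := hpair _ (lam.isShape_ht.isMinimalRep_shapeElt hn.le) (hlen hn)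
    have ha : ∀ mu, mu.ht.degree ≠ lam.ht.degree → a mu = 0 := by
      intro mu hmu
      have h1 : a.filter (fun nu => nu.ht.degree = mu.ht.degree) =
          (0 : StrictPartition →₀ ℤ).filter fun nu => nu.ht.degree = mu.ht.degree :=
        filter_degree_eq (fun _ => schurP_independent) (fun _ _ => coeff_schurP_eq_zero)
          fun α hα => by
            rw [hhom.coeff_eq_zero (by omega), Finsupp.sum_zero_index, map_zero]
      have h2 := DFunLike.congr_fun h1 mu
      rwa [Finsupp.filter_zero, Finsupp.filter_apply_pos
        (fun nu : StrictPartition => nu.ht.degree = mu.ht.degree) a rfl] at h2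
    have hsupp : ∀ mu ∈ a.support, mu.ht.degree = lam.ht.degree := fun mu hmu => by
      by_contra h
      exact Finsupp.mem_support_iff.1 hmu (ha mu h)
    have hval : a = Finsupp.single lam 1 := by
      classical
      ext mu
      by_cases hmu : mu.ht.degree = lam.ht.degree
      · have hmun : mu.ht.degree < n := by omega
        have h1 := hpair _ (mu.isShape_ht.isMinimalRep_shapeElt hmun.le) (by rw [hlen hmun, hmu])
        rw [typeCQ_eq hmun] at h1
        rw [← h1.eq_coeff (fun nu hnu => by rw [hsupp nu hnu, hmu]) (by omega),
          Finsupp.single_apply]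
        refine if_congr ⟨fun h => ?_, fun h => by rw [h]⟩ rfl rfl
        exact (StrictPartition.ht_injective
          (shapeElt_injOn mu.isShape_ht lam.isShape_ht hmun.le hn.le h)).symm
      · rw [ha mu hmu, Finsupp.single_eq_of_ne fun h => hmu (by rw [h])]
    rw [hval, sum_single_smul]
  · rintro rfl
    refine ⟨schurP_mem_GammaLower (by omega), ?_, fun v hv hl => ?_⟩
    · rw [hlen hn]
      exact isHomogeneous_schurP lam
    · rw [hlen hn] at hl
      obtain ⟨h, hh, hd, rfl⟩ := hv.exists_shape (by omega)
      obtain ⟨mu, rfl⟩ : ∃ mu : StrictPartition, mu.ht = h := ⟨ofShape h, ht_ofShape hh⟩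
      rw [hl] at hd
      rw [typeCQ_eq (by omega)]
      have hp := pairingEq_schurP_schurQ (n := n) (lam := lam) (mu := mu) (by omega)
      by_cases hmu : mu = lam
      · rw [if_pos hmu] at hp
        rwa [if_pos (by rw [hmu])]
      · rw [if_neg hmu] at hp
        rwa [if_neg fun h => hmu (StrictPartition.ht_injective
          (shapeElt_injOn hh lam.isShape_ht (by omega) hn.le h))]

end KSchur

end TypeC

end

theorem mainTheorem6 (n : ℕ) (w : TypeC.AffineC n) (hw : TypeC.IsMinimalRep w)
    (hn : TypeC.len w < n) :
    ∃ lam : TypeC.StrictPartition,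
      (∀ f : MvPowerSeries ℕ ℤ, TypeC.IsTypeCKSchur n w f ↔ f = TypeC.schurP lam) ∧
      TypeC.typeCQ n w = TypeC.schurQ lam := by
  obtain ⟨h, hh, hd, rfl⟩ := hw.exists_shape hn
  obtain ⟨lam, rfl⟩ : ∃ lam : TypeC.StrictPartition, lam.ht = h :=
    ⟨TypeC.ofShape h, TypeC.ht_ofShape hh⟩
  rw [← hd] at hn
  exact ⟨lam, TypeC.isTypeCKSchur_iff hn, TypeC.typeCQ_eq hn⟩
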